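/- **Setting.** Let $p$ be a prime, $K$ a complete discretely valued field of characteristic $0$ with perfect residue field $k$ of characteristic $p$, $\overline K$ an algebraic closure of $K$, $G=\mathrm{Gal}(\overline K/K)$, and $v_p$ the valuation of $\overline K$ with $v_p(p)=1$. Let $R=\varprojlim \mathcal O_{\overline K}/p$ (transition maps $x\mapsto x^p$), with valuation $v_R(x)=\lim_{n}v_p(\hat x_n^{p^n})$ for $x=(x_n)_n$, where $\hat x_n\in\mathcal O_{\overline K}$ is any lift of $x_n$. The ring $W(R)$ of Witt vectors carries its Frobenius $\varphi$, its action of $G$ and its weak topology (the product topology, each component $R$ having its valuation topology). Let $\theta\colon W(R)\to\mathcal O_{\mathbb C_p}=\varprojlim_m\mathcal O_{\overline K}/p^m$ be Fontaine's map, and put $\mathrm{Fil}^1W(R)=\ker\theta$ and $$I^{[1]}W(R)=\{x\in W(R)\mid \varphi^n(x)\in \mathrm{Fil}^1W(R)\text{ for all }n\ge 0\}.$$ Fix a uniformizer $\pi$ of $K$, a polynomial $f(u)=u^p+a_{p-1}u^{p-1}+\cdots+a_1u\in\mathbb Z_p[u]$ with $f(u)\equiv u^p \bmod p$, and a sequence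 $(\pi_n)_{n\ge 0}$ in $\mathcal O_{\overline K}$ with $\pi_0=\pi$ and $f(\pi_{n+1})=\pi_n$ for all $n\geq 0$. Put $\underline\pi=(\pi_n\bmod p)_n\in R$, $K_{\underline\pi}=\bigcup_n K(\pi_n)$ and $G_{\underline\pi}=\mathrm{Gal}(\overline K/K_{\underline\pi})$. There is a unique set-theoretic section $\{\cdot\}_f\colon R\to W(R)$ of reduction modulo $p$ with $\varphi(\{x\}_f)=f(\{x\}_f)$ for all $x$. Let $\mathfrak S=W(k)[\![u]\!]$, with the Frobenius $\varphi$ that extends the one of $W(k)$ and sends $u$ to $f(u)$, be regarded as a $\varphi$-stable $W(k)$-subalgebra of $W(R)$ via $u\mapsto\{\underline\pi\}_f$. Let $E(u)$ be the minimal polynomial of $\pi$ over $W(k)[1/p]$. A *torsion Kisin module of height $r$* ($r\ge 0$ an integer) is a finitely generated $\mathfrak S$-module $\mathfrak M$ with a $\varphi$-semilinear map $\varphi_{\mathfrak M}\colon\mathfrak M\to\mathfrak M$ such that $\mathfrak M$ is killed by a power of $p$, the annihilator of each nonzero $x\in\mathfrak M$ is $0$ or $p^n\mathfrak S$ for some $n$,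 and the cokernel of $1\otimes\varphi_{\mathfrak M}\colon\varphi^*\mathfrak M=\mathfrak S\otimes_{\varphi,\mathfrak S}\mathfrak M\to\mathfrak M$ is killed by $E(u)^r$. Morphisms are the $\mathfrak S$-linear maps commuting with $\varphi$; the category is denoted $\mathrm{Mod}^r_{\mathfrak S_\infty}$. A *torsion $(\varphi,G)$-module of height $r$* is such an $\mathfrak M$ together with a continuous $W(R)$-semilinear action of $G$ on $W(R)\otimes_{\varphi,\mathfrak S}\mathfrak M$ that commutes with $\varphi_{W(R)}\otimes\varphi_{\mathfrak M}$ and for which $G_{\underline\pi}$ fixes the image of $\varphi^*\mathfrak M$. It is denoted $\hat{\mathfrak M}$. Morphisms $\hat{\mathfrak M}\to\hat{\mathfrak N}$ are the morphisms $h\colon\mathfrak M\to\mathfrak N$ of Kisin modules for which $\mathrm{id}_{W(R)}\otimes h$ commutes with $G$. For $\alpha\in W(R)\smallsetminus pW(R)$ let $\mathrm{Mod}^{r,G}_{\mathfrak S_\infty}(\alpha)$ be the full subcategory of those torsion $(\varphi,G)$-modules $\hat{\mathfrak M}$ of height $r$ such that $$g(1\otimes x)-(1\otimes x)\in \alpha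 I^{[1]}W(R)\otimes_{\varphi,\mathfrak S}\mathfrak M\qquad\text{for all } g\in G,\ x\in\mathfrak M,$$ where the right-hand side denotes the submodule $(\alpha I^{[1]}W(R))\cdot(W(R)\otimes_{\varphi,\mathfrak S}\mathfrak M)$. Let $\bar\alpha=\alpha\bmod pW(R)\in R$. **Theorem.** Let $\alpha\in W(R)\smallsetminus pW(R)$ and let $r\ge 0$ be an integer with $v_R(\bar\alpha)>p(r-1)/(p-1)$. For every integer $r'\ge 0$, every $\hat{\mathfrak M}\in\mathrm{Mod}^{r,G}_{\mathfrak S_\infty}(\alpha)$ and every $\hat{\mathfrak N}\in\mathrm{Mod}^{r',G}_{\mathfrak S_\infty}(\alpha)$ we have $$\mathrm{Hom}(\hat{\mathfrak M},\hat{\mathfrak N})=\mathrm{Hom}(\mathfrak M,\mathfrak N),$$ that is, every morphism $\mathfrak M\to\mathfrak N$ of the underlying Kisin modules is compatible with the $G$-actions. In particular, the forgetful functor $\mathrm{Mod}^{r,G}_{\mathfrak S_\infty}(\alpha)\to\mathrm{Mod}^{r}_{\mathfrak S_\infty}$ is fully faithful. -/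

import Mathlib

universe w

noncomputable section

namespace CaisLiu

open scoped NNReal

section Fields

/-- The ring of integers of a nonarchimedean normed field. -/
abbrev IntegerRing (K : Type*) [NontriviallyNormedField K] [IsUltrametricDist K] : Type _ :=
  (NormedField.valuation (K := K)).integer

variable (K : Type*) [NontriviallyNormedField K] [IsUltrametricDist K] [CompleteSpace K]
  (L : Type*) [Field L] [Algebra K L] [Algebra.IsAlgebraic K L]

/-- The unique extension of the absolute value of the complete field `K` to an algebraic
extension `L` (the spectral norm), as a valuation. -/
def absVal : Valuation L ℝ≥0 where
  toFun y := ⟨spectralNorm K L y, spectralNorm_nonneg y⟩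
  map_zero' := by ext; exact spectralNorm_zero
  map_one' := by ext; exact spectralNorm_one
  map_mul' x y := by ext; exact spectralAlgNorm_mul x y
  map_add_le_max' x y := isNonarchimedean_spectralNorm x y

/-- The ring of integers of the algebraic extension `L` of `K`. -/
abbrev BigIntegerRing : Type _ := (absVal K L).integer

/-- The inclusion of rings of integers. -/
def inclO : IntegerRing K →+* BigIntegerRing K L :=
  ((algebraMap K L).comp (NormedField.valuation (K := K)).integer.subtype).codRestrict
    (absVal K L).integer (fun x => by
      have h : (NormedField.valuation (K := K)) x.1 ≤ 1 := x.2
      show absVal K L (algebraMap K L x.1) ≤ 1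
      have h2 : absVal K L (algebraMap K L x.1) = NormedField.valuation x.1 := by
        ext; exact spectralNorm_extends x.1
      rw [h2]; exact h)

variable {K L} in
/-- The action of the Galois group on the ring of integers of `L`. -/
def galO (g : L ≃ₐ[K] L) : BigIntegerRing K L →+* BigIntegerRing K L :=
  ((g : L →+* L).comp (absVal K L).integer.subtype).codRestrict
    (absVal K L).integer (fun x => by
      have h : absVal K L x.1 ≤ 1 := x.2
      show absVal K L (g x.1) ≤ 1
      have h2 : absVal K L (g x.1) = absVal K L x.1 := by
        ext; exact (spectralNorm_eq_of_equiv g x.1).symm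
      rw [h2]; exact h)

variable {K} in
theorem norm_le_one (x : IntegerRing K) : ‖(x : K)‖ ≤ 1 := x.2

variable (p : ℕ) [Fact p.Prime] [hn : Fact (‖(p : K)‖ = (p : ℝ)⁻¹)]

theorem norm_p_lt_one : ‖(p : K)‖ < 1 := by
  rw [hn.out]
  exact inv_lt_one_of_one_lt₀ (by exact_mod_cast (Fact.out : p.Prime).one_lt)

instance notUnitO : Fact (¬ IsUnit (p : IntegerRing K)) := ⟨fun h => by
  have := (Valuation.integer.integers (NormedField.valuation (K := K))).isUnit_iff_valuation_eq_one.1 h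
  have h2 := norm_p_lt_one K p
  rw [map_natCast] at this
  have h3 : ‖(p : K)‖ = 1 := congrArg NNReal.toReal this
  linarith⟩

instance notUnitBigO : Fact (¬ IsUnit (p : BigIntegerRing K L)) := ⟨fun h => by
  have := (Valuation.integer.integers (absVal K L)).isUnit_iff_valuation_eq_one.1 h
  have h2 := norm_p_lt_one K p
  rw [map_natCast, ← map_natCast (algebraMap K L)] at this
  have h3 : spectralNorm K L (algebraMap K L p) = 1 := congrArg NNReal.toReal this
  rw [spectralNorm_extends] at h3
  linarith⟩

/-- `K` being complete, its ring of integers is `p`-adically complete. -/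
instance adicCompleteO : IsAdicComplete (Ideal.span {(p : IntegerRing K)}) (IntegerRing K) := by
  have hp0 : (p : K) ≠ 0 := by
    intro h
    have := hn.out
    rw [h, norm_zero] at this
    exact (inv_ne_zero (Nat.cast_ne_zero.2 (Fact.out : p.Prime).ne_zero)) this.symm
  have hq := norm_p_lt_one K p
  have key : ∀ (n : ℕ) (x y : IntegerRing K),
      x ≡ y [SMOD (Ideal.span {(p : IntegerRing K)} ^ n • ⊤ : Submodule (IntegerRing K) (IntegerRing K))]
        ↔ ‖(x : K) - y‖ ≤ ‖(p : K)‖ ^ n := by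
    intro n x y
    rw [smul_eq_mul, Ideal.mul_top, SModEq.sub_mem, Ideal.span_singleton_pow,
      Ideal.mem_span_singleton]
    constructor
    · rintro ⟨z, hz⟩
      have : (x : K) - y = (p : K) ^ n * z := by
        have := congrArg (Subtype.val) hz
        simpa using this
      rw [this, norm_mul, norm_pow]
      exact mul_le_of_le_one_right (by positivity) (norm_le_one z)
    · intro h
      refine ⟨⟨((x : K) - y) / p ^ n, ?_⟩, ?_⟩
      · show ‖((x : K) - y) / p ^ n‖ ≤ 1
        rw [norm_div, norm_pow]
        exact div_le_one_of_le₀ h (by positivity)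
      · ext
        simp
        field_simp
  have hlim : Filter.Tendsto (fun n : ℕ => ‖(p : K)‖ ^ n) Filter.atTop (nhds 0) :=
    tendsto_pow_atTop_nhds_zero_of_lt_one (norm_nonneg _) hq
  refine { haus' := ?_, prec' := ?_ }
  · intro x hx
    have : ‖(x : K)‖ ≤ 0 := ge_of_tendsto' hlim fun n => by
      simpa using (key n x 0).1 (hx n)
    ext
    simpa using this
  · intro f hf
    have hb : ∀ m n, m ≤ n → ‖(f m : K) - f n‖ ≤ ‖(p : K)‖ ^ m := fun m n h =>
      (key m _ _).1 (hf h)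
    have hc : CauchySeq (fun n => (f n : K)) :=
      cauchySeq_of_le_tendsto_0' (fun n => ‖(p : K)‖ ^ n)
        (fun m n h => by rw [dist_eq_norm]; exact hb m n h) hlim
    obtain ⟨l, hl⟩ := cauchySeq_tendsto_of_complete hc
    have hl1 : ‖l‖ ≤ 1 := le_of_tendsto' hl.norm fun n => norm_le_one (f n)
    refine ⟨⟨l, hl1⟩, fun n => (key n _ _).2 ?_⟩
    refine le_of_tendsto (hl.const_sub (f n : K)).norm ?_
    filter_upwards [Filter.eventually_ge_atTop n] with m hm using hb n m hm

end Fields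

section Tilt
variable (p : ℕ) [Fact p.Prime]

section Functoriality
variable {A B : Type*} [CommRing A] [CommRing B] [Fact (¬ IsUnit (p : A))] [Fact (¬ IsUnit (p : B))]

/-- `A / p → B / p` induced by `A → B`. -/
def modPMap (h : A →+* B) : ModP A p →+* ModP B p :=
  Ideal.quotientMap _ h (by
    rw [Ideal.span_le, Set.singleton_subset_iff]
    simp [Ideal.mem_span_singleton])

/-- The map `lim A / p → lim B / p` induced by `A → B`. -/
def tiltMap (h : A →+* B) : PreTilt A p →+* PreTilt B p :=
  Perfection.map p (modPMap p h)

end Functoriality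

section Residue
variable (A : Type*) [CommRing A] [IsLocalRing A] [hA : Fact (¬ IsUnit (p : A))]

/-- The residue map `A / p → k`. -/
def modPResidue : ModP A p →+* IsLocalRing.ResidueField A :=
  Ideal.Quotient.lift _ (IsLocalRing.residue A) (fun a ha => by
    rw [IsLocalRing.residue_eq_zero_iff]
    exact (Ideal.span_le.2 (Set.singleton_subset_iff.2
      ((IsLocalRing.mem_maximalIdeal _).2 hA.out))) ha)

/-- Reduction of the zeroth component, `lim A / p → k`. -/
def tiltResidue : PreTilt A p →+* IsLocalRing.ResidueField A :=
  (modPResidue p A).comp (PreTilt.coeff 0)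

theorem charPResidue : CharP (IsLocalRing.ResidueField A) p :=
  (CharP.charP_iff_prime_eq_zero Fact.out).2 (by
    have h : ((p : ℕ) : ModP A p) = 0 := CharP.cast_eq_zero _ _
    have h2 := congrArg (modPResidue p A) h
    rwa [map_natCast, map_zero] at h2)

theorem modPResidue_surjective : Function.Surjective (modPResidue p A) := fun x => by
  obtain ⟨a, rfl⟩ := IsLocalRing.residue_surjective x
  exact ⟨Ideal.Quotient.mk _ a, rfl⟩

theorem tiltResidue_bijective [PerfectField (IsLocalRing.ResidueField A)]
    (hm : ∃ N : ℕ, ∀ x : ModP A p, modPResidue p A x = 0 → x ^ p ^ N = 0) :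
    Function.Bijective (tiltResidue p A) := by
  have := charPResidue p A
  have : ExpChar (IsLocalRing.ResidueField A) p := ExpChar.prime Fact.out
  have : PerfectRing (IsLocalRing.ResidueField A) p := PerfectField.toPerfectRing p
  have : ExpChar (ModP A p) p := ExpChar.prime Fact.out
  obtain ⟨N, hN⟩ := hm
  have hp0 : ∀ n, p ^ n ≠ 0 := fun n => pow_ne_zero n (Fact.out : p.Prime).ne_zero
  have hco : ∀ (x : PreTilt A p) (n j : ℕ), PreTilt.coeff (n + j) x ^ p ^ j = PreTilt.coeff n x := by
    intro x n j
    induction j with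
    | zero => simp
    | succ j ih => rw [pow_succ', pow_mul, ← add_assoc, PreTilt.coeff_pow_p, ih]
  constructor
  · rw [injective_iff_map_eq_zero]
    intro x hx
    refine Perfection.ext fun n => ?_
    show PreTilt.coeff n x = 0
    have h1 : ∀ n, modPResidue p A (PreTilt.coeff n x) = 0 := by
      intro n
      have := hco x 0 n
      rw [zero_add] at this
      have h2 : modPResidue p A (PreTilt.coeff 0 x) = 0 := hx
      rw [← this, map_pow] at h2
      exact eq_zero_of_pow_eq_zero h2
    rw [← hco x n N]
    exact hN _ (h1 _)
  · intro a
    choose b hb using fun n : ℕ =>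
      modPResidue_surjective p A ((frobeniusEquiv (IsLocalRing.ResidueField A) p).symm^[n] a)
    refine ⟨(⟨fun n => b (n + N) ^ p ^ N, fun n => ?_⟩ : Perfection (ModP A p) p), ?_⟩
    · show (b (n + 1 + N) ^ p ^ N) ^ p = b (n + N) ^ p ^ N
      rw [← sub_eq_zero, pow_right_comm, ← sub_pow_expChar_pow]
      apply hN
      rw [map_sub, map_pow, hb, hb, sub_eq_zero, show n + 1 + N = (n + N) + 1 by ring,
        Function.iterate_succ_apply']
      exact frobeniusEquiv_symm_pow_p (IsLocalRing.ResidueField A) p _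
    · show modPResidue p A (b (0 + N) ^ p ^ N) = a
      rw [map_pow, hb, zero_add, ← iterate_frobenius]
      have := Function.LeftInverse.iterate
        (frobeniusEquiv (IsLocalRing.ResidueField A) p).apply_symm_apply N
      exact this a
end Residue
end Tilt

section DVR
variable (p : ℕ) [Fact p.Prime] (A : Type*) [CommRing A] [IsDomain A] [IsDiscreteValuationRing A]
  [hA : Fact (¬ IsUnit (p : A))]

theorem exists_pow_eq_zero (h0 : (p : A) ≠ 0) :
    ∃ N : ℕ, ∀ x : ModP A p, modPResidue p A x = 0 → x ^ p ^ N = 0 := by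
  obtain ⟨ϖ, hϖ⟩ := IsDiscreteValuationRing.exists_irreducible A
  obtain ⟨n, hn⟩ := IsDiscreteValuationRing.associated_pow_irreducible h0 hϖ
  refine ⟨n, fun x hx => ?_⟩
  obtain ⟨a, rfl⟩ := Ideal.Quotient.mk_surjective x
  have ha : a ∈ IsLocalRing.maximalIdeal A := by
    rw [← IsLocalRing.residue_eq_zero_iff]; exact hx
  rw [hϖ.maximalIdeal_eq, Ideal.mem_span_singleton] at ha
  rw [← map_pow, Ideal.Quotient.eq_zero_iff_mem, Ideal.mem_span_singleton]
  refine (hn.dvd.trans (pow_dvd_pow ϖ ?_)).trans (pow_dvd_pow_of_dvd ha _)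
  exact (Nat.lt_pow_self (Fact.out : p.Prime).one_lt).le

end DVR
section FrobeniusLift
variable {p : ℕ} [Fact p.Prime] {P : Type*} [CommRing P] [CharP P p] [PerfectRing P p]

theorem pow_dvd_eval_sub {W : Type*} [CommRing W] (f g : Polynomial W)
    (hf : f = Polynomial.X ^ p + Polynomial.C (p : W) * g) (n : ℕ) (a b : W)
    (hab : (p : W) ^ (n + 1) ∣ a - b) : (p : W) ^ (n + 2) ∣ f.eval a - f.eval b := by
  have h1 : f.eval a - f.eval b = (a ^ p - b ^ p) + p * (g.eval a - g.eval b) := by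
    subst hf; simp; ring
  rw [h1]
  refine dvd_add ?_ ?_
  · rw [← geom_sum₂_mul, pow_succ']
    exact mul_dvd_mul (dvd_geom_sum₂_self ((dvd_pow_self _ (Nat.succ_ne_zero n)).trans hab)) hab
  · rw [pow_succ']
    exact mul_dvd_mul_left _ (hab.trans (Polynomial.sub_dvd_eval_sub a b g))

open WittVector in
/-- For a polynomial `f ≡ X ^ p mod p`, every `x` has a unique lift `y ∈ W(P)`
with `φ(y) = f(y)`. -/
theorem existsUnique_lift (f g : Polynomial (WittVector p P))
    (hf : f = Polynomial.X ^ p + Polynomial.C (p : WittVector p P) * g) (x : P) :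
    ∃! y : WittVector p P, y.coeff 0 = x ∧ frobenius y = f.eval y := by
  have dvd0 : ∀ a b : WittVector p P, (p : WittVector p P) ∣ a - b ↔ a.coeff 0 = b.coeff 0 := by
    intro a b
    rw [← Ideal.mem_span_singleton, mem_span_p_iff_coeff_zero_eq_zero, ← sub_eq_zero (a := a.coeff 0)]
    have : (a - b).coeff 0 = a.coeff 0 - b.coeff 0 := map_sub (constantCoeff (p := p) (R := P)) a b
    rw [this]
  set T : WittVector p P → WittVector p P := fun z => (frobeniusEquiv p P).symm (f.eval z) with hT
  have hfr : ∀ y, frobenius y = f.eval y ↔ T y = y := by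
    intro y
    rw [hT]
    simp only
    rw [RingEquiv.symm_apply_eq, WittVector.frobeniusEquiv_apply, eq_comm]
  have hcon : ∀ (n : ℕ) (a b : WittVector p P), (p : WittVector p P) ^ (n + 1) ∣ a - b →
      (p : WittVector p P) ^ (n + 2) ∣ T a - T b := by
    intro n a b h
    have := map_dvd (frobeniusEquiv p P).symm (pow_dvd_eval_sub f g hf n a b h)
    simpa [hT] using this
  have hsm : ∀ (n : ℕ) (a b : WittVector p P),
      a ≡ b [SMOD (Ideal.span {(p : WittVector p P)} ^ n • ⊤ :
        Submodule (WittVector p P) (WittVector p P))] ↔ (p : WittVector p P) ^ n ∣ a - b := by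
    intro n a b
    rw [smul_eq_mul, Ideal.mul_top, SModEq.sub_mem, Ideal.span_singleton_pow,
      Ideal.mem_span_singleton]
  have hsep : ∀ a b : WittVector p P, (∀ n, (p : WittVector p P) ^ n ∣ a - b) → a = b := by
    intro a b h
    rw [IsHausdorff.eq_iff_smodEq (I := Ideal.span {(p : WittVector p P)})]
    exact fun n => (hsm n a b).2 (h n)
  have hT0 : ∀ a : WittVector p P, (T a).coeff 0 = a.coeff 0 := by
    intro a
    rw [← dvd0]
    have h1 : (p : WittVector p P) ∣ f.eval a - frobenius a := by
      have h2 : (p : WittVector p P) ∣ a ^ p - frobenius a := by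
        rw [dvd0, coeff_frobenius_charP]
        exact map_pow (constantCoeff (p := p) (R := P)) a p
      have h3 : f.eval a - frobenius a = (a ^ p - frobenius a) + p * g.eval a := by
        subst hf; simp; ring
      rw [h3]
      exact dvd_add h2 (dvd_mul_right _ _)
    have := map_dvd (frobeniusEquiv p P).symm h1
    rw [map_sub, map_natCast, ← WittVector.frobeniusEquiv_apply, RingEquiv.symm_apply_apply] at this
    exact this
  refine existsUnique_of_exists_of_unique ?_ ?_
  · set z : ℕ → WittVector p P := fun n => T^[n] (teichmuller p x) with hz
    have hz1 : ∀ n, z (n + 1) = T (z n) := fun n => Function.iterate_succ_apply' T n _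
    have hstep : ∀ n, (p : WittVector p P) ^ (n + 1) ∣ z n - z (n + 1) := by
      intro n
      induction n with
      | zero =>
        rw [zero_add, pow_one, dvd0, hz1, hT0]
      | succ n ih =>
        rw [hz1 n, hz1 (n + 1)]
        exact hcon n _ _ ih
    have hmn : ∀ m j, (p : WittVector p P) ^ (m + 1) ∣ z m - z (m + j) := by
      intro m j
      induction j with
      | zero => simp
      | succ j ih =>
        have := (pow_dvd_pow (p : WittVector p P) (by omega : m + 1 ≤ m + j + 1)).trans
          (hstep (m + j))
        have h2 := dvd_add ih this
        rwa [sub_add_sub_cancel] at h2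
    obtain ⟨y, hy⟩ := IsPrecomplete.prec
      (inferInstance : IsPrecomplete (Ideal.span {(p : WittVector p P)}) (WittVector p P))
      (f := z) (fun {m n} h => by
        obtain ⟨j, rfl⟩ := Nat.exists_eq_add_of_le h
        exact (hsm _ _ _).2 ((pow_dvd_pow _ (Nat.le_succ m)).trans (hmn m j)))
    have hy' : ∀ n, (p : WittVector p P) ^ n ∣ z n - y := fun n => (hsm _ _ _).1 (hy n)
    refine ⟨y, ?_, (hfr y).2 (hsep _ _ fun n => ?_)⟩
    · have h1 := hy' 1
      rw [pow_one, dvd0] at h1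
      rw [← h1, hz1, hT0]
      simp [hz]
    · have h1 := hcon n _ _ (hy' (n + 1))
      rw [← hz1] at h1
      have h2 := dvd_sub (hy' (n + 2)) h1
      have h3 : (z (n + 2) - y) - (z (n + 1 + 1) - T y) = T y - y := by ring
      rw [h3] at h2
      exact (pow_dvd_pow _ (by omega)).trans h2
  · rintro a b ⟨ha, ha'⟩ ⟨hb, hb'⟩
    rw [hfr] at ha' hb'
    have : ∀ n, (p : WittVector p P) ^ (n + 1) ∣ a - b := by
      intro n
      induction n with
      | zero => rw [zero_add, pow_one, dvd0, ha, hb]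
      | succ n ih =>
        have := hcon n _ _ ih
        rwa [ha', hb'] at this
    exact hsep _ _ fun n => (pow_dvd_pow _ (Nat.le_succ n)).trans (this n)
end FrobeniusLift

section Evaluation
variable {p : ℕ} [Fact p.Prime] {A : Type*} [CommRing A] [Fact (¬ IsUnit (p : A))]
variable {B : Type*} [CommRing B]

/-- The projection `W(lim A / p) → W_n(A / p)` through the `m`-th component. -/
def wittProj (n m : ℕ) : WittVector p (PreTilt A p) →+* TruncatedWittVector p n (ModP A p) :=
  (WittVector.truncate n).comp (WittVector.map (PreTilt.coeff m))

theorem wittProj_eq_iff (n m : ℕ) (a b : WittVector p (PreTilt A p)) :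
    wittProj n m a = wittProj n m b ↔
      ∀ i < n, PreTilt.coeff m (a.coeff i) = PreTilt.coeff m (b.coeff i) := by
  constructor
  · intro h i hi
    have := congrArg (TruncatedWittVector.coeff ⟨i, hi⟩) h
    simpa [wittProj] using this
  · intro h
    ext i
    simpa [wittProj] using h i i.2

theorem wittProj_ext {a b : WittVector p (PreTilt A p)}
    (h : ∀ n m, wittProj n m a = wittProj n m b) : a = b := by
  ext n
  refine Perfection.ext fun m => ?_
  exact (wittProj_eq_iff (n + 1) m a b).1 (h _ _) n (Nat.lt_succ_self n)

/-- Topological nilpotence in `W(lim A / p)` for the weak topology. -/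
def TopNil (y : WittVector p (PreTilt A p)) : Prop :=
  ∀ n m, ∃ N, wittProj n m (y ^ N) = 0

theorem wittProj_eval₂_congr {c : B →+* WittVector p (PreTilt A p)}
    {y : WittVector p (PreTilt A p)} {n m N : ℕ} (hN : wittProj n m (y ^ N) = 0)
    {F G : Polynomial B} (h : ∀ d < N, F.coeff d = G.coeff d) :
    wittProj n m (F.eval₂ c y) = wittProj n m (G.eval₂ c y) := by
  have : Polynomial.X ^ N ∣ F - G := Polynomial.X_pow_dvd_iff.2 fun d hd => by
    rw [Polynomial.coeff_sub, h d hd, sub_self]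
  obtain ⟨Q, hQ⟩ := this
  rw [← sub_eq_zero, ← map_sub, ← Polynomial.eval₂_sub, hQ, Polynomial.eval₂_mul,
    Polynomial.eval₂_pow, Polynomial.eval₂_X, map_mul, hN, zero_mul]

theorem exists_eval (c : B →+* WittVector p (PreTilt A p)) {y : WittVector p (PreTilt A p)}
    (hy : TopNil y) (F : PowerSeries B) :
    ∃ z : WittVector p (PreTilt A p), ∀ n m N, wittProj n m (y ^ N) = 0 →
      wittProj n m z = wittProj n m ((PowerSeries.trunc N F).eval₂ c y) := by
  choose N hN using hy
  have hcmp : ∀ i m N₁ N₂, wittProj (i + 1) m (y ^ N₁) = 0 → wittProj (i + 1) m (y ^ N₂) = 0 →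
      PreTilt.coeff m (((PowerSeries.trunc N₁ F).eval₂ c y).coeff i) =
      PreTilt.coeff m (((PowerSeries.trunc N₂ F).eval₂ c y).coeff i) := by
    intro i m N₁ N₂ h1 h2
    refine (wittProj_eq_iff (i + 1) m _ _).1 ?_ i (Nat.lt_succ_self i)
    rcases le_total N₁ N₂ with h | h
    · refine wittProj_eval₂_congr h1 fun d hd => ?_
      rw [PowerSeries.coeff_trunc, PowerSeries.coeff_trunc, if_pos hd, if_pos (hd.trans_le h)]
    · refine wittProj_eval₂_congr h2 fun d hd => ?_
      rw [PowerSeries.coeff_trunc, PowerSeries.coeff_trunc, if_pos hd, if_pos (hd.trans_le h)]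
  have hge : ∀ n m N₁ N₂, N₁ ≤ N₂ → wittProj n m (y ^ N₁) = 0 → wittProj n m (y ^ N₂) = 0 := by
    intro n m N₁ N₂ h h1
    obtain ⟨j, rfl⟩ := Nat.exists_eq_add_of_le h
    rw [pow_add, map_mul, h1, zero_mul]
  refine ⟨WittVector.mk p fun i => (⟨fun m => PreTilt.coeff m
    (((PowerSeries.trunc (N (i + 1) m) F).eval₂ c y).coeff i), fun m => ?_⟩ :
      Perfection (ModP A p) p), ?_⟩
  · beta_reduce
    rw [hcmp i m (N (i + 1) m) (max (N (i + 1) m) (N (i + 1) (m + 1))) (hN _ _)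
        (hge _ _ _ _ (le_max_left _ _) (hN _ _)),
      hcmp i (m + 1) (N (i + 1) (m + 1)) (max (N (i + 1) m) (N (i + 1) (m + 1))) (hN _ _)
        (hge _ _ _ _ (le_max_right _ _) (hN _ _))]
    exact PreTilt.coeff_pow_p _ _
  · intro n m N' hN'
    rw [wittProj_eq_iff]
    intro i hi
    refine hcmp i m _ _ (hN _ _) ?_
    rw [← map_zero (wittProj (i + 1) m), wittProj_eq_iff]
    rw [← map_zero (wittProj n m), wittProj_eq_iff] at hN'
    exact fun j hj => hN' j (by omega)

/-- The value at `y` of a power series (the sum of the series for the weak topology). -/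
def evalFun (c : B →+* WittVector p (PreTilt A p)) {y : WittVector p (PreTilt A p)}
    (hy : TopNil y) (F : PowerSeries B) : WittVector p (PreTilt A p) :=
  (exists_eval c hy F).choose

theorem wittProj_evalFun (c : B →+* WittVector p (PreTilt A p)) {y : WittVector p (PreTilt A p)}
    (hy : TopNil y) (F : PowerSeries B) {n m N : ℕ} (hN : wittProj n m (y ^ N) = 0)
    {G : Polynomial B} (hG : ∀ d < N, PowerSeries.coeff d F = G.coeff d) :
    wittProj n m (evalFun c hy F) = wittProj n m (G.eval₂ c y) := by
  rw [evalFun, (exists_eval c hy F).choose_spec n m N hN]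
  refine wittProj_eval₂_congr hN fun d hd => ?_
  rw [PowerSeries.coeff_trunc, if_pos hd, hG d hd]

theorem evalFun_coe (c : B →+* WittVector p (PreTilt A p)) {y : WittVector p (PreTilt A p)}
    (hy : TopNil y) (G : Polynomial B) : evalFun c hy (G : PowerSeries B) = G.eval₂ c y := by
  refine wittProj_ext fun n m => ?_
  obtain ⟨N, hN⟩ := hy n m
  exact wittProj_evalFun c hy _ hN fun d _ => Polynomial.coeff_coe G d

/-- The ring homomorphism `B⟦X⟧ → W(lim A / p)` given by `c` on `B`
and by a topologically nilpotent value `y` of `X`. -/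
def evalHom (c : B →+* WittVector p (PreTilt A p)) {y : WittVector p (PreTilt A p)}
    (hy : TopNil y) : PowerSeries B →+* WittVector p (PreTilt A p) where
  toFun := evalFun c hy
  map_one' := by simpa using evalFun_coe c hy 1
  map_zero' := by simpa using evalFun_coe c hy 0
  map_add' F G := by
    refine wittProj_ext fun n m => ?_
    obtain ⟨N, hN⟩ := hy n m
    have ht : ∀ H : PowerSeries B, ∀ d < N,
        PowerSeries.coeff d H = (PowerSeries.trunc N H).coeff d := fun H d hd => by
      rw [PowerSeries.coeff_trunc, if_pos hd]
    rw [map_add, wittProj_evalFun c hy F hN (ht F), wittProj_evalFun c hy G hN (ht G), ← map_add,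
      ← Polynomial.eval₂_add]
    refine wittProj_evalFun c hy _ hN fun d hd => ?_
    rw [Polynomial.coeff_add, map_add, ht F d hd, ht G d hd]
  map_mul' F G := by
    refine wittProj_ext fun n m => ?_
    obtain ⟨N, hN⟩ := hy n m
    have ht : ∀ H : PowerSeries B, ∀ d < N,
        PowerSeries.coeff d H = (PowerSeries.trunc N H).coeff d := fun H d hd => by
      rw [PowerSeries.coeff_trunc, if_pos hd]
    rw [map_mul, wittProj_evalFun c hy F hN (ht F), wittProj_evalFun c hy G hN (ht G), ← map_mul,
      ← Polynomial.eval₂_mul]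
    refine wittProj_evalFun c hy _ hN fun d hd => ?_
    rw [Polynomial.coeff_mul, PowerSeries.coeff_mul]
    refine Finset.sum_congr rfl fun x hx => ?_
    have hx' := Finset.HasAntidiagonal.mem_antidiagonal.1 hx
    rw [ht F _ (by omega), ht G _ (by omega)]

theorem evalHom_C (c : B →+* WittVector p (PreTilt A p)) {y : WittVector p (PreTilt A p)}
    (hy : TopNil y) (b : B) : evalHom c hy (PowerSeries.C b) = c b := by
  show evalFun c hy (PowerSeries.C b) = c b
  simpa using evalFun_coe c hy (Polynomial.C b)

theorem evalHom_X (c : B →+* WittVector p (PreTilt A p)) {y : WittVector p (PreTilt A p)}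
    (hy : TopNil y) : evalHom c hy PowerSeries.X = y := by
  show evalFun c hy PowerSeries.X = y
  simpa using evalFun_coe c hy Polynomial.X

theorem evalHom_coe (c : B →+* WittVector p (PreTilt A p)) {y : WittVector p (PreTilt A p)}
    (hy : TopNil y) (G : Polynomial B) : evalHom c hy (G : PowerSeries B) = G.eval₂ c y :=
  evalFun_coe c hy G

/-- A ring homomorphism `B⟦X⟧ → W(lim A / p)` is determined by its values on `B` and at `X`. -/
theorem powerSeries_hom_ext {g h : PowerSeries B →+* WittVector p (PreTilt A p)}
    (hX : g PowerSeries.X = h PowerSeries.X) (hn : TopNil (g PowerSeries.X))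
    (hC : ∀ b, g (PowerSeries.C b) = h (PowerSeries.C b)) : g = h := by
  ext1 F
  refine wittProj_ext fun n m => ?_
  obtain ⟨N, hN⟩ := hn n m
  have hpoly : ∀ G : Polynomial B, g (G : PowerSeries B) = h (G : PowerSeries B) := by
    intro G
    induction G using Polynomial.induction_on' with
    | add a b ha hb => rw [Polynomial.coe_add, map_add, map_add, ha, hb]
    | monomial k b =>
      rw [← Polynomial.C_mul_X_pow_eq_monomial]
      simp [hX, hC]
  have hd : PowerSeries.X ^ N ∣ F - (PowerSeries.trunc N F : PowerSeries B) :=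
    PowerSeries.X_pow_dvd_iff.2 fun d hd => by
      rw [map_sub, Polynomial.coeff_coe, PowerSeries.coeff_trunc, if_pos hd, sub_self]
  obtain ⟨Q, hQ⟩ := hd
  have hF : F = (PowerSeries.trunc N F : PowerSeries B) + PowerSeries.X ^ N * Q := by
    rw [← hQ]; ring
  have hN' : wittProj n m (h PowerSeries.X ^ N) = 0 := by rw [← hX]; exact hN
  rw [hF, map_add, map_add, map_add, map_add, hpoly, map_mul g, map_mul h, map_pow g, map_pow h,
    map_mul, map_mul, hN, hN']
  simp

/-- A Witt vector whose residue is topologically nilpotent is topologically nilpotent. -/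
theorem topNil_of_coeff_zero {y : WittVector p (PreTilt A p)}
    (h : ∀ m, IsNilpotent (PreTilt.coeff m (y.coeff 0))) : TopNil y := by
  intro n m
  have h1 : (p : WittVector p (PreTilt A p)) ∣ y - WittVector.teichmuller p (y.coeff 0) := by
    rw [← Ideal.mem_span_singleton, WittVector.mem_span_p_iff_coeff_zero_eq_zero]
    have : (y - WittVector.teichmuller p (y.coeff 0)).coeff 0 =
        y.coeff 0 - (WittVector.teichmuller p (y.coeff 0)).coeff 0 :=
      map_sub (WittVector.constantCoeff (p := p) (R := PreTilt A p)) _ _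
    rw [this]
    simp
  obtain ⟨w, hw⟩ := h1
  have h2 : wittProj n m y = wittProj n m (WittVector.teichmuller p (y.coeff 0)) +
      wittProj n m p * wittProj n m w := by
    rw [← map_mul, ← hw, ← map_add]; congr 1; ring
  have h3 : IsNilpotent (wittProj n m (WittVector.teichmuller p (y.coeff 0))) := by
    obtain ⟨N, hN⟩ := h m
    refine ⟨N, ?_⟩
    rw [← map_pow, ← map_pow, wittProj, RingHom.comp_apply, WittVector.map_teichmuller, map_pow,
      hN, WittVector.teichmuller_zero, map_zero]
  have h4 : IsNilpotent (wittProj (A := A) n m (p : WittVector p (PreTilt A p))) := by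
    refine ⟨n, ?_⟩
    rw [← map_pow, ← map_zero (wittProj n m), wittProj_eq_iff]
    intro i hi
    rw [WittVector.coeff_p_pow_eq_zero p _ hi.ne, WittVector.zero_coeff]
  obtain ⟨N, hN⟩ := (Commute.all _ _).isNilpotent_add h3
    ((Commute.all _ (wittProj n m w)).isNilpotent_mul_right h4)
  refine ⟨N, ?_⟩
  rw [map_pow, h2, hN]
end Evaluation
section Theta
variable (p : ℕ) [Fact p.Prime] (A : Type*) [CommRing A] [Fact (¬ IsUnit (p : A))]

theorem thetaMod_eq_of_lift (n : ℕ) (x : WittVector p (PreTilt A p)) (z : ℕ → A)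
    (hz : ∀ i, Ideal.Quotient.mk (Ideal.span {(p : A)}) (z i) = PreTilt.coeff n (x.coeff i)) :
    WittVector.fontaineThetaModPPow A p n x =
      Ideal.Quotient.mk (Ideal.span {(p : A)} ^ (n + 1))
        (∑ i ∈ Finset.range (n + 1), (p : A) ^ i * z i ^ p ^ (n - i)) := by
  have h1 : WittVector.map (PreTilt.coeff 0)
      (WittVector.map ((frobeniusEquiv (PreTilt A p) p).symm ^ n :
        PreTilt A p →+* PreTilt A p) x) =
      WittVector.map (Ideal.Quotient.mk (Ideal.span {(p : A)})) (WittVector.mk p z) := by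
    ext i
    rw [WittVector.map_coeff, WittVector.map_coeff, WittVector.map_coeff, WittVector.coeff_mk, hz]
    have h2 : ∀ y : PreTilt A p, ((frobeniusEquiv (PreTilt A p) p).symm ^ n :
        PreTilt A p →+* PreTilt A p) y = (frobeniusEquiv (PreTilt A p) p).symm^[n] y := by
      intro y
      simp
    rw [h2, PreTilt.coeff_iterate_frobeniusEquiv_symm, zero_add]
  rw [WittVector.fontaineThetaModPPow, RingHom.comp_apply, RingHom.comp_apply]
  rw [h1, WittVector.ghostComponentModPPow_map_mk, WittVector.ghostComponent_apply,
    aeval_wittPolynomial]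
  rfl

theorem thetaMod_succ (n : ℕ) (x : WittVector p (PreTilt A p)) (a : A)
    (h : WittVector.fontaineThetaModPPow A p (n + 1) x = Ideal.Quotient.mk _ a) :
    WittVector.fontaineThetaModPPow A p n x = Ideal.Quotient.mk _ a := by
  choose z hz using fun i => Ideal.Quotient.mk_surjective (PreTilt.coeff (n + 1) (x.coeff i))
  have h1 := (thetaMod_eq_of_lift p A (n + 1) x z hz).symm.trans h
  rw [Ideal.Quotient.eq] at h1
  refine (thetaMod_eq_of_lift p A n x (fun i => z i ^ p) (fun i => by
    rw [map_pow]
    exact (congrArg (· ^ p) (hz i)).trans (PreTilt.coeff_pow_p _ n))).trans ?_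
  rw [Ideal.Quotient.eq]
  have h' := Ideal.pow_le_pow_right (Nat.le_succ (n + 1)) h1
  rw [Finset.sum_range_succ] at h'
  have h3 : (p : A) ^ (n + 1) * z (n + 1) ^ p ^ (n + 1 - (n + 1)) ∈
      Ideal.span {(p : A)} ^ (n + 1) :=
    Ideal.mul_mem_right _ _ (Ideal.pow_mem_pow (Ideal.mem_span_singleton_self _) _)
  have h4 := Ideal.sub_mem _ h' h3
  convert h4 using 1
  rw [add_sub_right_comm, add_sub_cancel_right]
  congr 1
  refine Finset.sum_congr rfl fun i hi => ?_
  rw [← pow_mul, ← pow_succ', Nat.succ_sub (Nat.lt_succ_iff.1 (Finset.mem_range.1 hi))]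

theorem thetaMod_le {m n : ℕ} (hmn : m ≤ n) (x : WittVector p (PreTilt A p)) (a : A)
    (h : WittVector.fontaineThetaModPPow A p n x = Ideal.Quotient.mk _ a) :
    WittVector.fontaineThetaModPPow A p m x = Ideal.Quotient.mk _ a := by
  induction n, hmn using Nat.le_induction with
  | base => exact h
  | succ n _ ih => exact ih (thetaMod_succ p A n x a h)

/-- Fontaine's map `θ : W(lim A / p) → lim A / p ^ n`, with values in the `p`-adic completion
of `A`, obtained from its reductions modulo the powers of `p`. -/
def theta : WittVector p (PreTilt A p) →+* AdicCompletion (Ideal.span {(p : A)}) A :=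
  AdicCompletion.liftRingHom (Ideal.span {(p : A)})
    (fun n => (Ideal.Quotient.factorPow (Ideal.span {(p : A)}) (Nat.le_succ n)).comp
      (WittVector.fontaineThetaModPPow A p n))
    (fun {m n} hle => by
      ext1 x
      obtain ⟨a, ha⟩ := Ideal.Quotient.mk_surjective (WittVector.fontaineThetaModPPow A p n x)
      rw [RingHom.comp_apply, RingHom.comp_apply, RingHom.comp_apply, ← ha,
        thetaMod_le p A hle x a ha.symm]
      rfl)
end Theta

section Setting

theorem coeff_pow_pow (p : ℕ) [Fact p.Prime] {A : Type*} [CommRing A] [Fact (¬ IsUnit (p : A))]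
    (x : PreTilt A p) (n : ℕ) : PreTilt.coeff n x ^ p ^ n = PreTilt.coeff 0 x := by
  induction n with
  | zero => simp
  | succ n ih => rw [pow_succ', pow_mul, PreTilt.coeff_pow_p, ih]

variable (p : ℕ) [Fact p.Prime]
  (K : Type*) [NontriviallyNormedField K] [IsUltrametricDist K] [CompleteSpace K]
  [IsDiscreteValuationRing (IntegerRing K)]
  [hn : Fact (‖(p : K)‖ = (p : ℝ)⁻¹)]

/-- The residue field `k` of `K`. -/
abbrev ResField (K : Type*) [NontriviallyNormedField K] [IsUltrametricDist K]
    [IsDiscreteValuationRing (IntegerRing K)] : Type _ :=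
  IsLocalRing.ResidueField (IntegerRing K)

variable [PerfectField (ResField K)]

/-- As `k` is perfect, reduction is an isomorphism `lim 𝒪_K / p ≃ k`. -/
def residueEquiv : PreTilt (IntegerRing K) p ≃+* ResField K :=
  RingEquiv.ofBijective (tiltResidue p (IntegerRing K))
    (tiltResidue_bijective p (IntegerRing K) (exists_pow_eq_zero p (IntegerRing K) (fun h => by
      have h1 : ((p : IntegerRing K) : K) = 0 := by rw [h]; rfl
      have h2 : (p : K) = 0 := by simpa using h1
      have h3 := hn.out
      rw [h2, norm_zero] at h3
      exact (inv_ne_zero (Nat.cast_ne_zero.2 (Fact.out : p.Prime).ne_zero)) h3.symm)))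

/-- The canonical embedding `W(k) → 𝒪_K` (it induces the identity on `k`). -/
def wittToO : WittVector p (ResField K) →+* IntegerRing K :=
  (WittVector.fontaineTheta (IntegerRing K) p).comp
    (WittVector.map ((residueEquiv p K).symm : ResField K →+* PreTilt (IntegerRing K) p))

/-- The canonical map `ℤ_p = W(𝔽_p) → W(k)`. -/
def zpToW : ℤ_[p] →+* WittVector p (ResField K) :=
  letI := charPResidue p (IntegerRing K)
  (WittVector.map (ZMod.castHom (dvd_refl p) (ResField K))).comp
    (WittVector.equiv p).symm.toRingHom

variable (L : Type*) [Field L] [Algebra K L] [Algebra.IsAlgebraic K L]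

/-- The ring `R = lim 𝒪_L / p`, the transition maps being `x ↦ x ^ p`. -/
abbrev TiltR : Type _ := PreTilt (BigIntegerRing K L) p

/-- The canonical embedding `W(k) → W(R)`, induced by `k ≃ lim 𝒪_K / p → R`. -/
def wittToWR : WittVector p (ResField K) →+* WittVector p (TiltR p K L) :=
  WittVector.map ((tiltMap p (inclO K L)).comp
    ((residueEquiv p K).symm : ResField K →+* PreTilt (IntegerRing K) p))


/-- The valuation `v_R` of `R`: `v_R(x) = lim v_p(x̂_n ^ p ^ n)`, where `x̂_n` lifts the `n`-th
component of `x` and `v_p = - log_p |·|`. -/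
def vR (x : TiltR p K L) : EReal :=
  open Classical in
  if x = 0 then ⊤ else
    ((-Real.logb p (PreTilt.val L (absVal K L) (BigIntegerRing K L)
      (Valuation.integer.integers (absVal K L)) p x : ℝ) : ℝ) : EReal)

/-- The ideal `Fil¹ W(R)`, the kernel of Fontaine's map `θ` on `W(R)`. -/
def fil1 : Ideal (WittVector p (TiltR p K L)) :=
  RingHom.ker (theta p (BigIntegerRing K L))

/-- The ideal `I^{[1]} W(R)` of all `x` with `φⁿ(x) ∈ Fil¹ W(R)` for every `n ≥ 0`. -/
def I1 : Ideal (WittVector p (TiltR p K L)) :=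
  ⨅ n : ℕ, (fil1 p K L).comap
    ((WittVector.frobenius : WittVector p (TiltR p K L) →+* WittVector p (TiltR p K L)) ^ n)

/-- The weak topology of `W(R)`: the product topology on `W(R) = R^ℕ`, where `R = lim 𝒪_L / p`
has the inverse limit topology of the discrete rings `𝒪_L / p` (its `v_R`-adic topology). -/
abbrev weakTopology : TopologicalSpace (WittVector p (TiltR p K L)) :=
  ⨅ (n : ℕ) (m : ℕ), TopologicalSpace.induced (fun x => PreTilt.coeff m (x.coeff n)) ⊥

variable {K L} in
/-- The action of the Galois group on `W(R)`. -/
def galW (g : L ≃ₐ[K] L) : WittVector p (TiltR p K L) →+* WittVector p (TiltR p K L) :=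
  WittVector.map (tiltMap p (galO g))

/-- The choices of a uniformizer `π` of `K`, of a polynomial `f ∈ ℤ_p[u]`, monic of degree `p`
without constant term and congruent to `u ^ p` modulo `p`, and of a sequence `(π_n)` in `𝒪_L`
with `π_0 = π` and `f(π_{n+1}) = π_n`. -/
structure IterateData where
  /-- The uniformizer `π`. -/
  unif : IntegerRing K
  irreducible_unif : Irreducible unif
  /-- The polynomial `f`. -/
  f : Polynomial ℤ_[p]
  monic : f.Monic
  natDegree : f.natDegree = p
  coeff_zero : f.coeff 0 = 0
  cong : Polynomial.C (p : ℤ_[p]) ∣ f - Polynomial.X ^ p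
  /-- The sequence `(π_n)`. -/
  seq : ℕ → BigIntegerRing K L
  seq_zero : seq 0 = inclO K L unif
  seq_succ : ∀ n, f.eval₂ ((inclO K L).comp ((wittToO p K).comp (zpToW p K))) (seq (n + 1)) = seq n

namespace IterateData
variable {p K L} (D : IterateData p K L)

theorem seq_pow (n : ℕ) :
    (Ideal.Quotient.mk (Ideal.span {(p : BigIntegerRing K L)}) (D.seq (n + 1))) ^ p =
      Ideal.Quotient.mk (Ideal.span {(p : BigIntegerRing K L)}) (D.seq n) := by
  obtain ⟨g, hg⟩ := D.cong
  have h1 : D.f = Polynomial.X ^ p + Polynomial.C (p : ℤ_[p]) * g := by rw [← hg]; ring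
  have h2 := D.seq_succ n
  rw [h1, Polynomial.eval₂_add, Polynomial.eval₂_mul, Polynomial.eval₂_pow, Polynomial.eval₂_X,
    Polynomial.eval₂_C, map_natCast] at h2
  rw [← map_pow, ← h2, map_add, eq_comm, add_eq_left, Ideal.Quotient.eq_zero_iff_mem]
  exact Ideal.mul_mem_right _ _ (Ideal.mem_span_singleton_self _)

/-- The element `(π_n mod p)_n` of `R`. -/
def piR : TiltR p K L :=
  (⟨fun n => Ideal.Quotient.mk _ (D.seq n), fun n => D.seq_pow n⟩ :
    Perfection (ModP (BigIntegerRing K L) p) p)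

/-- The polynomial `f` with coefficients in `W(k)`. -/
def fW : Polynomial (WittVector p (ResField K)) := D.f.map (zpToW p K)

/-- The set-theoretic section `{·}_f : R → W(R)` of the reduction modulo `p`: `{x}_f` is the
unique lift of `x` with `φ({x}_f) = f({x}_f)`. -/
theorem existsUnique_section (x : TiltR p K L) : ∃! y : WittVector p (TiltR p K L),
    y.coeff 0 = x ∧ WittVector.frobenius y = D.fW.eval₂ (wittToWR p K L) y := by
  obtain ⟨g, hg⟩ := D.cong
  have h1 : D.f = Polynomial.X ^ p + Polynomial.C (p : ℤ_[p]) * g := by rw [← hg]; ring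
  have h2 := existsUnique_lift (p := p) (D.fW.map (wittToWR p K L))
    ((g.map (zpToW p K)).map (wittToWR p K L)) (by
      rw [fW, h1]; simp) x
  simpa only [Polynomial.eval_map] using h2

/-- `{x}_f`. -/
def sect (x : TiltR p K L) : WittVector p (TiltR p K L) := (D.existsUnique_section x).choose

theorem sect_coeff_zero (x : TiltR p K L) : (D.sect x).coeff 0 = x :=
  (D.existsUnique_section x).choose_spec.1.1

theorem frobenius_sect (x : TiltR p K L) :
    WittVector.frobenius (D.sect x) = D.fW.eval₂ (wittToWR p K L) (D.sect x) :=
  (D.existsUnique_section x).choose_spec.1.2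

theorem isNilpotent_coeff_piR (m : ℕ) : IsNilpotent (PreTilt.coeff m D.piR) := by
  have hp0 : (p : IntegerRing K) ≠ 0 := fun h => by
    have h1 : ((p : IntegerRing K) : K) = 0 := by rw [h]; rfl
    have h2 : (p : K) = 0 := by simpa using h1
    have h3 := hn.out
    rw [h2, norm_zero] at h3
    exact (inv_ne_zero (Nat.cast_ne_zero.2 (Fact.out : p.Prime).ne_zero)) h3.symm
  obtain ⟨n, hn⟩ := IsDiscreteValuationRing.associated_pow_irreducible hp0 D.irreducible_unif
  refine ⟨p ^ m * n, ?_⟩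
  rw [pow_mul, coeff_pow_pow]
  show (Ideal.Quotient.mk (Ideal.span {(p : BigIntegerRing K L)}) (D.seq 0)) ^ n = 0
  rw [D.seq_zero, ← map_pow, ← map_pow, Ideal.Quotient.eq_zero_iff_mem, Ideal.mem_span_singleton]
  simpa using map_dvd (inclO K L) hn.dvd

theorem topNil_sect : TopNil (D.sect D.piR) :=
  topNil_of_coeff_zero fun m => by
    rw [sect_coeff_zero]
    exact D.isNilpotent_coeff_piR m

/-- The ring `𝔖 = W(k)⟦u⟧`. -/
abbrev S (_D : IterateData p K L) : Type _ := PowerSeries (WittVector p (ResField K))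

/-- The embedding of `W(k)`-algebras `𝔖 → W(R)`, `u ↦ {π}_f`. -/
def embed : D.S →+* WittVector p (TiltR p K L) := evalHom (wittToWR p K L) D.topNil_sect

theorem hasSubst_fW : PowerSeries.HasSubst (D.fW : D.S) :=
  PowerSeries.HasSubst.of_constantCoeff_zero' (by
    rw [← PowerSeries.coeff_zero_eq_constantCoeff_apply, Polynomial.coeff_coe, fW,
      Polynomial.coeff_map, D.coeff_zero, map_zero])

/-- The Frobenius of `𝔖`: the Witt vector Frobenius on `W(k)`, and `u ↦ f(u)`. -/
def phiS : D.S →+* D.S :=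
  (PowerSeries.substAlgHom D.hasSubst_fW : D.S →ₐ[WittVector p (ResField K)] D.S).toRingHom.comp
    (PowerSeries.map WittVector.frobenius)

/-- The embedding `𝔖 → W(R)` is compatible with the Frobenius maps. -/
theorem frobenius_comp_embed :
    (WittVector.frobenius : WittVector p (TiltR p K L) →+* _).comp D.embed =
      D.embed.comp D.phiS := by
  have := charPResidue p (IntegerRing K)
  have hX : D.phiS PowerSeries.X = (D.fW : D.S) := by
    simp only [phiS, RingHom.comp_apply, PowerSeries.map_X]
    exact (congrFun (PowerSeries.coe_substAlgHom D.hasSubst_fW) _).trans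
      (PowerSeries.subst_X D.hasSubst_fW)
  have hC : ∀ b, D.phiS (PowerSeries.C b) = PowerSeries.C (WittVector.frobenius b) := by
    intro b
    simp only [phiS, RingHom.comp_apply, PowerSeries.map_C]
    exact (PowerSeries.substAlgHom D.hasSubst_fW).commutes _
  have hu : D.embed PowerSeries.X = D.sect D.piR := evalHom_X _ _
  refine powerSeries_hom_ext ?_ ?_ fun b => ?_
  · rw [RingHom.comp_apply, RingHom.comp_apply, hX, hu, frobenius_sect]
    exact (evalHom_coe _ _ _).symm
  · rw [RingHom.comp_apply, hu]
    refine topNil_of_coeff_zero fun m => ?_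
    rw [WittVector.coeff_frobenius_charP, sect_coeff_zero, map_pow]
    exact (D.isNilpotent_coeff_piR m).pow_of_pos (Fact.out : p.Prime).ne_zero
  · rw [RingHom.comp_apply, RingHom.comp_apply, hC]
    refine (congrArg _ (evalHom_C _ _ _)).trans (Eq.trans ?_ (evalHom_C _ _ _).symm)
    rw [wittToWR]
    ext n
    simp only [WittVector.map_coeff, WittVector.coeff_frobenius_charP, map_pow]

/-- The minimal polynomial `E(u)` of `π` over `W(k)`. As `W(k)` is integrally closed, it is
the minimal polynomial of `π` over `K_0 = W(k)[1/p]`. -/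
def E : Polynomial (WittVector p (ResField K)) :=
  letI : Algebra (WittVector p (ResField K)) (IntegerRing K) := (wittToO p K).toAlgebra
  minpoly (WittVector p (ResField K)) D.unif

/-- The subgroup of the Galois group fixing the field `K(π_n, n ≥ 0)`. -/
def Gpi : Subgroup (L ≃ₐ[K] L) :=
  (IntermediateField.adjoin K (Set.range fun n => (D.seq n : L))).fixingSubgroup

end IterateData
end Setting
section BaseChange
open scoped TensorProduct
variable {S A : Type*} [CommRing S] [CommRing A] (j : S →+* A)

/-- The extension of scalars `A ⊗_{j, S} M` of an `S`-module along a ring homomorphism `j`. -/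
def BaseChange (M : Type*) [AddCommGroup M] [Module S M] : Type _ :=
  letI := j.toAlgebra
  A ⊗[S] M

namespace BaseChange
variable (M : Type*) [AddCommGroup M] [Module S M]

instance : AddCommGroup (BaseChange j M) :=
  letI := j.toAlgebra
  (TensorProduct.addCommGroup : AddCommGroup (A ⊗[S] M))

instance : Module A (BaseChange j M) :=
  letI := j.toAlgebra
  (TensorProduct.leftModule : Module A (A ⊗[S] M))

variable {M}

/-- The element `a ⊗ x`. -/
def tmul (a : A) (x : M) : BaseChange j M :=
  letI := j.toAlgebra
  a ⊗ₜ[S] x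

/-- The `A`-linear extension of an `S`-linear map. -/
def map {N : Type*} [AddCommGroup N] [Module S N] (f : M →ₗ[S] N) :
    BaseChange j M →ₗ[A] BaseChange j N :=
  letI := j.toAlgebra
  f.baseChange A

/-- The additive map `A ⊗_{j, S} M → N` induced by a balanced map `A × M → N`. -/
def liftAdd {N : Type*} [AddCommGroup N] (b : A →+ M →+ N)
    (hb : ∀ (s : S) (a : A) (x : M), b (j s * a) x = b a (s • x)) : BaseChange j M →+ N :=
  letI := j.toAlgebra
  TensorProduct.liftAddHom b (fun s a x => by rw [Algebra.smul_def]; exact hb s a x)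

@[simp] theorem map_tmul {N : Type*} [AddCommGroup N] [Module S N] (f : M →ₗ[S] N) (a : A) (x : M) :
    map j f (tmul j a x) = tmul j a (f x) := rfl

@[simp] theorem liftAdd_tmul {N : Type*} [AddCommGroup N] (b : A →+ M →+ N)
    (hb : ∀ (s : S) (a : A) (x : M), b (j s * a) x = b a (s • x)) (a : A) (x : M) :
    liftAdd j b hb (tmul j a x) = b a x := rfl

theorem smul_tmul (c a : A) (x : M) : c • tmul j a x = tmul j (c * a) x := rfl

theorem add_tmul (a b : A) (x : M) : tmul j (a + b) x = tmul j a x + tmul j b x :=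
  letI := j.toAlgebra
  TensorProduct.add_tmul a b x

theorem tmul_add (a : A) (x y : M) : tmul j a (x + y) = tmul j a x + tmul j a y :=
  letI := j.toAlgebra
  TensorProduct.tmul_add a x y

theorem map_id : map j (LinearMap.id : M →ₗ[S] M) = LinearMap.id :=
  letI := j.toAlgebra
  LinearMap.baseChange_id

theorem map_comp {N Q : Type*} [AddCommGroup N] [Module S N] [AddCommGroup Q] [Module S Q]
    (g : N →ₗ[S] Q) (f : M →ₗ[S] N) : map j (g ∘ₗ f) = map j g ∘ₗ map j f :=
  letI := j.toAlgebra
  LinearMap.baseChange_comp g (f := f)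

theorem mul_tmul (s : S) (a : A) (x : M) : tmul j (j s * a) x = tmul j a (s • x) :=
  letI := j.toAlgebra
  (congrArg (fun b => tmul j b x) (Algebra.smul_def s a).symm).trans
    (TensorProduct.smul_tmul s a x)

/-- `a ⊗ x` as a biadditive map. -/
def tmulHom : A →+ M →+ BaseChange j M :=
  AddMonoidHom.mk' (fun a => AddMonoidHom.mk' (tmul j a) (tmul_add j a)) fun a b => by
    ext x
    exact add_tmul j a b x

end BaseChange
end BaseChange

section PhiModules
open CategoryTheory

universe u

/-- A `φ`-module over a ring `S` with an endomorphism `φ`: an `S`-module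
with a `φ`-semilinear endomorphism. -/
structure PhiModule {S : Type u} [CommRing S] (φ : S →+* S) where
  /-- The underlying module. -/
  carrier : Type w
  [addCommGroup : AddCommGroup carrier]
  [module : Module S carrier]
  /-- The semilinear endomorphism. -/
  phi : carrier →ₛₗ[φ] carrier

namespace PhiModule
variable {S : Type u} [CommRing S] {φ : S →+* S}

instance : CoeSort (PhiModule.{w} φ) (Type w) := ⟨carrier⟩

instance (M : PhiModule.{w} φ) : AddCommGroup M := M.addCommGroup
instance (M : PhiModule.{w} φ) : Module S M := M.module

/-- Morphisms of `φ`-modules: the linear maps that commute with `φ`. -/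
@[ext] structure Hom (M N : PhiModule.{w} φ) where
  /-- The underlying linear map. -/
  lin : M →ₗ[S] N
  comm : ∀ x, lin (M.phi x) = N.phi (lin x)

instance : Category (PhiModule.{w} φ) where
  Hom := Hom
  id M := ⟨LinearMap.id, fun _ => rfl⟩
  comp f g := ⟨g.lin ∘ₗ f.lin, fun x => by simp [f.comm, g.comm]⟩

/-- The linearization `1 ⊗ φ : S ⊗_{φ, S} M → M`, `s ⊗ x ↦ s φ(x)`. -/
def linearization (M : PhiModule.{w} φ) : BaseChange φ M →+ M :=
  BaseChange.liftAdd φ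
    (AddMonoidHom.mk' (fun s => AddMonoidHom.mk' (fun x => s • M.phi x) fun x y => by
      rw [map_add, smul_add]) fun s t => by ext x; exact add_smul s t (M.phi x))
    (fun s a x => by simp [mul_smul, smul_comm a])

/-- The semilinear endomorphism `Φ ⊗ φ_M` of `A ⊗_{j, S} M`, for an endomorphism `Φ` of `A`
which is compatible with `φ`. -/
def extendPhi (M : PhiModule.{w} φ) {A : Type*} [CommRing A] (j : S →+* A) (Φ : A →+* A)
    (h : Φ.comp j = j.comp φ) : BaseChange j M →+ BaseChange j M :=
  BaseChange.liftAdd j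
    (AddMonoidHom.mk' (fun a => ((BaseChange.tmulHom j) (Φ a)).comp (M.phi : M →+ M)) fun a b => by
      ext x; simp)
    (fun s a x => by
      have hs : Φ (j s) = j (φ s) := congrArg (fun k : S →+* A => k s) h
      show BaseChange.tmul j (Φ (j s * a)) (M.phi x) = BaseChange.tmul j (Φ a) (M.phi (s • x))
      rw [map_mul, hs, BaseChange.mul_tmul, LinearMap.map_smulₛₗ])

end PhiModule

variable {p : ℕ} [Fact p.Prime]
  {K : Type*} [NontriviallyNormedField K] [IsUltrametricDist K] [CompleteSpace K]
  [IsDiscreteValuationRing (IntegerRing K)] [PerfectField (ResField K)]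
  [Fact (‖(p : K)‖ = (p : ℝ)⁻¹)]
  {L : Type*} [Field L] [Algebra K L] [Algebra.IsAlgebraic K L]
  (D : IterateData p K L)

/-- Torsion Kisin modules of height `r`: the `φ`-modules over `𝔖` which are of finite type, killed
by a power of `p`, `p'`-torsion free, and such that the cokernel of the linearization of `φ`
is killed by `E(u) ^ r`. -/
structure IsTorsionKisin (r : ℕ) (M : PhiModule.{w} D.phiS) : Prop where
  finite : Module.Finite D.S M
  torsion : ∃ n : ℕ, ∀ x : M, (p : D.S) ^ n • x = 0
  torsionFree : ∀ x : M, x ≠ 0 →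
    Ideal.torsionOf D.S M x = ⊥ ∨ ∃ n : ℕ, Ideal.torsionOf D.S M x = Ideal.span {(p : D.S) ^ n}
  height : ∀ x : M, ∃ y : BaseChange D.phiS M,
    M.linearization y = (D.E : PowerSeries (WittVector p (ResField K))) ^ r • x

/-- `W(R) ⊗_{φ, 𝔖} M`. -/
abbrev WRTensor (M : PhiModule.{w} D.phiS) : Type _ := BaseChange (D.embed.comp D.phiS) M

/-- `φ_{W(R)} ⊗ φ_M` on `W(R) ⊗_{φ, 𝔖} M`. -/
def phiWR (M : PhiModule.{w} D.phiS) : WRTensor D M →+ WRTensor D M :=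
  M.extendPhi (D.embed.comp D.phiS) WittVector.frobenius (by
    rw [← RingHom.comp_assoc, D.frobenius_comp_embed])

/-- The weak topology on `W(R) ⊗_{φ, 𝔖} M`: the module topology over `W(R)` with its weak topology
(for a module of finite type, the quotient topology of a presentation `W(R) ^ n → W(R) ⊗ M`). -/
abbrev tensorTopology (M : PhiModule.{w} D.phiS) : TopologicalSpace (WRTensor D M) :=
  letI := weakTopology p K L
  moduleTopology (WittVector p (TiltR p K L)) (WRTensor D M)

/-- A `φ`-module `M` over `𝔖` with a `W(R)`-semilinear continuous action of the Galois group `G`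
on `W(R) ⊗_{φ, 𝔖} M`, which commutes with `φ_{W(R)} ⊗ φ_M`, and such that the image of
`φ^* M = 𝔖 ⊗_{φ, 𝔖} M` is fixed by `G_π`. -/
structure PhiGModule where
  /-- The underlying `φ`-module. -/
  under : PhiModule.{w} D.phiS
  /-- The action of `G`. -/
  act : (L ≃ₐ[K] L) →* AddMonoid.End (WRTensor D under)
  act_smul : ∀ (g : L ≃ₐ[K] L) (a : WittVector p (TiltR p K L)) (x : WRTensor D under),
    act g (a • x) = galW p g a • act g x
  continuous_act : letI := tensorTopology D under
    Continuous fun gx : (L ≃ₐ[K] L) × WRTensor D under => act gx.1 gx.2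
  act_phi : ∀ (g : L ≃ₐ[K] L) (x : WRTensor D under),
    act g (phiWR D under x) = phiWR D under (act g x)
  fixed : ∀ g ∈ D.Gpi, ∀ (s : D.S) (x : under),
    act g (BaseChange.tmul (D.embed.comp D.phiS) (D.embed s) x) =
      BaseChange.tmul (D.embed.comp D.phiS) (D.embed s) x

namespace PhiGModule
variable {D}

/-- Morphisms: the morphisms of `φ`-modules whose `W(R)`-linear extension commutes with `G`. -/
@[ext] structure Hom (M N : PhiGModule.{w} D) where
  /-- The underlying morphism of `φ`-modules. -/
  hom : M.under ⟶ N.under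
  equivariant : ∀ (g : L ≃ₐ[K] L) (x : WRTensor D M.under),
    BaseChange.map (D.embed.comp D.phiS) hom.lin (M.act g x) =
      N.act g (BaseChange.map (D.embed.comp D.phiS) hom.lin x)

instance : Category (PhiGModule.{w} D) where
  Hom := Hom
  id M := ⟨𝟙 M.under, fun g x => by
    have h : BaseChange.map (D.embed.comp D.phiS) (𝟙 M.under : M.under ⟶ M.under).lin =
      LinearMap.id := BaseChange.map_id _
    rw [h, LinearMap.id_apply, LinearMap.id_apply]⟩
  comp f g := ⟨f.hom ≫ g.hom, fun σ x => by
    have h : BaseChange.map (D.embed.comp D.phiS) (f.hom ≫ g.hom).lin =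
      BaseChange.map (D.embed.comp D.phiS) g.hom.lin ∘ₗ
        BaseChange.map (D.embed.comp D.phiS) f.hom.lin := BaseChange.map_comp _ _ _
    rw [h, LinearMap.comp_apply, LinearMap.comp_apply, f.equivariant, g.equivariant]⟩

/-- The functor that forgets the action of `G`. -/
def forget : PhiGModule.{w} D ⥤ PhiModule.{w} D.phiS where
  obj M := M.under
  map f := f.hom

end PhiGModule

/-- The category of torsion Kisin modules of height `r`. -/
abbrev TorsionKisinCat (r : ℕ) := ObjectProperty.FullSubcategory (IsTorsionKisin.{w} D r)

/-- Torsion `(φ, G)`-modules of height `r` with `g(1 ⊗ x) - 1 ⊗ x ∈ α I^{[1]} W(R) ⊗_{φ, 𝔖} M` for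
all `g ∈ G` and `x ∈ M`. -/
structure IsTorsionAlpha (r : ℕ) (α : WittVector p (TiltR p K L)) (M : PhiGModule.{w} D) :
    Prop where
  torsionKisin : IsTorsionKisin D r M.under
  congr : ∀ (g : L ≃ₐ[K] L) (x : M.under),
    M.act g (BaseChange.tmul (D.embed.comp D.phiS) 1 x) -
      BaseChange.tmul (D.embed.comp D.phiS) 1 x ∈
        ((Ideal.span {α} * I1 p K L) • ⊤ : Submodule (WittVector p (TiltR p K L))
          (WRTensor D M.under))

/-- The full subcategory of these torsion `(φ, G)`-modules. -/
abbrev TorsionAlphaCat (r : ℕ) (α : WittVector p (TiltR p K L)) :=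
  ObjectProperty.FullSubcategory (IsTorsionAlpha.{w} D r α)

/-- The forgetful functor from torsion `(φ, G)`-modules to torsion Kisin modules. -/
def forgetTorsion (r : ℕ) (α : WittVector p (TiltR p K L)) :
    TorsionAlphaCat.{w} D r α ⥤ TorsionKisinCat.{w} D r :=
  ObjectProperty.lift _ (ObjectProperty.ι _ ⋙ PhiGModule.forget) fun M => M.property.torsionKisin

end PhiModules

end CaisLiu

end

/-!
Let `h : 𝔐 → 𝔑` be a morphism of Kisin modules. For `g ∈ G`, the defect of equivariance
`δ(y) = h(g y) - g(h y)` on `W(R) ⊗_{φ, 𝔖} 𝔐` is `g`-semilinear, commutes with `φ`, and sends each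
`1 ⊗ x` into `α I^{[1]} (W(R) ⊗ 𝔑)`, because `g(1 ⊗ x) - 1 ⊗ x` and `g(1 ⊗ h x) - 1 ⊗ h x` lie in
the corresponding submodules. Let `Y` be the span of the elements `δ(1 ⊗ x)`. As `E ^ r 𝔐` lies in
the `𝔖`-span of `φ(𝔐)`, the multiple `g(φ(E)) ^ r Y` lies in the span of `φ(Y)`; such a submodule
`Y` of `α I^{[1]} (W(R) ⊗ 𝔑)` is called contracted (`IsContracted`). The theorem follows from the
statement that contracted submodules vanish.

If `p 𝔑 = 0`, then `W(R) ⊗ 𝔑` is free over `R = W(R) / p`. Since `φ(I^{[1]}) ⊆ φ(E) I^{[1]}`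
(`IterateData.exists_frobenius_eq`), an inclusion `Y ⊆ b I^{[1]} (W(R) ⊗ 𝔑)` improves to
`Y ⊆ b' I^{[1]} (W(R) ⊗ 𝔑)` with `b' g(φ(E)) ^ r ≡ b ^ p φ(E)` modulo `p`. Here `φ(E)` and
`g(φ(E))` have valuation `p` modulo `p`, so that `v(b') = p v(b) + p - p r`. Starting from
`b = α`, the bound `v(α) > p (r - 1) / (p - 1)` makes the valuations of the successive `b` tend to
infinity, and `Y = 0` (`IsContracted.eq_bot_of_killed`).

The general case follows from the exact sequences `0 → 𝔑[p] → 𝔑 → p 𝔑 → 0`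
(`IsContracted.eq_bot_of_eq_bot_of_killed`). One needs that `W(R) ⊗ 𝔑[p] → W(R) ⊗ 𝔑` is injective
and remains so modulo `α I^{[1]}`. This is the vanishing of `Tor₁` of a torsion Kisin module with
a module without `p`-torsion (`lTensor_injective_of_exact`), and `W(R) / α I^{[1]}` has no
`p`-torsion.

The inclusion `φ(I^{[1]}) ⊆ φ(E) I^{[1]}` rests on two facts: `E` generates the kernel of `θ`
(`IterateData.embedE_dvd`), which follows from `v_R(E mod p) = 1` by successive approximation; and
`θ(φᵐ(E))` is `p` times a unit for `m ≥ 1` (`IterateData.thetaMod_frobenius_embedE`). For the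
latter, `E` is an Eisenstein polynomial (`IterateData.exists_E_eq`), `θ` maps `φᵐ({π}_f)` to the
`m`-fold iterate of `f` at `π` (`IterateData.thetaMod_frobenius_sect`), and the absolute value of
that iterate is smaller than that of `π`.
-/

noncomputable section

namespace CaisLiu

open scoped NNReal
open Module
open WittVector (fontaineThetaModPPow)

/-! ### Vanishing of Tor for torsion modules -/

section TorsionDevissage

variable {S : Type*} [CommRing S]

/-- Every element of `S` which kills some nonzero element of `Q` is divisible by `a`. -/
def AnnihilatorsDivisible (a : S) (Q : Type*) [AddCommGroup Q] [Module S Q] : Prop :=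
  ∀ (s : S) (x : Q), s • x = 0 → x ≠ 0 → a ∣ s

theorem AnnihilatorsDivisible.submodule {a : S} {Q : Type*} [AddCommGroup Q] [Module S Q]
    (h : AnnihilatorsDivisible a Q) (P : Submodule S Q) : AnnihilatorsDivisible a P :=
  fun s x hx h0 => h s x (by simpa using congrArg Subtype.val hx) (by simpa using h0)

/-- A finite module over `S` killed by `a`, on which only multiples of `a` have torsion, is
free over `S / a` if the latter is a principal ideal domain. -/
theorem exists_basis_mod (a : S) [IsDomain (S ⧸ Ideal.span {a})]
    [IsPrincipalIdealRing (S ⧸ Ideal.span {a})]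
    (Q : Type*) [AddCommGroup Q] [Module S Q] [Module.Finite S Q]
    (ha : ∀ x : Q, a • x = 0) (hQ : AnnihilatorsDivisible a Q) :
    ∃ (n : ℕ) (e : Fin n → Q), Submodule.span S (Set.range e) = ⊤ ∧
      ∀ s : Fin n → S, ∑ k, s k • e k = 0 → ∀ k, a ∣ s k := by
  have hT : Module.IsTorsionBySet S Q (Ideal.span {a} : Ideal S) := by
    rw [Module.isTorsionBySet_span_singleton_iff]
    exact ha
  let : Module (S ⧸ Ideal.span {a}) Q := hT.module
  have : IsScalarTower S (S ⧸ Ideal.span {a}) Q := hT.isScalarTower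
  have hmk : ∀ (s : S) (x : Q), (Ideal.Quotient.mk (Ideal.span {a}) s) • x = s • x :=
    fun s x => rfl
  have : Module.Finite (S ⧸ Ideal.span {a}) Q := Module.Finite.of_restrictScalars_finite S _ _
  have : Module.IsTorsionFree (S ⧸ Ideal.span {a}) Q := by
    rw [Module.isTorsionFree_iff_smul_eq_zero]
    intro c x hc
    obtain ⟨s, rfl⟩ := Ideal.Quotient.mk_surjective c
    by_cases hx : x = 0
    · exact Or.inr hx
    · exact Or.inl (Ideal.Quotient.eq_zero_iff_mem.2
        (Ideal.mem_span_singleton.2 (hQ s x hc hx)))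
  obtain ⟨n, b⟩ := Module.basisOfFiniteTypeTorsionFree' (R := S ⧸ Ideal.span {a}) (M := Q)
  refine ⟨n, b, ?_, ?_⟩
  · rw [eq_top_iff]
    rintro x -
    rw [← b.sum_repr x]
    refine Submodule.sum_mem _ fun i _ => ?_
    obtain ⟨s, hs⟩ := Ideal.Quotient.mk_surjective (b.repr x i)
    rw [← hs, hmk]
    exact Submodule.smul_mem _ _ (Submodule.subset_span ⟨i, rfl⟩)
  · intro s hs k
    have h1 := Fintype.linearIndependent_iff.1 b.linearIndependent
      (fun k => Ideal.Quotient.mk (Ideal.span {a}) (s k)) hs k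
    exact Ideal.mem_span_singleton.1 (Ideal.Quotient.eq_zero_iff_mem.1 h1)

/-- Vanishing of `Tor₁(A, Q)` for `Q` free over `S / a` and `A` without `a`-torsion. -/
theorem lTensor_injective_of_basis (a : S) {A X Y Q : Type*} [AddCommGroup A] [Module S A]
    [AddCommGroup X] [Module S X] [AddCommGroup Y] [Module S Y] [AddCommGroup Q] [Module S Q]
    (hA : ∀ z : A, a • z = 0 → z = 0) {f : X →ₗ[S] Y} {g : Y →ₗ[S] Q}
    (hf : Function.Injective f) (hfg : Function.Exact f g) (hg : Function.Surjective g)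
    {n : ℕ} {e : Fin n → Q} (ha : ∀ k, a • e k = 0)
    (hspan : Submodule.span S (Set.range e) = ⊤)
    (hind : ∀ s : Fin n → S, ∑ k, s k • e k = 0 → ∀ k, a ∣ s k) :
    Function.Injective (f.lTensor A) := by
  choose y hy using fun k => hg (e k)
  have hx : ∀ k, ∃ x, f x = a • y k := fun k => (hfg (a • y k)).1 (by rw [map_smul, hy, ha])
  choose x hx using hx
  -- `Y` has the presentation `Sⁿ → X × Sⁿ → Y`, in which the second component of the first map
  -- is multiplication by `a`
  let κ : (Fin n → S) →ₗ[S] X × (Fin n → S) :=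
    (-(Fintype.linearCombination S x)).prod (a • LinearMap.id)
  let ρ : X × (Fin n → S) →ₗ[S] Y := f.coprod (Fintype.linearCombination S y)
  have hρ : Function.Surjective ρ := by
    intro z
    have hz : g z ∈ Submodule.span S (Set.range e) := by rw [hspan]; trivial
    obtain ⟨c, hc⟩ := (Submodule.mem_span_range_iff_exists_fun S).1 hz
    have h1 : g (z - ∑ k, c k • y k) = 0 := by
      rw [map_sub, map_sum, sub_eq_zero, ← hc]
      exact Finset.sum_congr rfl fun k _ => by rw [map_smul, hy]
    obtain ⟨w, hw⟩ := (hfg _).1 h1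
    refine ⟨(w, c), ?_⟩
    simp [ρ, Fintype.linearCombination_apply, hw]
  have hex : Function.Exact κ ρ := by
    rintro ⟨w, s⟩
    constructor
    · intro h
      have h0 : f w + ∑ k, s k • y k = 0 := by
        simpa [ρ, Fintype.linearCombination_apply] using h
      have h1 : ∑ k, s k • e k = 0 := by
        have := congrArg g h0
        rw [map_add, hfg.apply_apply_eq_zero, zero_add, map_sum, map_zero] at this
        rw [← this]
        exact Finset.sum_congr rfl fun k _ => by rw [map_smul, hy]
      choose t ht using hind s h1
      refine ⟨t, ?_⟩
      have h2 : w = -∑ k, t k • x k := by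
        apply hf
        rw [map_neg, map_sum, eq_neg_iff_add_eq_zero, ← h0]
        congr 1
        exact Finset.sum_congr rfl fun k _ => by rw [map_smul, hx, ht, smul_smul, mul_comm]
      ext
      · simp [κ, Fintype.linearCombination_apply, h2]
      · simp [κ, ht]
    · rintro ⟨t, ht⟩
      rw [← ht]
      simp [κ, ρ, Fintype.linearCombination_apply, hx, smul_smul, Finset.smul_sum, mul_comm]
  have hexA := lTensor_exact A hex hρ
  have hinj : Function.Injective ((a • LinearMap.id : (Fin n → S) →ₗ[S] _).lTensor A) := by
    have h1 : Function.Injective (a • LinearMap.id : A →ₗ[S] A) := by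
      rw [injective_iff_map_eq_zero]; exact hA
    have h2 := Module.Flat.rTensor_preserves_injective_linearMap (M := Fin n → S) _ h1
    rw [LinearMap.lTensor_smul, LinearMap.lTensor_id]
    rwa [LinearMap.rTensor_smul, LinearMap.rTensor_id] at h2
  rw [injective_iff_map_eq_zero]
  intro w hw
  have h3 : ρ.lTensor A ((LinearMap.inl S X (Fin n → S)).lTensor A w) = 0 := by
    rw [← LinearMap.comp_apply, ← LinearMap.lTensor_comp]
    simpa [ρ] using hw
  obtain ⟨v, hv⟩ := (hexA _).1 h3
  have h4 : (a • LinearMap.id : (Fin n → S) →ₗ[S] _).lTensor A v = 0 := by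
    have := congrArg ((LinearMap.snd S X (Fin n → S)).lTensor A) hv
    rw [← LinearMap.comp_apply, ← LinearMap.lTensor_comp, ← LinearMap.comp_apply,
      ← LinearMap.lTensor_comp, LinearMap.snd_comp_inl] at this
    simpa [κ] using this
  have h5 : v = 0 := hinj (h4.trans (map_zero _).symm)
  have := congrArg ((LinearMap.fst S X (Fin n → S)).lTensor A) hv
  rw [h5, map_zero, map_zero, ← LinearMap.comp_apply, ← LinearMap.lTensor_comp,
    LinearMap.fst_comp_inl] at this
  simpa using this.symm

/-- Vanishing of `Tor₁(A, Q)` for an `S`-module `A` without `a`-torsion and a finite module `Q`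
which is killed by a power of `a` and on which only multiples of `a` have torsion. -/
theorem lTensor_injective_of_exact (a : S) [IsNoetherianRing S] [IsDomain (S ⧸ Ideal.span {a})]
    [IsPrincipalIdealRing (S ⧸ Ideal.span {a})] {A : Type*} [AddCommGroup A] [Module S A]
    (hA : ∀ z : A, a • z = 0 → z = 0) (n : ℕ) :
    ∀ {X Y Q : Type w} [AddCommGroup X] [Module S X] [AddCommGroup Y] [Module S Y]
      [AddCommGroup Q] [Module S Q] [Module.Finite S Q] {f : X →ₗ[S] Y} {g : Y →ₗ[S] Q},
      Function.Injective f → Function.Exact f g → Function.Surjective g →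
      (∀ x : Q, a ^ n • x = 0) → AnnihilatorsDivisible a Q →
      Function.Injective (f.lTensor A) := by
  induction n with
  | zero =>
    intro X Y Q _ _ _ _ _ _ _ f g hf hfg hg ha hQ
    refine lTensor_injective_of_basis a (n := 0) (e := fun _ => 0) hA hf hfg hg (by simp) ?_
      (by simp)
    rw [eq_top_iff]
    intro x _
    have := ha x
    rw [pow_zero, one_smul] at this
    rw [this]
    exact Submodule.zero_mem _
  | succ n ih =>
    intro X Y Q _ _ _ _ _ _ _ f g hf hfg hg ha hQ
    -- `Y₁ ⊆ Y` is the preimage of the `a`-torsion of `Q`; `Y₁ / X` is killed by `a`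
    -- and `Y / Y₁ = a Q` by `a ^ n`
    let m : Q →ₗ[S] Q := a • LinearMap.id
    let g₂ : Y →ₗ[S] LinearMap.range m := m.rangeRestrict ∘ₗ g
    have hg₂ : Function.Surjective g₂ := m.surjective_rangeRestrict.comp hg
    let Y₁ := LinearMap.ker g₂
    have hY₁ : ∀ z : Y, z ∈ Y₁ ↔ g z ∈ LinearMap.ker m := by
      intro z
      rw [LinearMap.mem_ker, LinearMap.mem_ker]
      constructor
      · intro h
        exact congrArg Subtype.val h
      · intro h
        exact Subtype.ext h
    let f₁ : X →ₗ[S] Y₁ := f.codRestrict Y₁ fun x => by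
      rw [hY₁, hfg.apply_apply_eq_zero]; exact Submodule.zero_mem _
    let g₁ : Y₁ →ₗ[S] LinearMap.ker m := (g ∘ₗ Y₁.subtype).codRestrict _ fun z => (hY₁ z).1 z.2
    have h1 : Function.Injective (f₁.lTensor A) := by
      obtain ⟨N, e, he, hind⟩ := exists_basis_mod a (LinearMap.ker m)
        (fun x => Subtype.ext x.2) (hQ.submodule _)
      refine lTensor_injective_of_basis a (g := g₁) (e := e) hA ?_ ?_ ?_
        (fun k => Subtype.ext (e k).2) he hind
      · intro x y hxy
        exact hf (congrArg Subtype.val hxy)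
      · intro z
        constructor
        · intro h
          obtain ⟨x, hx⟩ := (hfg z).1 (congrArg Subtype.val h)
          exact ⟨x, Subtype.ext hx⟩
        · rintro ⟨x, rfl⟩
          exact Subtype.ext (hfg.apply_apply_eq_zero x)
      · rintro ⟨z, hz⟩
        obtain ⟨y, rfl⟩ := hg z
        exact ⟨⟨y, (hY₁ y).2 hz⟩, rfl⟩
    have h2 : Function.Injective (Y₁.subtype.lTensor A) := by
      refine ih (g := g₂) Y₁.injective_subtype ?_ hg₂ ?_ (hQ.submodule _)
      · exact LinearMap.exact_subtype_ker_map g₂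
      · rintro ⟨_, z, rfl⟩
        refine Subtype.ext ?_
        have := ha z
        rw [pow_succ, mul_smul] at this
        exact this
    have h3 : f = Y₁.subtype ∘ₗ f₁ := rfl
    rw [h3, LinearMap.lTensor_comp]
    exact h2.comp h1

end TorsionDevissage

/-! ### Exactness properties of base change -/

section TensorIdeal
open scoped TensorProduct
variable {S W : Type*} [CommRing S] [CommRing W] [Algebra S W]

/-- The kernel of `W ⊗ X → W / J ⊗ X` is `J (W ⊗ X)`. -/
theorem rTensor_mkQ_eq_zero_iff (J : Ideal W) {X : Type*} [AddCommGroup X] [Module S X]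
    (y : W ⊗[S] X) :
    (J.restrictScalars S).mkQ.rTensor X y = 0 ↔ y ∈ (J • ⊤ : Submodule W (W ⊗[S] X)) := by
  constructor
  · intro h
    have hex : Function.Exact (J.restrictScalars S).subtype (J.restrictScalars S).mkQ := by
      rw [LinearMap.exact_iff]; simp
    obtain ⟨t, rfl⟩ := (rTensor_exact X hex (J.restrictScalars S).mkQ_surjective _).1 h
    clear h
    induction t using TensorProduct.induction_on with
    | zero => rw [map_zero]; exact Submodule.zero_mem _
    | tmul c x =>
      have h4 : (J.restrictScalars S).subtype.rTensor X (c ⊗ₜ[S] x) =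
          (c : W) • ((1 : W) ⊗ₜ[S] x) := by
        rw [TensorProduct.smul_tmul', smul_eq_mul, mul_one]; rfl
      rw [h4]
      exact Submodule.smul_mem_smul c.2 trivial
    | add t u ht hu =>
      rw [map_add]
      exact Submodule.add_mem _ ht hu
  · intro h
    refine Submodule.smul_induction_on h ?_ ?_
    · intro c hc t _
      induction t using TensorProduct.induction_on with
      | zero => rw [smul_zero, map_zero]
      | tmul b x =>
        have h1 : (J.restrictScalars S).mkQ (c * b) = 0 := by
          rw [Submodule.mkQ_apply, Submodule.Quotient.mk_eq_zero]
          exact J.mul_mem_right b hc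
        rw [TensorProduct.smul_tmul', smul_eq_mul, LinearMap.rTensor_tmul, h1,
          TensorProduct.zero_tmul]
      | add t u ht hu => rw [smul_add, map_add, ht trivial, hu trivial, add_zero]
    · intro t u ht hu
      rw [map_add, ht, hu, add_zero]

/-- The vanishing of `Tor₁(W / J, Q)`, expressed through membership in `J (W ⊗ X)`. -/
theorem mem_smul_top_of_lTensor_mem (a : S) [IsNoetherianRing S] [IsDomain (S ⧸ Ideal.span {a})]
    [IsPrincipalIdealRing (S ⧸ Ideal.span {a})]
    {X Y Q : Type w} [AddCommGroup X] [Module S X] [AddCommGroup Y] [Module S Y]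
    [AddCommGroup Q] [Module S Q] [Module.Finite S Q] {f : X →ₗ[S] Y} {g : Y →ₗ[S] Q}
    (hf : Function.Injective f) (hfg : Function.Exact f g) (hg : Function.Surjective g)
    {n : ℕ} (ha : ∀ x : Q, a ^ n • x = 0) (hQ : AnnihilatorsDivisible a Q)
    {J : Ideal W} (hJ : ∀ z : W, a • z ∈ J → z ∈ J) {y : W ⊗[S] X}
    (hy : f.lTensor W y ∈ (J • ⊤ : Submodule W (W ⊗[S] Y))) :
    y ∈ (J • ⊤ : Submodule W (W ⊗[S] X)) := by
  have hinj := lTensor_injective_of_exact a (A := W ⧸ J.restrictScalars S) (fun z hz => by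
    obtain ⟨z, rfl⟩ := Submodule.Quotient.mk_surjective _ z
    rw [← Submodule.Quotient.mk_smul, Submodule.Quotient.mk_eq_zero] at hz
    rw [Submodule.Quotient.mk_eq_zero]
    exact hJ z hz) n hf hfg hg ha hQ
  rw [← rTensor_mkQ_eq_zero_iff] at hy ⊢
  apply hinj
  rw [map_zero, ← LinearMap.comp_apply, LinearMap.lTensor_comp_rTensor,
    ← LinearMap.rTensor_comp_lTensor]
  exact hy

end TensorIdeal

section BaseChangeExactness
variable {S W : Type*} [CommRing S] [CommRing W] (j : S →+* W)

@[elab_as_elim]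
theorem BaseChange.induction_on {M : Type*} [AddCommGroup M] [Module S M]
    {motive : BaseChange j M → Prop} (y : BaseChange j M) (zero : motive 0)
    (tmul : ∀ a x, motive (BaseChange.tmul j a x))
    (add : ∀ y z, motive y → motive z → motive (y + z)) : motive y :=
  letI := j.toAlgebra
  TensorProduct.induction_on (R := S) (M := W) (N := M) y zero tmul add

theorem BaseChange.exact_map {M N Q : Type*} [AddCommGroup M] [Module S M] [AddCommGroup N]
    [Module S N] [AddCommGroup Q] [Module S Q] {f : M →ₗ[S] N} {g : N →ₗ[S] Q}
    (hfg : Function.Exact f g) (hg : Function.Surjective g) :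
    Function.Exact (BaseChange.map j f) (BaseChange.map j g) :=
  letI := j.toAlgebra
  lTensor_exact W hfg hg

variable (a : S) [IsNoetherianRing S] [IsDomain (S ⧸ Ideal.span {a})]
    [IsPrincipalIdealRing (S ⧸ Ideal.span {a})]
    {X Y Q : Type w} [AddCommGroup X] [Module S X] [AddCommGroup Y] [Module S Y]
    [AddCommGroup Q] [Module S Q] [Module.Finite S Q] {f : X →ₗ[S] Y} {g : Y →ₗ[S] Q}
    (hf : Function.Injective f) (hfg : Function.Exact f g) (hg : Function.Surjective g)
    {n : ℕ} (ha : ∀ x : Q, a ^ n • x = 0) (hQ : AnnihilatorsDivisible a Q)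
include hf hfg hg ha hQ

theorem BaseChange.map_injective (hW : ∀ z : W, j a * z = 0 → z = 0) :
    Function.Injective (BaseChange.map j f) :=
  letI := j.toAlgebra
  lTensor_injective_of_exact a (A := W) (fun z hz => hW z (by rwa [Algebra.smul_def] at hz))
    n hf hfg hg ha hQ

/-- For an ideal `J` such that `W / J` has no `a`-torsion, base change reflects membership in the
multiples of `J`. -/
theorem BaseChange.mem_smul_top_of_map_mem {J : Ideal W} (hJ : ∀ z : W, j a * z ∈ J → z ∈ J)
    {y : BaseChange j X}
    (hy : BaseChange.map j f y ∈ (J • ⊤ : Submodule W (BaseChange j Y))) :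
    y ∈ (J • ⊤ : Submodule W (BaseChange j X)) :=
  letI := j.toAlgebra
  mem_smul_top_of_lTensor_mem a hf hfg hg ha hQ (fun z hz => hJ z (by
    rwa [Algebra.smul_def] at hz)) hy

end BaseChangeExactness

/-! ### Contracted submodules: reduction to modules killed by `p` -/

section TensorBasis
open scoped TensorProduct
variable {S W : Type*} [CommRing S] [CommRing W]

/-- If `e` is a basis of `Q` over `S / a`, then the elements `1 ⊗ e k` are linearly independent
over `W / a`. -/
theorem dvd_of_sum_tmul_eq_zero [Algebra S W] (a : S) {Q : Type*} [AddCommGroup Q] [Module S Q]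
    {n : ℕ} {e : Fin n → Q} (ha : ∀ k, a • e k = 0)
    (hspan : Submodule.span S (Set.range e) = ⊤)
    (hind : ∀ s : Fin n → S, ∑ k, s k • e k = 0 → ∀ k, a ∣ s k)
    {w : Fin n → W} (hw : ∑ k, w k ⊗ₜ[S] e k = 0) (k : Fin n) : algebraMap S W a ∣ w k := by
  let ρ : (Fin n → S) →ₗ[S] Q := Fintype.linearCombination S e
  let κ : (Fin n → S) →ₗ[S] (Fin n → S) := a • LinearMap.id
  have hρ : Function.Surjective ρ := by
    intro x
    have hx : x ∈ Submodule.span S (Set.range e) := by rw [hspan]; trivial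
    obtain ⟨c, hc⟩ := (Submodule.mem_span_range_iff_exists_fun S).1 hx
    exact ⟨c, hc⟩
  have hex : Function.Exact κ ρ := by
    intro s
    constructor
    · intro h
      choose t ht using hind s h
      exact ⟨t, funext fun k => (ht k).symm⟩
    · rintro ⟨t, rfl⟩
      show ∑ k, (a • t k) • e k = 0
      exact Finset.sum_eq_zero fun k _ => by rw [smul_eq_mul, mul_comm, mul_smul, ha, smul_zero]
  have h1 : ρ.lTensor W (∑ k, w k ⊗ₜ[S] Pi.single k 1) = 0 := by
    rw [map_sum, ← hw]
    refine Finset.sum_congr rfl fun k _ => ?_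
    rw [LinearMap.lTensor_tmul]
    congr 1
    simp [ρ, Fintype.linearCombination_apply_single]
  obtain ⟨t, ht⟩ := (lTensor_exact W hex hρ _).1 h1
  have h2 := congrArg (fun z => TensorProduct.rid S W
    ((LinearMap.proj k : (Fin n → S) →ₗ[S] S).lTensor W z)) ht
  simp only [κ, LinearMap.lTensor_smul, LinearMap.lTensor_id, LinearMap.smul_apply,
    LinearMap.id_apply, map_smul, map_sum, LinearMap.lTensor_tmul, TensorProduct.rid_tmul,
    LinearMap.proj_apply] at h2
  rw [Finset.sum_eq_single k (fun i _ hi => by rw [Pi.single_eq_of_ne hi.symm, zero_smul])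
    (by simp), Pi.single_eq_same, one_smul, Algebra.smul_def] at h2
  exact ⟨_, h2.symm⟩

variable (j : S →+* W)

theorem BaseChange.dvd_of_sum_tmul_eq_zero (a : S) {Q : Type*} [AddCommGroup Q] [Module S Q]
    {n : ℕ} {e : Fin n → Q} (ha : ∀ k, a • e k = 0)
    (hspan : Submodule.span S (Set.range e) = ⊤)
    (hind : ∀ s : Fin n → S, ∑ k, s k • e k = 0 → ∀ k, a ∣ s k)
    {w : Fin n → W} (hw : ∑ k, BaseChange.tmul j (w k) (e k) = 0) (k : Fin n) : j a ∣ w k :=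
  letI := j.toAlgebra
  CaisLiu.dvd_of_sum_tmul_eq_zero a ha hspan hind hw k

theorem BaseChange.tmul_zero {Q : Type*} [AddCommGroup Q] [Module S Q] (a : W) :
    BaseChange.tmul j a (0 : Q) = 0 :=
  map_zero (BaseChange.tmulHom j a)

theorem BaseChange.tmul_sum {Q : Type*} [AddCommGroup Q] [Module S Q] {ι : Type*} (s : Finset ι)
    (a : W) (f : ι → Q) :
    BaseChange.tmul j a (∑ i ∈ s, f i) = ∑ i ∈ s, BaseChange.tmul j a (f i) :=
  map_sum (BaseChange.tmulHom j a) f s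

theorem BaseChange.exists_eq_sum_tmul {Q : Type*} [AddCommGroup Q] [Module S Q]
    {n : ℕ} {e : Fin n → Q} (hspan : Submodule.span S (Set.range e) = ⊤) (y : BaseChange j Q) :
    ∃ w : Fin n → W, y = ∑ k, BaseChange.tmul j (w k) (e k) := by
  refine BaseChange.induction_on j y ⟨0, ?_⟩ ?_ ?_
  · exact (Finset.sum_eq_zero fun k _ => map_zero ((BaseChange.tmulHom j).flip (e k))).symm
  · intro a x
    have hx : x ∈ Submodule.span S (Set.range e) := by rw [hspan]; trivial
    obtain ⟨c, rfl⟩ := (Submodule.mem_span_range_iff_exists_fun S).1 hx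
    refine ⟨fun k => j (c k) * a, ?_⟩
    rw [BaseChange.tmul_sum]
    exact Finset.sum_congr rfl fun k _ => (BaseChange.mul_tmul j _ _ _).symm
  · rintro _ _ ⟨w, rfl⟩ ⟨w', rfl⟩
    refine ⟨w + w', ?_⟩
    rw [← Finset.sum_add_distrib]
    exact Finset.sum_congr rfl fun k _ => (BaseChange.add_tmul j _ _ _).symm

end TensorBasis

section Devissage
variable {S W : Type*} [CommRing S] [CommRing W] {φ : S →+* S} (j : S →+* W) (Φ : W →+* W)
  (h : Φ.comp j = j.comp φ)

/-- The restriction of a `φ`-module to a `φ`-stable submodule. -/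
def PhiModule.restrict (N : PhiModule.{w} φ) (P : Submodule S N) (hP : ∀ x ∈ P, N.phi x ∈ P) :
    PhiModule.{w} φ where
  carrier := P
  phi :=
    { toFun := fun x => ⟨N.phi x, hP x x.2⟩
      map_add' := fun _ _ => Subtype.ext (map_add N.phi _ _)
      map_smul' := fun _ _ => Subtype.ext (LinearMap.map_smulₛₗ N.phi _ _) }

theorem PhiModule.extendPhi_tmul (N : PhiModule.{w} φ) (a : W) (x : N) :
    N.extendPhi j Φ h (BaseChange.tmul j a x) = BaseChange.tmul j (Φ a) (N.phi x) := rfl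

theorem PhiModule.extendPhi_smul (N : PhiModule.{w} φ) (a : W) (y : BaseChange j N) :
    N.extendPhi j Φ h (a • y) = Φ a • N.extendPhi j Φ h y := by
  refine BaseChange.induction_on j y ?_ ?_ ?_
  · simp
  · intro b x
    rw [BaseChange.smul_tmul, extendPhi_tmul, extendPhi_tmul, BaseChange.smul_tmul, map_mul]
  · intro y z hy hz
    rw [smul_add, map_add, map_add, smul_add, hy, hz]

theorem PhiModule.map_extendPhi {M N : PhiModule.{w} φ} (f : M →ₗ[S] N)
    (hf : ∀ x, f (M.phi x) = N.phi (f x)) (y : BaseChange j M) :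
    BaseChange.map j f (M.extendPhi j Φ h y) = N.extendPhi j Φ h (BaseChange.map j f y) := by
  refine BaseChange.induction_on j y ?_ ?_ ?_
  · simp
  · intro b x
    rw [extendPhi_tmul, BaseChange.map_tmul, BaseChange.map_tmul, extendPhi_tmul, hf]
  · intro y z hy hz
    rw [map_add, map_add, map_add, map_add, hy, hz]

theorem map_mem_smul_top {M N : Type*} [AddCommGroup M] [Module W M] [AddCommGroup N] [Module W N]
    (f : M →ₗ[W] N) {J : Ideal W} {y : M} (hy : y ∈ (J • ⊤ : Submodule W M)) :
    f y ∈ (J • ⊤ : Submodule W N) := by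
  have : f y ∈ (J • ⊤ : Submodule W M).map f := Submodule.mem_map_of_mem hy
  rw [Submodule.map_smul''] at this
  exact Submodule.smul_mono le_rfl le_top this

/-- The submodules `Y` of `W ⊗ N` contained in `J (W ⊗ N)` whose multiple by `c` is contained
in the span of `Φ(Y)`. -/
def IsContracted (J : Ideal W) (c : W) (N : PhiModule.{w} φ)
    (Y : Submodule W (BaseChange j N)) : Prop :=
  Y ≤ J • ⊤ ∧ ∀ y ∈ Y, c • y ∈ Submodule.span W (N.extendPhi j Φ h '' Y)

variable (p : ℕ) [IsNoetherianRing S] [IsDomain (S ⧸ Ideal.span {(p : S)})]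
    [IsPrincipalIdealRing (S ⧸ Ideal.span {(p : S)})] (J : Ideal W) (c : W)

/-- Reduction of the vanishing of the contracted submodules to modules killed by `p`, by means
of the exact sequences `0 → N[p] → N → p N → 0`. -/
theorem IsContracted.eq_bot_of_eq_bot_of_killed
    (hW : ∀ z : W, (p : W) * z = 0 → z = 0) (hJ : ∀ z : W, (p : W) * z ∈ J → z ∈ J)
    (hbase : ∀ N : PhiModule.{w} φ, Module.Finite S N → (∀ x : N, (p : S) • x = 0) →
      AnnihilatorsDivisible (p : S) N →
      ∀ Y, IsContracted j Φ h J c N Y → Y = ⊥) (n : ℕ) :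
    ∀ N : PhiModule.{w} φ, Module.Finite S N → (∀ x : N, (p : S) ^ n • x = 0) →
      AnnihilatorsDivisible (p : S) N →
      ∀ Y, IsContracted j Φ h J c N Y → Y = ⊥ := by
  induction n with
  | zero =>
    intro N hfin hkill hN Y hY
    refine hbase N hfin (fun x => ?_) hN Y hY
    have := hkill x
    rw [pow_zero, one_smul] at this
    rw [this, smul_zero]
  | succ n ih =>
    intro N hfin hkill hN Y hY
    let m : N →ₗ[S] N := (p : S) • LinearMap.id
    have hm : ∀ x : N, m (N.phi x) = N.phi (m x) := by
      intro x
      show (p : S) • N.phi x = N.phi ((p : S) • x)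
      rw [LinearMap.map_smulₛₗ, map_natCast]
    let N₁ := N.restrict (LinearMap.ker m) fun x hx => by
      rw [LinearMap.mem_ker] at hx ⊢
      rw [hm, hx, map_zero]
    let N₂ := N.restrict (LinearMap.range m) fun x hx => by
      obtain ⟨y, rfl⟩ := hx
      exact ⟨N.phi y, hm y⟩
    let f : N₁ →ₗ[S] N := (LinearMap.ker m).subtype
    let g : N →ₗ[S] N₂ := m.rangeRestrict
    have hf : Function.Injective f := Subtype.val_injective
    have hg : Function.Surjective g := m.surjective_rangeRestrict
    have hfg : Function.Exact f g := by
      intro x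
      constructor
      · intro hx
        exact ⟨⟨x, congrArg Subtype.val hx⟩, rfl⟩
      · rintro ⟨y, rfl⟩
        exact Subtype.ext y.2
    have hfφ : ∀ x, f (N₁.phi x) = N.phi (f x) := fun x => rfl
    have hgφ : ∀ x, g (N.phi x) = N₂.phi (g x) := fun x => Subtype.ext (hm x)
    have hfin₁ : Module.Finite S N₁ :=
      inferInstanceAs (Module.Finite S (LinearMap.ker m))
    have hfin₂ : Module.Finite S N₂ :=
      inferInstanceAs (Module.Finite S (LinearMap.range m))
    have hN₂ : AnnihilatorsDivisible (p : S) N₂ := hN.submodule _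
    have hkill₂ : ∀ x : N₂, (p : S) ^ n • x = 0 := by
      rintro ⟨_, z, rfl⟩
      refine Subtype.ext ?_
      have := hkill z
      rw [pow_succ, mul_smul] at this
      exact this
    have himg : Y.map (BaseChange.map j g) = ⊥ := by
      refine ih N₂ hfin₂ hkill₂ hN₂ _ ⟨?_, ?_⟩
      · rintro _ ⟨y, hy, rfl⟩
        exact map_mem_smul_top _ (hY.1 hy)
      · rintro _ ⟨y, hy, rfl⟩
        rw [← map_smul]
        have h1 := Submodule.mem_map_of_mem (f := BaseChange.map j g) (hY.2 y hy)
        rw [Submodule.map_span] at h1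
        refine Submodule.span_mono ?_ h1
        rintro _ ⟨_, ⟨z, hz, rfl⟩, rfl⟩
        exact ⟨_, ⟨z, hz, rfl⟩, (PhiModule.map_extendPhi j Φ h g hgφ z).symm⟩
    have hinj : Function.Injective (BaseChange.map j f) :=
      BaseChange.map_injective j (p : S) hf hfg hg hkill₂ hN₂ (by simpa using hW)
    have hY₁ : Y.comap (BaseChange.map j f) = ⊥ := by
      refine hbase N₁ hfin₁ (fun x => Subtype.ext x.2) (hN.submodule _) _ ⟨?_, ?_⟩
      · intro y hy
        exact BaseChange.mem_smul_top_of_map_mem j (p : S) hf hfg hg hkill₂ hN₂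
          (by simpa using hJ) (hY.1 hy)
      · intro y hy
        have h1 := hY.2 _ hy
        have h2 : N.extendPhi j Φ h '' Y ⊆
            BaseChange.map j f '' (N₁.extendPhi j Φ h '' (Y.comap (BaseChange.map j f))) := by
          rintro _ ⟨z, hz, rfl⟩
          have h3 : BaseChange.map j g z = 0 := by
            have : BaseChange.map j g z ∈ Y.map (BaseChange.map j g) :=
              Submodule.mem_map_of_mem hz
            rwa [himg, Submodule.mem_bot] at this
          obtain ⟨z, rfl⟩ := (BaseChange.exact_map j hfg hg z).1 h3
          exact ⟨_, ⟨z, hz, rfl⟩, PhiModule.map_extendPhi j Φ h f hfφ z⟩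
        have h4 := Submodule.span_mono (R := W) h2 h1
        rw [← Submodule.map_span, ← map_smul] at h4
        obtain ⟨t, ht, ht'⟩ := h4
        rwa [← hinj ht']
    rw [eq_bot_iff]
    intro y hy
    have h3 : BaseChange.map j g y = 0 := by
      have : BaseChange.map j g y ∈ Y.map (BaseChange.map j g) := Submodule.mem_map_of_mem hy
      rwa [himg, Submodule.mem_bot] at this
    obtain ⟨z, rfl⟩ := (BaseChange.exact_map j hfg hg y).1 h3
    have h4 : z ∈ Y.comap (BaseChange.map j f) := hy
    rw [hY₁, Submodule.mem_bot] at h4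
    rw [h4, map_zero]
    exact Submodule.zero_mem _

end Devissage

/-! ### Contracted submodules of modules killed by `p` -/

section Contraction
variable {S W : Type*} [CommRing S] [CommRing W] {φ : S →+* S} (j : S →+* W) (Φ : W →+* W)
  (h : Φ.comp j = j.comp φ)

theorem mem_span_mul_smul_top_iff {M : Type*} [AddCommGroup M] [Module W M] {b : W} {I : Ideal W}
    {y : M} : y ∈ ((Ideal.span {b} * I) • ⊤ : Submodule W M) ↔
      ∃ z ∈ (I • ⊤ : Submodule W M), b • z = y := by
  rw [Submodule.mul_smul, Submodule.ideal_span_singleton_smul]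
  exact Iff.rfl

/-- If `Φ(I) ⊆ ε I`, then `Φ` maps `b I (W ⊗ N)` into `Φ(b) ε I (W ⊗ N)`. -/
theorem PhiModule.extendPhi_mem {N : PhiModule.{w} φ} {I : Ideal W} {ε : W}
    (hI : ∀ z ∈ I, ∃ w ∈ I, Φ z = ε * w) {b : W} {y : BaseChange j N}
    (hy : y ∈ ((Ideal.span {b} * I) • ⊤ : Submodule W (BaseChange j N))) :
    N.extendPhi j Φ h y ∈ ((Ideal.span {Φ b * ε} * I) • ⊤ : Submodule W (BaseChange j N)) := by
  refine Submodule.smul_induction_on hy ?_ ?_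
  · intro c hc t _
    obtain ⟨z, hz, rfl⟩ := Ideal.mem_span_singleton_mul.1 hc
    obtain ⟨w, hw, hzw⟩ := hI z hz
    rw [PhiModule.extendPhi_smul, map_mul, hzw, ← mul_assoc]
    exact Submodule.smul_mem_smul
      (Ideal.mul_mem_mul (Ideal.mem_span_singleton_self _) hw) trivial
  · intro y z hy hz
    rw [map_add]
    exact Submodule.add_mem _ hy hz

variable (p : ℕ) [IsDomain (S ⧸ Ideal.span {(p : S)})]
    [IsPrincipalIdealRing (S ⧸ Ideal.span {(p : S)})]
    {R : Type*} [CommRing R] [IsDomain R] (ρ : W →+* R) (hρ : Function.Surjective ρ)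
    (hker : ∀ x, ρ x = 0 ↔ (p : W) ∣ x)
    (v : Valuation R ℝ≥0) (hv0 : ∀ x, v x = 0 → x = 0) (hv1 : ∀ x, v x ≤ 1)
    (hvd : ∀ x y, v x ≤ v y → y ∣ x) (hΦ : ∀ x, ρ (Φ x) = ρ x ^ p)
include hρ hker hv0 hv1 hvd hΦ

/-- The contraction argument over `R = W / p`: if `Y ⊆ b I (W ⊗ N)`, then
`q ^ m Y ⊆ Φ(b) ε I (W ⊗ N)`, hence `Y ⊆ b' I (W ⊗ N)` with `b' q ^ m ≡ b ^ p ε` modulo `p`,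
and `b'` is smaller than `b` by a factor bounded away from `1`. -/
theorem IsContracted.eq_bot_of_killed {I : Ideal W} {ε q α : W}
    (hI : ∀ z ∈ I, ∃ w ∈ I, Φ z = ε * w) (hε : v (ρ ε) ≠ 0) (hq : v (ρ q) = v (ρ ε)) (m : ℕ)
    (hp : p ≠ 0) (hα : v (ρ α) ^ (p - 1) * v (ρ ε) < v (ρ ε) ^ m)
    (N : PhiModule.{w} φ) (hfin : Module.Finite S N) (hkill : ∀ x : N, (p : S) • x = 0)
    (hN : AnnihilatorsDivisible (p : S) N) (Y : Submodule W (BaseChange j N))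
    (hY : IsContracted j Φ h (Ideal.span {α} * I) (q ^ m) N Y) : Y = ⊥ := by
  obtain ⟨n, e, hspan, hind⟩ := exists_basis_mod (p : S) N hkill hN
  have hdvd : ∀ w : Fin n → W, ∑ k, BaseChange.tmul j (w k) (e k) = 0 → ∀ k, ρ (w k) = 0 :=
    fun w hw k => (hker _).2 (by
      simpa using BaseChange.dvd_of_sum_tmul_eq_zero j (p : S) (fun k => hkill _) hspan hind hw k)
  have hkill' : ∀ (s : W) (y : BaseChange j N), ρ s = 0 → s • y = 0 := by
    intro s y hs
    obtain ⟨t, rfl⟩ := (hker s).1 hs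
    induction y using BaseChange.induction_on with
    | zero => rw [smul_zero]
    | tmul a x =>
      rw [BaseChange.smul_tmul, mul_assoc, ← map_natCast j p, BaseChange.mul_tmul, hkill,
        BaseChange.tmul_zero]
    | add y z hy hz => rw [smul_add, hy, hz, add_zero]
  have hsmul : ∀ (s : W) (w : Fin n → W), s • ∑ k, BaseChange.tmul j (w k) (e k) =
      ∑ k, BaseChange.tmul j (s * w k) (e k) := by
    intro s w
    rw [Finset.smul_sum]
    rfl
  have hsum0 : ∀ w : Fin n → W, (∀ k, ρ (w k) = 0) →
      ∑ k, BaseChange.tmul j (w k) (e k) = 0 := by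
    intro w hw
    refine Finset.sum_eq_zero fun k _ => ?_
    rw [← mul_one (w k), ← BaseChange.smul_tmul]
    exact hkill' _ _ (hw k)
  have htf : ∀ (s : W) (y : BaseChange j N), ρ s ≠ 0 → s • y = 0 → y = 0 := by
    intro s y hs hy
    obtain ⟨w, rfl⟩ := BaseChange.exists_eq_sum_tmul j hspan y
    rw [hsmul] at hy
    refine hsum0 w fun k => ?_
    have := hdvd _ hy k
    rw [map_mul] at this
    exact (mul_eq_zero.1 this).resolve_left hs
  -- `τ` is the factor by which the absolute value of the multiplier decreases at each step; it is
  -- determined by the first step, as the later multipliers are smaller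
  set l := v (ρ ε) with hl
  set τ := v (ρ α) ^ (p - 1) * l / l ^ m with hτ
  have hlm : l ^ m ≠ 0 := pow_ne_zero _ hε
  have hτ1 : τ < 1 := (div_lt_one (pos_iff_ne_zero.2 hlm)).2 hα
  have hclaim : ∀ i : ℕ, ∃ b : W, v (ρ b) ≤ τ ^ i * v (ρ α) ∧
      Y ≤ (Ideal.span {b} * I) • ⊤ := by
    intro i
    induction i with
    | zero => exact ⟨α, by simp, hY.1⟩
    | succ i ih =>
      obtain ⟨b, hb, hYb⟩ := ih
      have hbα : v (ρ b) ≤ v (ρ α) := hb.trans (mul_le_of_le_one_left (by simp)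
        (pow_le_one₀ (by simp) hτ1.le))
      have hbp : v (ρ b) ^ p * l ≤ τ * v (ρ b) * l ^ m := by
        have h1 : τ * v (ρ b) * l ^ m = v (ρ α) ^ (p - 1) * l * v (ρ b) := by
          rw [hτ]; field_simp
        rw [h1, ← Nat.sub_add_cancel (Nat.one_le_iff_ne_zero.2 hp), pow_succ,
          Nat.add_sub_cancel, mul_right_comm]
        gcongr
      have hdiv : ρ q ^ m ∣ ρ b ^ p * ρ ε := by
        apply hvd
        rw [map_mul, map_pow, map_pow, hq]
        refine hbp.trans (mul_le_of_le_one_left (by simp) ?_)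
        exact mul_le_one₀ hτ1.le (by simp) (hv1 _)
      obtain ⟨t, ht⟩ := hdiv
      obtain ⟨b', rfl⟩ := hρ t
      have hb' : v (ρ b') ≤ τ * v (ρ b) := by
        have h1 := congrArg v ht
        rw [map_mul, map_mul, map_pow, map_pow, hq] at h1
        rw [← hl] at h1
        rw [h1, mul_comm] at hbp
        exact le_of_mul_le_mul_right hbp (pos_iff_ne_zero.2 hlm)
      refine ⟨b', hb'.trans ?_, ?_⟩
      · rw [pow_succ', mul_assoc]
        gcongr
      · intro y hy
        have h1 : Submodule.span W (N.extendPhi j Φ h '' Y) ≤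
            ((Ideal.span {Φ b * ε} * I) • ⊤ : Submodule W (BaseChange j N)) := by
          rw [Submodule.span_le]
          rintro _ ⟨z, hz, rfl⟩
          exact PhiModule.extendPhi_mem j Φ h hI (hYb hz)
        obtain ⟨z, hz, hzy⟩ := mem_span_mul_smul_top_iff.1 (h1 (hY.2 y hy))
        rw [mem_span_mul_smul_top_iff]
        refine ⟨z, hz, ?_⟩
        have h2 : (Φ b * ε - q ^ m * b') • z = 0 := by
          apply hkill'
          rw [map_sub, map_mul, hΦ, ht, map_mul, map_pow, sub_self]
        rw [sub_smul, hzy, mul_smul, ← smul_sub] at h2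
        have h3 := htf _ _ (fun h0 => hlm (by
          rw [map_pow] at h0
          rw [← hq, ← map_pow, h0, map_zero])) h2
        exact (sub_eq_zero.1 h3).symm
  rw [eq_bot_iff]
  intro y hy
  rw [Submodule.mem_bot]
  obtain ⟨w, rfl⟩ := BaseChange.exists_eq_sum_tmul j hspan y
  refine hsum0 w fun k => hv0 _ ?_
  have hlim : Filter.Tendsto (fun i : ℕ => τ ^ i * v (ρ α)) Filter.atTop (nhds 0) := by
    simpa using (tendsto_pow_atTop_nhds_zero_of_lt_one (by simp) hτ1).mul_const (v (ρ α))
  refine le_antisymm (ge_of_tendsto' hlim fun i => ?_) (by simp)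
  obtain ⟨b, hb, hYb⟩ := hclaim i
  refine le_trans ?_ hb
  obtain ⟨z, -, hz⟩ := mem_span_mul_smul_top_iff.1 (hYb hy)
  obtain ⟨w', rfl⟩ := BaseChange.exists_eq_sum_tmul j hspan z
  have h1 : ∑ k, BaseChange.tmul j (w k - b * w' k) (e k) = 0 := by
    have h2 : ∀ k, BaseChange.tmul j (w k - b * w' k) (e k) =
        BaseChange.tmul j (w k) (e k) - BaseChange.tmul j (b * w' k) (e k) :=
      fun k => map_sub ((BaseChange.tmulHom j).flip (e k)) _ _
    rw [Finset.sum_congr rfl fun k _ => h2 k, Finset.sum_sub_distrib, ← hsmul, hz, sub_self]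
  have h2 := hdvd _ h1 k
  rw [map_sub, map_mul, sub_eq_zero] at h2
  rw [h2, map_mul]
  exact mul_le_of_le_one_right (by simp) (hv1 _)

end Contraction

/-! ### The valuation of the tilt -/

section TiltValuation

theorem dvd_p_iff {p : ℕ} {L : Type*} [Field L] {v : Valuation L ℝ≥0} {O : Type*} [CommRing O]
    [Algebra O L] (hv : v.Integers O) (z : O) :
    (p : O) ∣ z ↔ v (algebraMap O L z) ≤ v (p : L) := by
  rw [← map_natCast (algebraMap O L) p, hv.le_iff_dvd]

variable {p : ℕ} [Fact p.Prime] {L : Type*} [Field L] {v : Valuation L ℝ≥0}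
  {O : Type*} [CommRing O] [Algebra O L] (hv : v.Integers O) [Fact (¬ IsUnit (p : O))]

theorem tiltCoeff_add_pow (x : PreTilt O p) (n k : ℕ) :
    PreTilt.coeff (n + k) x ^ p ^ k = PreTilt.coeff n x := by
  induction k with
  | zero => simp
  | succ k ih => rw [pow_succ', pow_mul, ← add_assoc, PreTilt.coeff_pow_p, ih]

theorem tilt_exists_coeff_ne_zero {x : PreTilt O p} (hx : x ≠ 0) :
    ∃ n, PreTilt.coeff n x ≠ 0 :=
  not_forall.1 fun h => hx (Perfection.ext h)

theorem tiltCoeff_ne_zero_of_le {x : PreTilt O p} {m n : ℕ} (h : PreTilt.coeff m x ≠ 0)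
    (hmn : m ≤ n) : PreTilt.coeff n x ≠ 0 := by
  obtain ⟨k, rfl⟩ := Nat.exists_eq_add_of_le hmn
  intro h0
  apply h
  rw [← tiltCoeff_add_pow x m k, h0, zero_pow (pow_ne_zero k (Fact.out : p.Prime).ne_zero)]

/-- The valuation of the tilt can be computed from any nonzero component. -/
theorem tiltVal_eq {x : PreTilt O p} {n : ℕ} (hn : PreTilt.coeff n x ≠ 0) {z : O}
    (hz : Ideal.Quotient.mk _ z = PreTilt.coeff n x) :
    PreTilt.val L v O hv p x = v (algebraMap O L z) ^ p ^ n := by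
  have h1 : PreTilt.val L v O hv p x = ModP.preVal L v O p (PreTilt.coeff n x) ^ p ^ n :=
    PreTilt.valAux_eq hv hn
  rw [h1, ← hz]
  rw [← hz] at hn
  exact congrArg (· ^ p ^ n) (ModP.preVal_mk hv hn)

theorem tiltVal_le_one (x : PreTilt O p) : PreTilt.val L v O hv p x ≤ 1 := by
  by_cases hx : x = 0
  · rw [hx, map_zero]; exact zero_le_one
  obtain ⟨n, hn⟩ := tilt_exists_coeff_ne_zero hx
  obtain ⟨z, hz⟩ := Ideal.Quotient.mk_surjective (PreTilt.coeff n x)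
  rw [tiltVal_eq hv hn hz]
  exact pow_le_one₀ (by simp) (hv.map_le_one z)

theorem tiltVal_le_of_coeff_zero_eq_zero {x : PreTilt O p} (h : PreTilt.coeff 0 x = 0) :
    PreTilt.val L v O hv p x ≤ v (p : L) := by
  by_cases hx : x = 0
  · rw [hx, map_zero]; simp
  obtain ⟨n, hn⟩ := tilt_exists_coeff_ne_zero hx
  obtain ⟨z, hz⟩ := Ideal.Quotient.mk_surjective (PreTilt.coeff n x)
  rw [tiltVal_eq hv hn hz, ← map_pow, ← map_pow, ← dvd_p_iff hv, ← Ideal.mem_span_singleton,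
    ← Ideal.Quotient.eq_zero_iff_mem, map_pow]
  have h1 := tiltCoeff_add_pow x 0 n
  rw [zero_add, h, ← hz] at h1
  exact h1

/-- The tilt is the valuation ring of its valuation: the quotients of the components of `x` and `y`
converge, after raising to `p`-th powers. -/
theorem tilt_dvd_of_val_le {x y : PreTilt O p}
    (h : PreTilt.val L v O hv p x ≤ PreTilt.val L v O hv p y) : y ∣ x := by
  have hp := (Fact.out : p.Prime)
  by_cases hx : x = 0
  · rw [hx]; exact dvd_zero y
  have hy : y ≠ 0 := by
    rintro rfl
    rw [map_zero, nonpos_iff_eq_zero, PreTilt.map_eq_zero] at h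
    exact hx h
  obtain ⟨a, ha⟩ := tilt_exists_coeff_ne_zero hx
  obtain ⟨b, hb⟩ := tilt_exists_coeff_ne_zero hy
  choose X hX using fun n => Ideal.Quotient.mk_surjective (PreTilt.coeff n x)
  choose Y hY using fun n => Ideal.Quotient.mk_surjective (PreTilt.coeff n y)
  let m := max a b
  have hxm : ∀ n, PreTilt.coeff (m + n) x ≠ 0 := fun n =>
    tiltCoeff_ne_zero_of_le ha ((le_max_left a b).trans (Nat.le_add_right _ _))
  have hym : ∀ n, PreTilt.coeff (m + n) y ≠ 0 := fun n =>
    tiltCoeff_ne_zero_of_le hb ((le_max_right a b).trans (Nat.le_add_right _ _))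
  have hdvd : ∀ n, ∃ z, X (m + n) = Y (m + n) * z := by
    intro n
    refine hv.dvd_of_le ?_
    rw [tiltVal_eq hv (hxm n) (hX _), tiltVal_eq hv (hym n) (hY _)] at h
    exact le_of_pow_le_pow_left₀ (pow_ne_zero _ hp.ne_zero) (by simp) h
  choose z hz using hdvd
  have hchar : CharP (O ⧸ Ideal.span {(p : O)}) p := inferInstanceAs (CharP (ModP O p) p)
  have hexp : ExpChar (O ⧸ Ideal.span {(p : O)}) p := ExpChar.prime hp
  -- the quotients `z` are compatible up to an error whose `p`-th power is divisible by `p`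
  have hstep : ∀ n, Ideal.Quotient.mk (Ideal.span {(p : O)}) (z (n + 2) ^ p) ^ p =
      Ideal.Quotient.mk (Ideal.span {(p : O)}) (z (n + 1)) ^ p := by
    intro n
    rw [← sub_eq_zero, ← sub_pow_expChar, ← map_sub, ← map_pow, Ideal.Quotient.eq_zero_iff_mem,
      Ideal.mem_span_singleton, dvd_p_iff hv, map_pow, map_pow]
    set δ := z (n + 2) ^ p - z (n + 1) with hδ
    have h1 : (p : O) ∣ Y (m + (n + 1)) * δ := by
      rw [← Ideal.mem_span_singleton, ← Ideal.Quotient.eq_zero_iff_mem, hδ, mul_sub, ← hz, map_sub,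
        map_mul, hX, hY, ← PreTilt.coeff_pow_p x, ← PreTilt.coeff_pow_p y, sub_eq_zero, map_pow]
      erw [← hX (m + (n + 2)), ← hY (m + (n + 2))]
      rw [hz (n + 2), map_mul]
      exact (mul_pow _ _ _).symm
    have h2 : v (p : L) ≤ v (algebraMap O L (Y (m + (n + 1)))) ^ p := by
      rw [← map_pow, ← map_pow, ← not_lt]
      intro h3
      have h4 := (dvd_p_iff hv _).2 h3.le
      rw [← Ideal.mem_span_singleton, ← Ideal.Quotient.eq_zero_iff_mem, map_pow, hY] at h4
      exact hym n ((PreTilt.coeff_pow_p y (m + n)).symm.trans h4)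
    rw [dvd_p_iff hv, map_mul, map_mul] at h1
    have hvp1 : v (p : L) ≤ 1 := by
      rw [← map_natCast (algebraMap O L)]; exact hv.map_le_one _
    have hY0 : 0 < v (algebraMap O L (Y (m + (n + 1)))) := by
      rw [pos_iff_ne_zero]
      intro h0
      apply hym (n + 1)
      rw [← hY, Ideal.Quotient.eq_zero_iff_mem, Ideal.mem_span_singleton, dvd_p_iff hv, h0]
      simp
    have h3 := pow_le_pow_left₀ (by simp) h1 p
    rw [mul_pow] at h3
    have h4 : v (p : L) ^ p ≤ v (algebraMap O L (Y (m + (n + 1)))) ^ p * v (p : L) := by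
      calc v (p : L) ^ p ≤ v (p : L) ^ 2 := pow_le_pow_of_le_one (by simp) hvp1 hp.two_le
        _ = v (p : L) * v (p : L) := sq _
        _ ≤ _ := by gcongr
    exact le_of_mul_le_mul_left (h3.trans h4) (pow_pos hY0 p)
  let c : ℕ → O ⧸ Ideal.span {(p : O)} := fun n => Ideal.Quotient.mk _ (z (n + 2)) ^ p
  have hc : ∀ n, c (n + 1) ^ p = c n := fun n => by
    have := hstep (n + 1)
    rw [map_pow] at this
    exact this
  have hcy : ∀ n, c n * PreTilt.coeff (m + (n + 1)) y = PreTilt.coeff (m + (n + 1)) x := by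
    intro n
    rw [← PreTilt.coeff_pow_p y, ← PreTilt.coeff_pow_p x]
    have h1 := congrArg (Ideal.Quotient.mk (Ideal.span {(p : O)})) (hz (n + 2))
    rw [map_mul, hX, hY] at h1
    show _ * PreTilt.coeff (m + (n + 2)) y ^ p = PreTilt.coeff (m + (n + 2)) x ^ p
    rw [h1]
    exact ((mul_pow _ _ _).trans (mul_comm _ _)).symm
  have hC : ∃ C : PreTilt O p, ∀ n, PreTilt.coeff n C = c n ^ p ^ (m + 1) :=
    ⟨(⟨fun n => c n ^ p ^ (m + 1), fun n =>
      (pow_right_comm _ _ _).trans (congrArg (· ^ p ^ (m + 1)) (hc n))⟩ :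
        Perfection (ModP O p) p), fun n => rfl⟩
  obtain ⟨C, hC⟩ := hC
  refine ⟨C, Perfection.ext fun n => ?_⟩
  show PreTilt.coeff n x = PreTilt.coeff n (y * C)
  rw [map_mul, hC, ← tiltCoeff_add_pow x n (m + 1), ← tiltCoeff_add_pow y n (m + 1),
    show n + (m + 1) = m + (n + 1) by ring, ← hcy n]
  exact (mul_pow _ _ _).trans (mul_comm _ _)

theorem coeff_tiltMap {A B : Type*} [CommRing A] [CommRing B] [Fact (¬ IsUnit (p : A))]
    [Fact (¬ IsUnit (p : B))] (g : A →+* B) (x : PreTilt A p) (n : ℕ) {z : A}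
    (hz : Ideal.Quotient.mk _ z = PreTilt.coeff n x) :
    PreTilt.coeff n (tiltMap p g x) = Ideal.Quotient.mk _ (g z) := by
  have h1 : PreTilt.coeff n (tiltMap p g x) = modPMap p g (PreTilt.coeff n x) := rfl
  rw [h1, ← hz]
  rfl

theorem tiltVal_tiltMap (g : O →+* O) (hg : ∀ z, v (algebraMap O L (g z)) = v (algebraMap O L z))
    (x : PreTilt O p) :
    PreTilt.val L v O hv p (tiltMap p g x) = PreTilt.val L v O hv p x := by
  by_cases hx : x = 0
  · rw [hx, map_zero]
  obtain ⟨n, hn⟩ := tilt_exists_coeff_ne_zero hx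
  obtain ⟨z, hz⟩ := Ideal.Quotient.mk_surjective (PreTilt.coeff n x)
  have h1 := coeff_tiltMap g x n hz
  have h2 : PreTilt.coeff n (tiltMap p g x) ≠ 0 := by
    rw [h1]
    intro h0
    apply hn
    rw [Ideal.Quotient.eq_zero_iff_mem, Ideal.mem_span_singleton, dvd_p_iff hv, hg,
      ← dvd_p_iff hv, ← Ideal.mem_span_singleton, ← Ideal.Quotient.eq_zero_iff_mem] at h0
    rw [← hz]
    exact h0
  rw [tiltVal_eq hv h2 h1.symm, tiltVal_eq hv hn hz, hg]

end TiltValuation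

/-! ### Reductions of `θ` modulo powers of `p` -/

section ThetaModPow

theorem mk_eq_zero_iff_dvd {p : ℕ} {A : Type*} [CommRing A] (n : ℕ) (a : A) :
    Ideal.Quotient.mk (Ideal.span {(p : A)} ^ n) a = 0 ↔ (p : A) ^ n ∣ a := by
  rw [Ideal.Quotient.eq_zero_iff_mem, Ideal.span_singleton_pow, Ideal.mem_span_singleton]

variable {p : ℕ} [Fact p.Prime] {A : Type*} [CommRing A] [Fact (¬ IsUnit (p : A))]

/-- The kernel of `θ` is cut out by the reductions of `θ` modulo the powers of `p`. -/
theorem theta_eq_zero_iff (x : WittVector p (PreTilt A p)) :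
    theta p A x = 0 ↔ ∀ n, fontaineThetaModPPow A p n x = 0 := by
  have h1 : ∀ n, AdicCompletion.evalₐ (Ideal.span {(p : A)}) n (theta p A x) =
      Ideal.Quotient.factorPow (Ideal.span {(p : A)}) (Nat.le_succ n)
        (fontaineThetaModPPow A p n x) :=
    fun n => AdicCompletion.evalₐ_liftRingHom (Ideal.span {(p : A)})
      (fun n => (Ideal.Quotient.factorPow (Ideal.span {(p : A)}) (Nat.le_succ n)).comp
        (fontaineThetaModPPow A p n))
      (fun {m n} hle => by
        ext1 x
        obtain ⟨a, ha⟩ := Ideal.Quotient.mk_surjective (fontaineThetaModPPow A p n x)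
        rw [RingHom.comp_apply, RingHom.comp_apply, RingHom.comp_apply, ← ha,
          thetaMod_le p A hle x a ha.symm]
        rfl) n x
  constructor
  · intro h n
    obtain ⟨a, ha⟩ := Ideal.Quotient.mk_surjective (fontaineThetaModPPow A p (n + 1) x)
    rw [thetaMod_succ p A n x a ha.symm]
    have h2 := h1 (n + 1)
    rw [h, map_zero, ← ha] at h2
    exact h2.symm
  · intro h
    refine AdicCompletion.ext_evalₐ fun n => ?_
    rw [h1, h, map_zero, map_zero]

/-- If `θ(w)` is `p` times a unit, then `θ(w x) = 0` forces `θ(x) = 0`. -/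
theorem theta_eq_zero_of_mul (hA : ∀ a : A, (p : A) * a = 0 → a = 0)
    {w x : WittVector p (PreTilt A p)}
    (hw : ∀ n, ∃ u : A, IsUnit u ∧ fontaineThetaModPPow A p n w = Ideal.Quotient.mk _ (p * u))
    (h : theta p A (w * x) = 0) : theta p A x = 0 := by
  rw [theta_eq_zero_iff] at h ⊢
  intro n
  obtain ⟨a, ha⟩ := Ideal.Quotient.mk_surjective (fontaineThetaModPPow A p (n + 1) x)
  obtain ⟨u, hu, hwu⟩ := hw (n + 1)
  have h1 := h (n + 1)
  rw [map_mul, hwu, ← ha, ← map_mul, mk_eq_zero_iff_dvd] at h1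
  rw [thetaMod_succ p A n x a ha.symm, mk_eq_zero_iff_dvd]
  obtain ⟨b, hb⟩ := h1
  have h2 : u * a = p ^ (n + 1) * b := by
    rw [← sub_eq_zero]
    apply hA
    rw [mul_sub, ← mul_assoc, hb]
    ring
  exact (hu.dvd_mul_left).1 ⟨b, h2⟩

theorem theta_eq_zero_of_p_mul (hA : ∀ a : A, (p : A) * a = 0 → a = 0)
    {x : WittVector p (PreTilt A p)} (h : theta p A (p * x) = 0) : theta p A x = 0 :=
  theta_eq_zero_of_mul hA (fun n => ⟨1, isUnit_one, by rw [mul_one, map_natCast, map_natCast]⟩) h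

theorem thetaMod_map_tiltMap {B : Type*} [CommRing B] [Fact (¬ IsUnit (p : B))] (g : A →+* B)
    (n : ℕ) (x : WittVector p (PreTilt A p)) {a : A}
    (ha : fontaineThetaModPPow A p n x = Ideal.Quotient.mk _ a) :
    fontaineThetaModPPow B p n (WittVector.map (tiltMap p g) x) = Ideal.Quotient.mk _ (g a) := by
  choose z hz using fun i => Ideal.Quotient.mk_surjective (PreTilt.coeff n (x.coeff i))
  rw [thetaMod_eq_of_lift p A n x z hz, ← sub_eq_zero, ← map_sub, mk_eq_zero_iff_dvd] at ha
  rw [thetaMod_eq_of_lift p B n _ (fun i => g (z i)) (fun i => by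
    rw [WittVector.map_coeff, coeff_tiltMap g _ n (hz i)]), ← sub_eq_zero, ← map_sub,
    mk_eq_zero_iff_dvd]
  have := map_dvd g ha
  simpa using this

theorem thetaMod_zero_eq_mk_iff (x : WittVector p (PreTilt A p)) (a : A) :
    fontaineThetaModPPow A p 0 x = Ideal.Quotient.mk _ a ↔
      PreTilt.coeff 0 (x.coeff 0) = Ideal.Quotient.mk (Ideal.span {(p : A)}) a := by
  choose z hz using fun i => Ideal.Quotient.mk_surjective (PreTilt.coeff 0 (x.coeff i))
  rw [thetaMod_eq_of_lift p A 0 x z hz, ← hz 0, Ideal.Quotient.eq]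
  erw [Ideal.Quotient.eq]
  simp

end ThetaModPow

/-! ### The minimal polynomial of a uniformizer -/

section Eisenstein

theorem isPrecomplete_pi {R : Type*} [CommRing R] (I : Ideal R) [IsPrecomplete I R] (ι : Type*)
    [Finite ι] : IsPrecomplete I (ι → R) := by
  classical
  have := Fintype.ofFinite ι
  refine ⟨fun f hf => ?_⟩
  have h1 : ∀ i, ∃ l, ∀ n, f n i ≡ l [SMOD (I ^ n • ⊤ : Submodule R R)] := fun i =>
    IsPrecomplete.prec inferInstance fun {m n} hmn => by
      rw [SModEq.sub_mem]
      have h2 := SModEq.sub_mem.1 (hf hmn)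
      exact map_mem_smul_top (LinearMap.proj i : (ι → R) →ₗ[R] R) h2
  choose l hl using h1
  refine ⟨l, fun n => ?_⟩
  rw [SModEq.sub_mem, ← Finset.univ_sum_single (f n - l)]
  refine Submodule.sum_mem _ fun i _ => ?_
  exact map_mem_smul_top (LinearMap.single R (fun _ => R) i) (SModEq.sub_mem.1 (hl i n))

theorem natCast_integer_ne_zero {p : ℕ} [Fact p.Prime] {K : Type*} [NontriviallyNormedField K]
    [IsUltrametricDist K] [hn : Fact (‖(p : K)‖ = (p : ℝ)⁻¹)] : (p : IntegerRing K) ≠ 0 := by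
  intro h
  have h1 : ((p : IntegerRing K) : K) = 0 := by rw [h]; rfl
  have h2 : (p : K) = 0 := by simpa using h1
  have h3 := hn.out
  rw [h2, norm_zero] at h3
  exact (inv_ne_zero (Nat.cast_ne_zero.2 (Fact.out : p.Prime).ne_zero)) h3.symm

variable {p : ℕ} [Fact p.Prime]
  {K : Type*} [NontriviallyNormedField K] [IsUltrametricDist K] [CompleteSpace K]
  [IsDiscreteValuationRing (IntegerRing K)] [PerfectField (ResField K)]
  [Fact (‖(p : K)‖ = (p : ℝ)⁻¹)]

theorem residue_wittToO (b : WittVector p (ResField K)) :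
    IsLocalRing.residue (IntegerRing K) (wittToO p K b) = b.coeff 0 := by
  have h1 : IsLocalRing.residue (IntegerRing K) (wittToO p K b) =
      modPResidue p (IntegerRing K) (Ideal.Quotient.mk _ (wittToO p K b)) := rfl
  rw [h1, wittToO, RingHom.comp_apply, WittVector.mk_fontaineTheta, WittVector.map_coeff]
  exact (residueEquiv p K).apply_symm_apply (b.coeff 0)

theorem dvd_wittToO_iff {ϖ : IntegerRing K} (hϖ : Irreducible ϖ)
    (b : WittVector p (ResField K)) : ϖ ∣ wittToO p K b ↔ b.coeff 0 = 0 := by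
  rw [← residue_wittToO, IsLocalRing.residue_eq_zero_iff, hϖ.maximalIdeal_eq,
    Ideal.mem_span_singleton]

/-- Expansion to finite order in powers of a uniformizer with coefficients in `W(k)`. -/
theorem exists_sum_wittToO {ϖ : IntegerRing K} (hϖ : Irreducible ϖ) (N : ℕ) (a : IntegerRing K) :
    ∃ c : Fin N → WittVector p (ResField K), ϖ ^ N ∣ a - ∑ i, wittToO p K (c i) * ϖ ^ (i : ℕ) := by
  induction N with
  | zero => exact ⟨0, by simp⟩
  | succ N ih =>
    obtain ⟨c, b, hb⟩ := ih
    let d : WittVector p (ResField K) :=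
      WittVector.teichmuller p (IsLocalRing.residue (IntegerRing K) b)
    have hd : ϖ ∣ b - wittToO p K d := by
      rw [← Ideal.mem_span_singleton, ← hϖ.maximalIdeal_eq, ← IsLocalRing.residue_eq_zero_iff,
        map_sub, residue_wittToO, WittVector.teichmuller_coeff_zero, sub_self]
    refine ⟨Fin.snoc c d, ?_⟩
    rw [Fin.sum_univ_castSucc]
    simp only [Fin.snoc_castSucc, Fin.snoc_last, Fin.val_castSucc, Fin.val_last]
    rw [← sub_sub, hb, mul_comm, ← sub_mul, pow_succ']
    exact mul_dvd_mul_right hd _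

/-- `𝒪_K` is spanned over `W(k)` by the first `e` powers of a uniformizer, where `e` is the
ramification index. -/
theorem exists_eq_sum_wittToO {ϖ : IntegerRing K} (hϖ : Irreducible ϖ) {e : ℕ}
    (he : Associated (p : IntegerRing K) (ϖ ^ e)) (a : IntegerRing K) :
    ∃ c : Fin e → WittVector p (ResField K), a = ∑ i, wittToO p K (c i) * ϖ ^ (i : ℕ) := by
  have := charPResidue p (IntegerRing K)
  have : ExpChar (ResField K) p := ExpChar.prime Fact.out
  have : PerfectRing (ResField K) p := PerfectField.toPerfectRing p
  let : Algebra (WittVector p (ResField K)) (IntegerRing K) := (wittToO p K).toAlgebra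
  let I : Ideal (WittVector p (ResField K)) := Ideal.span {(p : WittVector p (ResField K))}
  have hI : I.map (algebraMap (WittVector p (ResField K)) (IntegerRing K)) =
      Ideal.span {(p : IntegerRing K)} := by
    rw [Ideal.map_span, Set.image_singleton, map_natCast]
  have : IsHausdorff I (IntegerRing K) := by
    rw [← IsHausdorff.map_algebraMap_iff (S := IntegerRing K), hI]
    infer_instance
  let f : (Fin e → WittVector p (ResField K)) →ₗ[WittVector p (ResField K)] IntegerRing K :=
    Fintype.linearCombination _ fun i => ϖ ^ (i : ℕ)
  have hf : ∀ c, f c = ∑ i, wittToO p K (c i) * ϖ ^ (i : ℕ) := fun c => rfl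
  have hsurj : Function.Surjective f := by
    have := isPrecomplete_pi I (Fin e)
    apply surjective_of_mkQ_comp_surjective (I := I)
    intro y
    obtain ⟨y, rfl⟩ := Submodule.Quotient.mk_surjective _ y
    obtain ⟨c, hc⟩ := exists_sum_wittToO (p := p) hϖ e y
    refine ⟨c, ?_⟩
    rw [LinearMap.comp_apply, Submodule.mkQ_apply, eq_comm, Submodule.Quotient.eq, hf]
    obtain ⟨z, hz⟩ := he.dvd.trans hc
    rw [hz]
    have : (p : IntegerRing K) * z = (p : WittVector p (ResField K)) • z := by
      rw [Algebra.smul_def, map_natCast]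
    rw [this]
    exact Submodule.smul_mem_smul (Ideal.mem_span_singleton_self _) trivial
  obtain ⟨c, hc⟩ := hsurj a
  exact ⟨c, hc.symm⟩

variable {L : Type*} [Field L] [Algebra K L] [Algebra.IsAlgebraic K L]

/-- `E` is an Eisenstein polynomial, of degree the ramification index `e`. -/
theorem IterateData.exists_E_eq (D : IterateData p K L) :
    ∃ e : ℕ, 0 < e ∧ Associated (p : IntegerRing K) (D.unif ^ e) ∧
      ∃ G : Polynomial (WittVector p (ResField K)), IsUnit (G.coeff 0) ∧
        D.E = Polynomial.X ^ e + Polynomial.C (p : WittVector p (ResField K)) * G := by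
  have := charPResidue p (IntegerRing K)
  have : ExpChar (ResField K) p := ExpChar.prime Fact.out
  have : PerfectRing (ResField K) p := PerfectField.toPerfectRing p
  have hϖ := D.irreducible_unif
  obtain ⟨e, he⟩ := IsDiscreteValuationRing.associated_pow_irreducible
    (natCast_integer_ne_zero (p := p) (K := K)) hϖ
  have he0 : 0 < e := by
    rw [pos_iff_ne_zero]
    rintro rfl
    rw [pow_zero] at he
    exact (notUnitO K p).out (associated_one_iff_isUnit.1 he)
  refine ⟨e, he0, he, ?_⟩
  let : Algebra (WittVector p (ResField K)) (IntegerRing K) := (wittToO p K).toAlgebra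
  obtain ⟨c, hc⟩ := exists_eq_sum_wittToO (p := p) hϖ he (D.unif ^ e)
  let Q : Polynomial (WittVector p (ResField K)) :=
    ∑ i, Polynomial.C (c i) * Polynomial.X ^ (i : ℕ)
  have hQdeg : Q.degree < e := by
    rw [Polynomial.degree_lt_iff_coeff_zero]
    intro m hm
    rw [Polynomial.finsetSum_coeff]
    refine Finset.sum_eq_zero fun i _ => ?_
    rw [Polynomial.coeff_C_mul_X_pow, if_neg (by omega)]
  have hPmonic : (Polynomial.X ^ e - Q).Monic := Polynomial.monic_X_pow_sub hQdeg
  have hProot : Polynomial.aeval D.unif (Polynomial.X ^ e - Q) = 0 := by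
    rw [map_sub, map_pow, Polynomial.aeval_X, sub_eq_zero]
    have halg : ∀ b, algebraMap (WittVector p (ResField K)) (IntegerRing K) b = wittToO p K b :=
      fun _ => rfl
    simpa [Q, halg] using hc
  have hint : IsIntegral (WittVector p (ResField K)) D.unif := ⟨_, hPmonic, hProot⟩
  have hEdef : D.E = minpoly (WittVector p (ResField K)) D.unif := rfl
  have hEmonic : D.E.Monic := minpoly.monic hint
  have hEroot : Polynomial.aeval D.unif D.E = 0 := minpoly.aeval _ _
  have hEdeg : D.E.natDegree ≤ e := by
    have h1 := minpoly.min _ _ hPmonic hProot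
    refine Polynomial.natDegree_le_iff_degree_le.2 (h1.trans ?_)
    exact (Polynomial.degree_sub_le _ _).trans
      (max_le (Polynomial.degree_X_pow_le e) hQdeg.le)
  have hEsum : ∑ i ∈ Finset.range (D.E.natDegree + 1),
      wittToO p K (D.E.coeff i) * D.unif ^ i = 0 := by
    rw [Polynomial.aeval_eq_sum_range] at hEroot
    exact hEroot
  have hdvd0 : ∀ b : WittVector p (ResField K), (p : WittVector p (ResField K)) ∣ b ↔
      b.coeff 0 = 0 := fun b => by
    rw [← Ideal.mem_span_singleton, WittVector.mem_span_p_iff_coeff_zero_eq_zero]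
  -- in `E(π) = 0`, the terms other than the one of degree `i < e` are divisible by `π ^ (i + 1)`:
  -- those of smaller degree since their coefficients are divisible by `p`
  have hlow : ∀ i, i < e → (D.E.coeff i).coeff 0 = 0 := by
    intro i
    induction i using Nat.strong_induction_on with
    | _ i ih =>
      intro hi
      by_cases hid : D.E.natDegree < i
      · rw [Polynomial.coeff_eq_zero_of_natDegree_lt hid, WittVector.zero_coeff]
      have hmem : i ∈ Finset.range (D.E.natDegree + 1) := Finset.mem_range.2 (by omega)
      rw [← Finset.add_sum_erase _ _ hmem] at hEsum
      have h1 : D.unif ^ (i + 1) ∣ ∑ x ∈ (Finset.range (D.E.natDegree + 1)).erase i,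
          wittToO p K (D.E.coeff x) * D.unif ^ x := by
        refine Finset.dvd_sum fun x hx => ?_
        rcases lt_or_gt_of_ne (Finset.ne_of_mem_erase hx) with h | h
        · obtain ⟨b, hb⟩ := (hdvd0 _).2 (ih x h (h.trans hi))
          rw [hb, map_mul, map_natCast, mul_assoc]
          exact ((pow_dvd_pow _ hi).trans he.symm.dvd).trans (dvd_mul_right _ _)
        · exact (pow_dvd_pow _ h).trans (dvd_mul_left _ _)
      have h2 : D.unif ^ (i + 1) ∣ wittToO p K (D.E.coeff i) * D.unif ^ i := by
        rw [eq_neg_of_add_eq_zero_left hEsum]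
        exact h1.neg_right
      rw [pow_succ'] at h2
      exact (dvd_wittToO_iff hϖ _).1
        ((mul_dvd_mul_iff_right (pow_ne_zero i hϖ.ne_zero)).1 h2)
  have hdeg : D.E.natDegree = e := by
    refine le_antisymm hEdeg (not_lt.1 fun h => ?_)
    have h1 := hlow _ h
    rw [hEmonic.coeff_natDegree, WittVector.one_coeff_zero] at h1
    exact one_ne_zero h1
  have hG : Polynomial.C (p : WittVector p (ResField K)) ∣ D.E - Polynomial.X ^ e := by
    rw [Polynomial.C_dvd_iff_dvd_coeff]
    intro i
    rw [Polynomial.coeff_sub, Polynomial.coeff_X_pow]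
    rcases lt_trichotomy i e with h | h | h
    · rw [if_neg h.ne, sub_zero, hdvd0]
      exact hlow i h
    · rw [if_pos h, h]
      have := hEmonic.coeff_natDegree
      rw [hdeg] at this
      rw [this, sub_self]
      exact dvd_zero _
    · rw [if_neg h.ne', sub_zero, Polynomial.coeff_eq_zero_of_natDegree_lt (by omega)]
      exact dvd_zero _
  obtain ⟨G, hG⟩ := hG
  have hEG : D.E = Polynomial.X ^ e + Polynomial.C (p : WittVector p (ResField K)) * G := by
    rw [← hG]; ring
  refine ⟨G, ?_, hEG⟩
  -- `π ^ e + p G(π) = 0` shows that `G(π)` is a unit, and `G(π) ≡ G(0)` modulo `π`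
  have h1 : D.unif ^ e + p * Polynomial.aeval D.unif G = 0 := by
    rw [hEG] at hEroot
    simpa using hEroot
  obtain ⟨u, hu⟩ := he
  have h2 : ¬ D.unif ∣ Polynomial.aeval D.unif G := by
    intro h
    rw [← hu, ← mul_add, mul_eq_zero] at h1
    have h3 := h1.resolve_left natCast_integer_ne_zero
    have h4 : D.unif ∣ (u : IntegerRing K) := by
      rw [eq_neg_of_add_eq_zero_left h3]
      exact h.neg_right
    exact hϖ.not_isUnit (isUnit_of_dvd_unit h4 u.isUnit)
  have h3 : D.unif ∣ Polynomial.aeval D.unif G - wittToO p K (G.coeff 0) := by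
    have h4 := Polynomial.X_dvd_sub_C (p := G)
    have h5 := map_dvd (Polynomial.aeval D.unif) h4
    rwa [Polynomial.aeval_X, map_sub, Polynomial.aeval_C] at h5
  apply WittVector.isUnit_of_coeff_zero_ne_zero
  intro h0
  exact h2 ((dvd_sub_left ((dvd_wittToO_iff hϖ _).2 h0)).1 h3)

end Eisenstein

/-! ### The values of `θ` on the Frobenius iterates of `{π}_f` -/

section ThetaOfSection
variable {p : ℕ} [Fact p.Prime]
  {K : Type*} [NontriviallyNormedField K] [IsUltrametricDist K] [CompleteSpace K]
  [IsDiscreteValuationRing (IntegerRing K)] [PerfectField (ResField K)]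
  [hn : Fact (‖(p : K)‖ = (p : ℝ)⁻¹)]
  {L : Type*} [Field L] [Algebra K L] [Algebra.IsAlgebraic K L]

theorem thetaMod_wittToWR (n : ℕ) (b : WittVector p (ResField K)) :
    fontaineThetaModPPow (BigIntegerRing K L) p n (wittToWR p K L b) =
      Ideal.Quotient.mk _ (inclO K L (wittToO p K b)) := by
  have h1 : wittToWR p K L b = WittVector.map (tiltMap p (inclO K L))
      (WittVector.map ((residueEquiv p K).symm : ResField K →+* PreTilt (IntegerRing K) p) b) :=
    rfl
  rw [h1]
  exact thetaMod_map_tiltMap _ n _ (WittVector.mk_pow_fontaineTheta n _).symm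

theorem frobenius_wittToWR_zpToW (a : ℤ_[p]) :
    WittVector.frobenius (wittToWR p K L (zpToW p K a)) = wittToWR p K L (zpToW p K a) := by
  have := charPResidue p (IntegerRing K)
  obtain ⟨b, hb⟩ : ∃ b : WittVector p (ZMod p), zpToW p K a =
      WittVector.map (ZMod.castHom (dvd_refl p) (ResField K)) b := ⟨_, rfl⟩
  rw [hb, wittToWR]
  ext n
  rw [WittVector.coeff_frobenius_charP, WittVector.map_coeff, WittVector.map_coeff, ← map_pow,
    ← map_pow, ZMod.pow_card]

namespace IterateData
variable (D : IterateData p K L)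

/-- The polynomial `f` as a self-map of `𝒪_L`. -/
def evalO (z : BigIntegerRing K L) : BigIntegerRing K L :=
  D.f.eval₂ ((inclO K L).comp ((wittToO p K).comp (zpToW p K))) z

theorem thetaMod_eval (n : ℕ) {w : WittVector p (TiltR p K L)} {z : BigIntegerRing K L}
    (h : fontaineThetaModPPow (BigIntegerRing K L) p n w = Ideal.Quotient.mk _ z) :
    fontaineThetaModPPow (BigIntegerRing K L) p n (D.fW.eval₂ (wittToWR p K L) w) =
      Ideal.Quotient.mk _ (D.evalO z) := by
  rw [evalO, fW, Polynomial.eval₂_map, Polynomial.hom_eval₂, Polynomial.hom_eval₂, h]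
  congr 1
  ext1 a
  simp only [RingHom.comp_apply]
  exact thetaMod_wittToWR n _

theorem frobenius_eval (w : WittVector p (TiltR p K L)) :
    WittVector.frobenius (D.fW.eval₂ (wittToWR p K L) w) =
      D.fW.eval₂ (wittToWR p K L) (WittVector.frobenius w) := by
  rw [fW, Polynomial.eval₂_map, Polynomial.eval₂_map, Polynomial.hom_eval₂]
  congr 1
  ext1 a
  exact frobenius_wittToWR_zpToW a

/-- `f` contracts `p`-adic distances. -/
theorem dvd_evalO_sub (n : ℕ) {a b : BigIntegerRing K L}
    (h : (p : BigIntegerRing K L) ^ (n + 1) ∣ a - b) :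
    (p : BigIntegerRing K L) ^ (n + 2) ∣ D.evalO a - D.evalO b := by
  obtain ⟨g, hg⟩ := D.cong
  have h1 : D.f = Polynomial.X ^ p + Polynomial.C (p : ℤ_[p]) * g := by rw [← hg]; ring
  have h2 := pow_dvd_eval_sub (p := p)
    (D.f.map ((inclO K L).comp ((wittToO p K).comp (zpToW p K))))
    (g.map ((inclO K L).comp ((wittToO p K).comp (zpToW p K)))) (by rw [h1]; simp) n a b h
  rwa [Polynomial.eval_map, Polynomial.eval_map] at h2

/-- `θ` sends `φ⁻ⁱ({π}_f)` to `π_i`: the two sequences agree modulo `p` and are both inverse orbits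
of `f`, which contracts `p`-adic distances. -/
theorem thetaMod_symm_frobenius_sect (k i : ℕ) :
    fontaineThetaModPPow (BigIntegerRing K L) p k
      ((WittVector.frobeniusEquiv p (TiltR p K L)).symm^[i] (D.sect D.piR)) =
        Ideal.Quotient.mk _ (D.seq i) := by
  set ψ := (WittVector.frobeniusEquiv p (TiltR p K L)).symm with hψ
  have hφψ : ∀ w, WittVector.frobenius (ψ w) = w :=
    (WittVector.frobeniusEquiv p (TiltR p K L)).apply_symm_apply
  have hinj : Function.Injective (WittVector.frobenius : WittVector p (TiltR p K L) →+* _) :=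
    (WittVector.frobeniusEquiv p (TiltR p K L)).injective
  have hcoeff : ∀ i (w : WittVector p (TiltR p K L)),
      PreTilt.coeff 0 ((ψ^[i] w).coeff 0) = PreTilt.coeff i (w.coeff 0) := by
    intro i
    induction i with
    | zero => intro w; rfl
    | succ i ih =>
      intro w
      have h1 : w.coeff 0 = (ψ w).coeff 0 ^ p := by
        rw [← WittVector.coeff_frobenius_charP, hφψ]
      rw [Function.iterate_succ_apply, ih, h1, map_pow, PreTilt.coeff_pow_p]
  have hstep : ∀ i, D.fW.eval₂ (wittToWR p K L) (ψ^[i + 1] (D.sect D.piR)) =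
      ψ^[i] (D.sect D.piR) := by
    intro i
    induction i with
    | zero =>
      apply hinj
      rw [frobenius_eval, Function.iterate_succ_apply', hφψ]
      exact (D.frobenius_sect _).symm
    | succ i ih =>
      apply hinj
      rw [frobenius_eval, Function.iterate_succ_apply', Function.iterate_succ_apply' _ i, hφψ, hφψ]
      rwa [Function.iterate_succ_apply'] at ih
  induction k generalizing i with
  | zero =>
    rw [thetaMod_zero_eq_mk_iff, hcoeff, sect_coeff_zero]
    rfl
  | succ k ih =>
    obtain ⟨a, ha⟩ := Ideal.Quotient.mk_surjective
      (fontaineThetaModPPow (BigIntegerRing K L) p (k + 1) (ψ^[i + 1] (D.sect D.piR)))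
    have h1 := D.thetaMod_eval (k + 1) ha.symm
    rw [hstep] at h1
    have h2 := thetaMod_succ p _ k _ a ha.symm
    rw [ih (i + 1), ← sub_eq_zero, ← map_sub, mk_eq_zero_iff_dvd] at h2
    have h3 := D.dvd_evalO_sub k h2
    have h4 : D.evalO (D.seq (i + 1)) = D.seq i := D.seq_succ i
    rw [h1, ← h4, eq_comm, ← sub_eq_zero, ← map_sub, mk_eq_zero_iff_dvd]
    exact h3

/-- `θ` sends `φᵐ({π}_f)` to the `m`-fold iterate of `f` at `π`. -/
theorem thetaMod_frobenius_sect (n m : ℕ) :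
    fontaineThetaModPPow (BigIntegerRing K L) p n
      ((WittVector.frobenius : WittVector p (TiltR p K L) →+* _)^[m] (D.sect D.piR)) =
        Ideal.Quotient.mk _ (D.evalO^[m] (D.seq 0)) := by
  have hstep : ∀ m, (WittVector.frobenius : WittVector p (TiltR p K L) →+* _)^[m + 1]
      (D.sect D.piR) = D.fW.eval₂ (wittToWR p K L)
        ((WittVector.frobenius : WittVector p (TiltR p K L) →+* _)^[m] (D.sect D.piR)) := by
    intro m
    induction m with
    | zero => exact D.frobenius_sect _
    | succ m ih =>
      rw [Function.iterate_succ_apply', ih, frobenius_eval]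
      rw [Function.iterate_succ_apply'] at ih
      rw [ih]
  induction m with
  | zero => exact D.thetaMod_symm_frobenius_sect n 0
  | succ m ih =>
    rw [hstep, D.thetaMod_eval n ih, Function.iterate_succ_apply']

end IterateData
end ThetaOfSection

/-! ### The element `E` of `W(R)` -/

section Generator
variable {p : ℕ} [Fact p.Prime]
  {K : Type*} [NontriviallyNormedField K] [IsUltrametricDist K] [CompleteSpace K]
  [hn : Fact (‖(p : K)‖ = (p : ℝ)⁻¹)]
  {L : Type*} [Field L] [Algebra K L] [Algebra.IsAlgebraic K L]

theorem absVal_algebraMap (x : K) : (absVal K L (algebraMap K L x) : ℝ) = ‖x‖ :=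
  spectralNorm_extends x

theorem absVal_p (p : ℕ) (K : Type*) [NontriviallyNormedField K] [IsUltrametricDist K]
    [CompleteSpace K] [hn : Fact (‖(p : K)‖ = (p : ℝ)⁻¹)] (L : Type*) [Field L] [Algebra K L]
    [Algebra.IsAlgebraic K L] : (absVal K L (p : L) : ℝ) = (p : ℝ)⁻¹ := by
  rw [← map_natCast (algebraMap K L), absVal_algebraMap, hn.out]

variable (p K L) in
theorem absVal_p_lt_one : absVal K L (p : L) < 1 := by
  rw [← NNReal.coe_lt_coe, absVal_p p K L]
  exact inv_lt_one_of_one_lt₀ (by exact_mod_cast (Fact.out : p.Prime).one_lt)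

variable (p K L) in
theorem absVal_p_ne_zero : absVal K L (p : L) ≠ 0 := by
  rw [← NNReal.coe_ne_zero, absVal_p p K L]
  exact inv_ne_zero (Nat.cast_ne_zero.2 (Fact.out : p.Prime).ne_zero)

variable (K L) in
theorem absVal_integers : (absVal K L).Integers (BigIntegerRing K L) :=
  Valuation.integer.integers (absVal K L)

theorem eq_zero_of_p_mul_bigO (a : BigIntegerRing K L) (h : (p : BigIntegerRing K L) * a = 0) :
    a = 0 := by
  have h1 := congrArg (absVal K L) (congrArg Subtype.val h)
  have h2 : absVal K L ((p : L) * a) = 0 := by simpa using h1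
  rw [map_mul] at h2
  exact Subtype.ext ((map_eq_zero (absVal K L)).1
    ((mul_eq_zero.1 h2).resolve_left (absVal_p_ne_zero p K L)))

theorem isUnit_bigO_iff (a : BigIntegerRing K L) : IsUnit a ↔ absVal K L (a : L) = 1 :=
  (absVal_integers K L).isUnit_iff_valuation_eq_one

variable [IsDiscreteValuationRing (IntegerRing K)] [PerfectField (ResField K)]

/-- The valuation of `R`, written multiplicatively. -/
abbrev tiltVal (p : ℕ) [Fact p.Prime] (K : Type*) [NontriviallyNormedField K]
    [IsUltrametricDist K] [CompleteSpace K] [Fact (‖(p : K)‖ = (p : ℝ)⁻¹)]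
    (L : Type*) [Field L] [Algebra K L] [Algebra.IsAlgebraic K L] :
    Valuation (TiltR p K L) ℝ≥0 :=
  PreTilt.val L (absVal K L) (BigIntegerRing K L) (absVal_integers K L) p

namespace IterateData
variable (D : IterateData p K L)

/-- As `f` has no constant term and is congruent to `u ^ p` modulo `p`, it has the form
`u (u ^ (p - 1) + p g(u))`. -/
theorem exists_evalO_eq : ∃ g : BigIntegerRing K L → BigIntegerRing K L,
    ∀ z, D.evalO z = z * (z ^ (p - 1) + p * g z) := by
  have hp := (Fact.out : p.Prime)
  obtain ⟨g, hg⟩ := D.cong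
  have h1 : D.f = Polynomial.X ^ p + Polynomial.C (p : ℤ_[p]) * g := by rw [← hg]; ring
  have h2 : g.coeff 0 = 0 := by
    have h3 := D.coeff_zero
    rw [h1, Polynomial.coeff_add, Polynomial.coeff_C_mul, Polynomial.coeff_X_pow,
      if_neg hp.ne_zero.symm, zero_add, mul_eq_zero] at h3
    exact h3.resolve_left (Nat.cast_ne_zero.2 hp.ne_zero)
  obtain ⟨g', rfl⟩ := Polynomial.X_dvd_iff.2 h2
  refine ⟨fun z => g'.eval₂ ((inclO K L).comp ((wittToO p K).comp (zpToW p K))) z, fun z => ?_⟩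
  rw [evalO, h1]
  have hpow : z ^ p = z * z ^ (p - 1) := by
    rw [← pow_succ', Nat.sub_add_cancel hp.pos]
  rw [Polynomial.eval₂_add, Polynomial.eval₂_mul, Polynomial.eval₂_mul, Polynomial.eval₂_X_pow,
    Polynomial.eval₂_X, Polynomial.eval₂_C, map_natCast, hpow]
  ring

theorem absVal_seq_zero_lt_one : absVal K L (D.seq 0 : L) < 1 := by
  rw [D.seq_zero]
  refine lt_of_le_of_ne (inclO K L D.unif).2 fun h => ?_
  have h1 : ‖(D.unif : K)‖ = 1 := by
    rw [← absVal_algebraMap (L := L)]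
    exact congrArg NNReal.toReal h
  apply D.irreducible_unif.not_isUnit
  rw [(Valuation.integer.integers (NormedField.valuation (K := K))).isUnit_iff_valuation_eq_one]
  exact NNReal.eq h1

theorem absVal_seq_zero_pow {e : ℕ} (he : Associated (p : IntegerRing K) (D.unif ^ e)) :
    absVal K L (D.seq 0 : L) ^ e = absVal K L (p : L) := by
  have h1 : Associated (p : BigIntegerRing K L) (D.seq 0 ^ e) := by
    have := he.map (inclO K L)
    rwa [map_natCast, map_pow, ← D.seq_zero] at this
  obtain ⟨u, hu⟩ := h1
  have h2 := congrArg (absVal K L) (congrArg Subtype.val hu)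
  have h3 := (isUnit_bigO_iff _).1 u.isUnit
  simpa [h3] using h2.symm

/-- The valuation of `π̲` is that of `π`. It is computed from the component `π₁`, since the
component `π₀ = π` vanishes modulo `p` if `K` is absolutely unramified. -/
theorem tiltVal_piR {e : ℕ} (he0 : 0 < e)
    (he : Associated (p : IntegerRing K) (D.unif ^ e)) :
    tiltVal p K L D.piR = absVal K L (D.seq 0 : L) := by
  have hp := (Fact.out : p.Prime)
  have hlt := absVal_p_lt_one p K L
  have hle : absVal K L (p : L) ≤ absVal K L (D.seq 0 : L) := by
    rw [← D.absVal_seq_zero_pow he]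
    exact pow_le_of_le_one (by simp) D.absVal_seq_zero_lt_one.le he0.ne'
  obtain ⟨g, hg⟩ := D.exists_evalO_eq
  have h1 : (D.seq 1 : L) ^ p + p * D.seq 1 * g (D.seq 1) = D.seq 0 := by
    have h2 : D.evalO (D.seq 1) = D.seq 0 := D.seq_succ 0
    rw [hg] at h2
    rw [← h2]
    have hpow : (D.seq 1 : L) ^ p = D.seq 1 * (D.seq 1 : L) ^ (p - 1) := by
      rw [← pow_succ', Nat.sub_add_cancel hp.pos]
    push_cast
    rw [hpow]
    ring
  have hg1 : absVal K L (g (D.seq 1) : L) ≤ 1 := (g (D.seq 1)).2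
  have hs1 : absVal K L (D.seq 1 : L) ≤ 1 := (D.seq 1).2
  have hs1' : absVal K L (D.seq 1 : L) < 1 := by
    refine lt_of_le_of_ne hs1 fun h => ?_
    have h2 : absVal K L (p * D.seq 1 * g (D.seq 1) : L) < absVal K L ((D.seq 1 : L) ^ p) := by
      rw [map_mul, map_mul, map_pow, h, one_pow, mul_one]
      exact (mul_le_of_le_one_right (by simp) hg1).trans_lt hlt
    have h3 := Valuation.map_add_eq_of_lt_left (absVal K L) h2
    rw [h1, map_pow, h, one_pow] at h3
    exact D.absVal_seq_zero_lt_one.ne h3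
  have h2 : absVal K L (p * D.seq 1 * g (D.seq 1) : L) < absVal K L (D.seq 0 : L) := by
    refine lt_of_lt_of_le ?_ hle
    rw [map_mul, map_mul]
    calc _ ≤ absVal K L (p : L) * absVal K L (D.seq 1 : L) :=
          mul_le_of_le_one_right (by simp) hg1
      _ < absVal K L (p : L) := mul_lt_of_lt_one_right
          (pos_iff_ne_zero.2 (absVal_p_ne_zero p K L)) hs1'
  have h3 : absVal K L (D.seq 1 : L) ^ p = absVal K L (D.seq 0 : L) := by
    have h4 := Valuation.map_sub_eq_of_lt_left (absVal K L) h2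
    rw [← map_pow, ← h4, ← h1, add_sub_cancel_right]
  have h4 : PreTilt.coeff 1 D.piR ≠ 0 := by
    intro h0
    have h5 : Ideal.Quotient.mk (Ideal.span {(p : BigIntegerRing K L)}) (D.seq 1) = 0 := h0
    rw [Ideal.Quotient.eq_zero_iff_mem, Ideal.mem_span_singleton,
      dvd_p_iff (absVal_integers K L)] at h5
    have h6 : absVal K L (p : L) ≤ absVal K L (p : L) ^ 2 :=
      calc absVal K L (p : L) ≤ absVal K L (D.seq 1 : L) ^ p := h3 ▸ hle
        _ ≤ absVal K L (D.seq 1 : L) ^ 2 := pow_le_pow_of_le_one (by simp) hs1 hp.two_le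
        _ ≤ _ := pow_le_pow_left₀ (by simp) h5 2
    rw [sq] at h6
    exact absurd h6 (not_le.2 (mul_lt_of_lt_one_right
      (pos_iff_ne_zero.2 (absVal_p_ne_zero p K L)) hlt))
  have h5 := tiltVal_eq (absVal_integers K L) h4 (z := D.seq 1) rfl
  rw [pow_one] at h5
  exact h5.trans h3

/-- Applying `f` to `π` strictly decreases the absolute value, and `|π| ^ e = |p|`. -/
theorem absVal_iterate_evalO_lt {m : ℕ} (hm : 0 < m) {e : ℕ} (he0 : 0 < e)
    (he : Associated (p : IntegerRing K) (D.unif ^ e)) :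
    absVal K L (D.evalO^[m] (D.seq 0) : L) ^ e < absVal K L (p : L) := by
  obtain ⟨g, hg⟩ := D.exists_evalO_eq
  have hp := (Fact.out : p.Prime)
  have hpos : 0 < absVal K L (D.seq 0 : L) := by
    rw [pos_iff_ne_zero]
    intro h0
    have := D.absVal_seq_zero_pow he
    rw [h0, zero_pow he0.ne'] at this
    exact absVal_p_ne_zero p K L this.symm
  have hstep : ∀ z : BigIntegerRing K L, absVal K L (z : L) ≤ absVal K L (D.seq 0 : L) →
      absVal K L (D.evalO z : L) < absVal K L (D.seq 0 : L) := by
    intro z hz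
    rw [hg]
    push_cast
    rw [map_mul]
    have h1 : absVal K L ((z : L) ^ (p - 1) + p * (g z : L)) < 1 := by
      refine Valuation.map_add_lt _ ?_ ?_
      · rw [map_pow]
        exact pow_lt_one₀ (by simp) (hz.trans_lt D.absVal_seq_zero_lt_one)
          (Nat.sub_ne_zero_of_lt hp.one_lt)
      · rw [map_mul]
        exact (mul_le_of_le_one_right (by simp) (g z).2).trans_lt (absVal_p_lt_one p K L)
    exact (mul_le_mul_left hz _).trans_lt (mul_lt_of_lt_one_right hpos h1)
  have h1 : ∀ m, absVal K L (D.evalO^[m + 1] (D.seq 0) : L) < absVal K L (D.seq 0 : L) := by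
    intro m
    induction m with
    | zero => exact hstep _ le_rfl
    | succ m ih =>
      rw [Function.iterate_succ_apply']
      exact hstep _ ih.le
  rw [← D.absVal_seq_zero_pow he]
  obtain ⟨m, rfl⟩ := Nat.exists_eq_succ_of_ne_zero hm.ne'
  exact pow_lt_pow_left₀ (h1 m) (by simp) he0.ne'

/-- The image of `E` in `W(R)`. -/
abbrev embedE : WittVector p (TiltR p K L) := D.embed (D.E : PowerSeries _)

theorem embedE_eq {e : ℕ} {G : Polynomial (WittVector p (ResField K))} (hG : IsUnit (G.coeff 0))
    (hE : D.E = Polynomial.X ^ e + Polynomial.C (p : WittVector p (ResField K)) * G) :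
    ∃ ε : WittVector p (TiltR p K L), IsUnit ε ∧ D.embedE = D.sect D.piR ^ e + p * ε := by
  refine ⟨D.embed (G : PowerSeries _), ?_, ?_⟩
  · refine IsUnit.map D.embed (PowerSeries.isUnit_iff_constantCoeff.2 ?_)
    simpa using hG
  · rw [embedE, hE]
    have hu : D.embed PowerSeries.X = D.sect D.piR := evalHom_X _ _
    have hC : D.embed (PowerSeries.C (p : WittVector p (ResField K))) = p := by
      rw [map_natCast, map_natCast]
    rw [Polynomial.coe_add, Polynomial.coe_mul, Polynomial.coe_pow, Polynomial.coe_X,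
      Polynomial.coe_C, map_add, map_mul, map_pow, hu, hC]

theorem coeff_zero_embedE {e : ℕ} {G : Polynomial (WittVector p (ResField K))}
    (hG : IsUnit (G.coeff 0))
    (hE : D.E = Polynomial.X ^ e + Polynomial.C (p : WittVector p (ResField K)) * G) :
    D.embedE.coeff 0 = D.piR ^ e := by
  obtain ⟨ε, -, h⟩ := D.embedE_eq hG hE
  have h1 := congrArg (WittVector.constantCoeff (p := p) (R := TiltR p K L)) h
  rw [map_add, map_mul, map_pow, map_natCast, CharP.cast_eq_zero, zero_mul, add_zero] at h1
  rw [← D.sect_coeff_zero D.piR]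
  exact h1

/-- The reduction of `E` modulo `p` has the valuation of `p`. -/
theorem tiltVal_embedE : tiltVal p K L (D.embedE.coeff 0) = absVal K L (p : L) := by
  obtain ⟨e, he0, he, G, hG, hE⟩ := D.exists_E_eq
  rw [D.coeff_zero_embedE hG hE, map_pow, D.tiltVal_piR he0 he, D.absVal_seq_zero_pow he]

/-- `θ(φᵐ(E))` is `p` times a unit for `m ≥ 1`. -/
theorem thetaMod_frobenius_embedE {m : ℕ} (hm : 0 < m) (n : ℕ) :
    ∃ u : BigIntegerRing K L, IsUnit u ∧ fontaineThetaModPPow (BigIntegerRing K L) p n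
      ((WittVector.frobenius : WittVector p (TiltR p K L) →+* _)^[m] D.embedE) =
        Ideal.Quotient.mk _ (p * u) := by
  obtain ⟨e, he0, he, G, hG, hE⟩ := D.exists_E_eq
  obtain ⟨ε, hε, h⟩ := D.embedE_eq hG hE
  have hlt := D.absVal_iterate_evalO_lt hm he0 he
  set τ := D.evalO^[m] (D.seq 0) with hτ
  obtain ⟨t, ht⟩ : (p : BigIntegerRing K L) ∣ τ ^ e := by
    rw [dvd_p_iff (absVal_integers K L), map_pow, map_pow]
    exact hlt.le
  have ht1 : absVal K L (t : L) < 1 := by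
    have h1 := congrArg (absVal K L) (congrArg Subtype.val ht)
    have h2 : absVal K L (τ : L) ^ e = absVal K L (p : L) * absVal K L (t : L) := by
      simpa using h1
    rw [h2] at hlt
    exact lt_of_mul_lt_mul_left (hlt.trans_eq (mul_one _).symm) (by simp)
  rw [← RingHom.coe_pow]
  set F := (WittVector.frobenius : WittVector p (TiltR p K L) →+* _) ^ m with hF
  obtain ⟨γ, hγ⟩ := Ideal.Quotient.mk_surjective
    (fontaineThetaModPPow (BigIntegerRing K L) p n (F ε))
  have hγu : absVal K L (γ : L) = 1 := by
    have h1 : IsUnit (Ideal.Quotient.mk (Ideal.span {(p : BigIntegerRing K L)} ^ (n + 1)) γ) := by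
      rw [hγ]
      exact (hε.map F).map _
    obtain ⟨δ', hδ⟩ := h1.exists_right_inv
    obtain ⟨δ, rfl⟩ := Ideal.Quotient.mk_surjective δ'
    rw [← map_mul, ← sub_eq_zero, ← map_one (Ideal.Quotient.mk _), ← map_sub,
      mk_eq_zero_iff_dvd] at hδ
    have h2 := (dvd_pow_self _ (Nat.succ_ne_zero n)).trans hδ
    rw [dvd_p_iff (absVal_integers K L)] at h2
    refine le_antisymm γ.2 (not_lt.1 fun hlt => ?_)
    have h3 : absVal K L ((γ : L) * δ) < 1 := by
      rw [map_mul]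
      exact (mul_le_of_le_one_right (by simp) δ.2).trans_lt hlt
    have h4 : absVal K L ((γ : L) * δ - 1) = 1 := by
      rw [Valuation.map_sub_eq_of_lt_right _ (by rwa [map_one]), map_one]
    have h5 : absVal K L ((γ : L) * δ - 1) ≤ absVal K L (p : L) := h2
    rw [h4] at h5
    exact absurd h5 (not_le.2 (absVal_p_lt_one p K L))
  -- `θ(φᵐ(E)) = τ ^ e + p γ` with `τ ^ e = p t`, where `γ` is a unit and `t` is not
  refine ⟨t + γ, ?_, ?_⟩
  · rw [isUnit_bigO_iff]
    push_cast
    rw [Valuation.map_add_eq_of_lt_right _ (by rwa [hγu]), hγu]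
  · have h1 : fontaineThetaModPPow (BigIntegerRing K L) p n (F (D.sect D.piR)) =
        Ideal.Quotient.mk _ τ := by
      rw [hF, RingHom.coe_pow]
      exact D.thetaMod_frobenius_sect n m
    rw [h, map_add, map_mul, map_pow, map_natCast, map_add, map_mul, map_pow, h1, ← hγ,
      map_natCast, ← map_pow, ht, mul_add]
    simp

theorem theta_embedE : theta p (BigIntegerRing K L) D.embedE = 0 := by
  rw [theta_eq_zero_iff]
  intro n
  have h1 : D.embedE = D.E.eval₂ (wittToWR p K L) (D.sect D.piR) := evalHom_coe _ _ _
  rw [h1, Polynomial.hom_eval₂]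
  have h2 : fontaineThetaModPPow (BigIntegerRing K L) p n (D.sect D.piR) =
      Ideal.Quotient.mk _ (D.seq 0) := D.thetaMod_frobenius_sect n 0
  have h3 : (fontaineThetaModPPow (BigIntegerRing K L) p n).comp (wittToWR p K L) =
      ((Ideal.Quotient.mk _).comp (inclO K L)).comp (wittToO p K) := by
    ext1 b
    exact thetaMod_wittToWR n b
  have h4 : D.E.eval₂ (wittToO p K) D.unif = 0 := by
    let : Algebra (WittVector p (ResField K)) (IntegerRing K) := (wittToO p K).toAlgebra
    exact minpoly.aeval (WittVector p (ResField K)) D.unif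
  rw [h2, h3, D.seq_zero, ← RingHom.comp_apply, ← Polynomial.hom_eval₂, h4, map_zero]

end IterateData
end Generator

/-! ### The ideal `I^{[1]}` and the ring `𝔖` -/

section IdealI1
variable {p : ℕ} [Fact p.Prime]
  {K : Type*} [NontriviallyNormedField K] [IsUltrametricDist K] [CompleteSpace K]
  [Fact (‖(p : K)‖ = (p : ℝ)⁻¹)]
  {L : Type*} [Field L] [Algebra K L] [Algebra.IsAlgebraic K L]

variable (p K L) in
theorem isDomain_tiltR : IsDomain (TiltR p K L) :=
  PreTilt.isDomain L (absVal K L) (BigIntegerRing K L) (absVal_integers K L) p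

theorem p_dvd_witt_iff {P : Type*} [CommRing P] [CharP P p] [PerfectRing P p]
    (x : WittVector p P) : (p : WittVector p P) ∣ x ↔ x.coeff 0 = 0 := by
  rw [← Ideal.mem_span_singleton, WittVector.mem_span_p_iff_coeff_zero_eq_zero]

theorem mem_I1_iff (z : WittVector p (TiltR p K L)) : z ∈ I1 p K L ↔
    ∀ n, theta p (BigIntegerRing K L)
      ((WittVector.frobenius : WittVector p (TiltR p K L) →+* _)^[n] z) = 0 := by
  rw [I1, Ideal.mem_iInf]
  refine forall_congr' fun n => ?_
  rw [Ideal.mem_comap, fil1, RingHom.mem_ker, RingHom.coe_pow]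

/-- The ideal `I^{[1]}` is saturated with respect to `p`. -/
theorem mem_I1_of_p_mul_mem {z : WittVector p (TiltR p K L)}
    (h : (p : WittVector p (TiltR p K L)) * z ∈ I1 p K L) : z ∈ I1 p K L := by
  rw [mem_I1_iff] at h ⊢
  intro n
  have h1 := h n
  rw [← RingHom.coe_pow, map_mul, map_natCast, RingHom.coe_pow] at h1
  exact theta_eq_zero_of_p_mul eq_zero_of_p_mul_bigO h1

/-- `W(R) / α I^{[1]}` has no `p`-torsion. -/
theorem mem_span_mul_I1_of_p_mul_mem {α z : WittVector p (TiltR p K L)} (hα : α.coeff 0 ≠ 0)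
    (h : (p : WittVector p (TiltR p K L)) * z ∈ Ideal.span {α} * I1 p K L) :
    z ∈ Ideal.span {α} * I1 p K L := by
  have := isDomain_tiltR p K L
  rw [Ideal.mem_span_singleton_mul] at h ⊢
  obtain ⟨y, hy, hyz⟩ := h
  have h1 : (p : WittVector p (TiltR p K L)) ∣ y := by
    rw [p_dvd_witt_iff]
    have h2 := (p_dvd_witt_iff (α * y)).1 ⟨z, hyz⟩
    have h3 : (α * y).coeff 0 = α.coeff 0 * y.coeff 0 :=
      map_mul (WittVector.constantCoeff (p := p) (R := TiltR p K L)) _ _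
    rw [h3] at h2
    exact (mul_eq_zero.1 h2).resolve_left hα
  obtain ⟨x, rfl⟩ := h1
  refine ⟨x, mem_I1_of_p_mul_mem hy, ?_⟩
  rw [← sub_eq_zero]
  apply WittVector.eq_zero_of_p_mul_eq_zero
  rw [sub_mul, sub_eq_zero, mul_assoc, mul_comm x, hyz, mul_comm]

variable [IsDiscreteValuationRing (IntegerRing K)] [PerfectField (ResField K)]

namespace IterateData
variable (D : IterateData p K L)

/-- `Fil¹ W(R)` is generated by `E`. Modulo `p`, every element of `Fil¹ W(R)` has valuation at least
`1` and is divisible by `E`; as `Fil¹ W(R)` is saturated, the remainder is `p` times an element of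
`Fil¹ W(R)`, and `W(R)` is `p`-adically complete. -/
theorem embedE_dvd {z : WittVector p (TiltR p K L)} (hz : theta p (BigIntegerRing K L) z = 0) :
    D.embedE ∣ z := by
  let J : Submodule (WittVector p (TiltR p K L)) (WittVector p (TiltR p K L)) := fil1 p K L
  let I : Ideal (WittVector p (TiltR p K L)) := Ideal.span {(p : WittVector p (TiltR p K L))}
  have hJ : ∀ x, x ∈ J ↔ theta p (BigIntegerRing K L) x = 0 := fun x => RingHom.mem_ker
  have : IsHausdorff I J := by
    refine ⟨fun x hx => Subtype.ext ?_⟩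
    refine IsHausdorff.haus (inferInstance : IsHausdorff I (WittVector p (TiltR p K L))) _
      fun n => ?_
    have h1 := hx n
    rw [SModEq.zero] at h1 ⊢
    exact map_mem_smul_top J.subtype h1
  let f : WittVector p (TiltR p K L) →ₗ[WittVector p (TiltR p K L)] J :=
    LinearMap.toSpanSingleton _ _ ⟨D.embedE, D.theta_embedE⟩
  have hsurj : Function.Surjective f := by
    apply surjective_of_mkQ_comp_surjective (I := I)
    intro y
    obtain ⟨⟨y, hy⟩, rfl⟩ := Submodule.Quotient.mk_surjective _ y
    have h1 : PreTilt.coeff 0 (y.coeff 0) = 0 := by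
      have h2 := (theta_eq_zero_iff y).1 ((hJ y).1 hy) 0
      rw [← map_zero (Ideal.Quotient.mk _), thetaMod_zero_eq_mk_iff] at h2
      exact h2.trans (map_zero _)
    have h2 := tiltVal_le_of_coeff_zero_eq_zero (absVal_integers K L) h1
    obtain ⟨t, ht⟩ := tilt_dvd_of_val_le (absVal_integers K L) (h2.trans D.tiltVal_embedE.ge)
    have h3 : (p : WittVector p (TiltR p K L)) ∣ y - WittVector.teichmuller p t * D.embedE := by
      rw [p_dvd_witt_iff]
      have h4 : (y - WittVector.teichmuller p t * D.embedE).coeff 0 =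
          y.coeff 0 - (WittVector.teichmuller p t).coeff 0 * D.embedE.coeff 0 := by
        rw [← WittVector.constantCoeff_apply, map_sub, map_mul]; rfl
      rw [h4, ht, WittVector.teichmuller_coeff_zero, mul_comm, sub_self]
    obtain ⟨x, hx⟩ := h3
    have hxJ : x ∈ J := by
      rw [hJ]
      apply theta_eq_zero_of_p_mul eq_zero_of_p_mul_bigO
      rw [← hx, map_sub, map_mul, D.theta_embedE, mul_zero, sub_zero]
      exact hy
    refine ⟨WittVector.teichmuller p t, ?_⟩
    rw [LinearMap.comp_apply, Submodule.mkQ_apply, eq_comm, Submodule.Quotient.eq]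
    have h5 : (⟨y, hy⟩ : J) - f (WittVector.teichmuller p t) =
        (p : WittVector p (TiltR p K L)) • (⟨x, hxJ⟩ : J) := Subtype.ext hx
    rw [h5]
    exact Submodule.smul_mem_smul (Ideal.mem_span_singleton_self _) trivial
  obtain ⟨w, hw⟩ := hsurj ⟨z, hz⟩
  exact ⟨w, (congrArg Subtype.val hw).symm.trans (mul_comm _ _)⟩

/-- `φ(I^{[1]}) ⊆ φ(E) I^{[1]}`: if `z = E w` lies in `I^{[1]}`, then so does `φ(w)`, as `θ(φⁿ(E))`
is not a zero divisor for `n ≥ 1`. -/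
theorem exists_frobenius_eq {z : WittVector p (TiltR p K L)} (hz : z ∈ I1 p K L) :
    ∃ w ∈ I1 p K L, WittVector.frobenius z = WittVector.frobenius D.embedE * w := by
  rw [mem_I1_iff] at hz
  obtain ⟨w, rfl⟩ := D.embedE_dvd (hz 0)
  refine ⟨WittVector.frobenius w, ?_, map_mul _ _ _⟩
  rw [mem_I1_iff]
  intro n
  rw [← Function.iterate_succ_apply]
  refine theta_eq_zero_of_mul eq_zero_of_p_mul_bigO
    (D.thetaMod_frobenius_embedE (Nat.succ_pos n)) ?_
  have h1 := hz (n + 1)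
  rw [← RingHom.coe_pow, map_mul, RingHom.coe_pow] at h1
  exact h1

theorem isNoetherianRing_S : IsNoetherianRing D.S := by
  have := charPResidue p (IntegerRing K)
  have : ExpChar (ResField K) p := ExpChar.prime Fact.out
  have : PerfectRing (ResField K) p := PerfectField.toPerfectRing p
  infer_instance

/-- `𝔖 / p` is the ring of power series over `k`. -/
theorem nonempty_quotient_equiv :
    Nonempty ((D.S ⧸ Ideal.span {(p : D.S)}) ≃+* PowerSeries (ResField K)) := by
  have := charPResidue p (IntegerRing K)
  have : ExpChar (ResField K) p := ExpChar.prime Fact.out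
  have : PerfectRing (ResField K) p := PerfectField.toPerfectRing p
  let m : D.S →+* PowerSeries (ResField K) :=
    PowerSeries.map (WittVector.constantCoeff (p := p) (R := ResField K))
  have hm : Function.Surjective m :=
    PowerSeries.map_surjective _ (WittVector.constantCoeff_surjective p)
  have hker : Ideal.span {(p : D.S)} = RingHom.ker m := by
    ext F
    rw [Ideal.mem_span_singleton, RingHom.mem_ker]
    constructor
    · rintro ⟨G, rfl⟩
      rw [map_mul, map_natCast]
      ext i
      rw [← map_natCast (PowerSeries.C (R := ResField K)), PowerSeries.coeff_C_mul,
        CharP.cast_eq_zero, zero_mul, map_zero]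
    · intro h
      have h1 : ∀ i, ∃ b, PowerSeries.coeff i F = p * b := fun i => by
        have h2 := congrArg (PowerSeries.coeff i) h
        rw [PowerSeries.coeff_map, map_zero] at h2
        exact (p_dvd_witt_iff _).2 h2
      choose b hb using h1
      refine ⟨PowerSeries.mk b, ?_⟩
      ext1 i
      rw [hb, ← map_natCast (PowerSeries.C (R := WittVector p (ResField K))),
        PowerSeries.coeff_C_mul, PowerSeries.coeff_mk]
  exact ⟨(Ideal.quotEquivOfEq hker).trans (RingHom.quotientKerEquivOfSurjective hm)⟩

theorem isDomain_quotient : IsDomain (D.S ⧸ Ideal.span {(p : D.S)}) :=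
  D.nonempty_quotient_equiv.some.toMulEquiv.isDomain _

theorem isPrincipalIdealRing_quotient : IsPrincipalIdealRing (D.S ⧸ Ideal.span {(p : D.S)}) :=
  IsPrincipalIdealRing.of_surjective D.nonempty_quotient_equiv.some.symm.toRingHom
    D.nonempty_quotient_equiv.some.symm.surjective

end IterateData
end IdealI1

/-! ### Equivariance of morphisms of Kisin modules -/

section Equivariance
open CategoryTheory
variable {p : ℕ} [Fact p.Prime]
  {K : Type*} [NontriviallyNormedField K] [IsUltrametricDist K] [CompleteSpace K]
  [Fact (‖(p : K)‖ = (p : ℝ)⁻¹)]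
  {L : Type*} [Field L] [Algebra K L] [Algebra.IsAlgebraic K L]

/-- The Galois action preserves the valuation of `R`. -/
theorem tiltVal_galO (g : L ≃ₐ[K] L) (x : TiltR p K L) :
    tiltVal p K L (tiltMap p (galO g) x) = tiltVal p K L x := by
  refine tiltVal_tiltMap (absVal_integers K L) (galO g) (fun z => ?_) x
  ext
  exact (spectralNorm_eq_of_equiv g (z : L)).symm

/-- The hypothesis on the valuation of `α` in multiplicative form. -/
theorem tiltVal_pow_lt {r : ℕ} {x : TiltR p K L} (hx : x ≠ 0)
    (hr : ((p * (r - 1) / (p - 1) : ℝ) : EReal) < vR p K L x) :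
    tiltVal p K L x ^ (p - 1) * absVal K L (p : L) ^ p < (absVal K L (p : L) ^ p) ^ r := by
  have hp := (Fact.out : p.Prime)
  have hp1 : (1 : ℝ) < p := by exact_mod_cast hp.one_lt
  have hp0 : (0 : ℝ) < p := by linarith
  rw [vR, if_neg hx, EReal.coe_lt_coe_iff] at hr
  have hpos : (0 : ℝ) < tiltVal p K L x := by
    rw [NNReal.coe_pos, pos_iff_ne_zero]
    exact fun h => hx ((PreTilt.map_eq_zero (absVal_integers K L)).1 h)
  have hr' : (p * (r - 1) / (p - 1) : ℝ) < -Real.logb p (tiltVal p K L x) := hr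
  rw [div_lt_iff₀ (by linarith)] at hr'
  rw [← NNReal.coe_lt_coe]
  push_cast
  rw [absVal_p p K L, ← Real.logb_lt_logb_iff hp1 (by positivity) (by positivity),
    Real.logb_mul (by positivity) (by positivity), Real.logb_pow, Real.logb_pow, Real.logb_pow,
    Real.logb_pow, Real.logb_inv, Real.logb_self_eq_one hp1, Nat.cast_sub hp.one_lt.le]
  push_cast
  linarith

variable [IsDiscreteValuationRing (IntegerRing K)] [PerfectField (ResField K)]
  {D : IterateData p K L}

theorem IsTorsionKisin.annihilatorsDivisible {r : ℕ} {M : PhiModule.{w} D.phiS}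
    (hM : IsTorsionKisin D r M) : AnnihilatorsDivisible (p : D.S) M := by
  intro s x hs hx
  have h1 : s ∈ Ideal.torsionOf D.S M x := (Ideal.mem_torsionOf_iff x s).2 hs
  rcases hM.torsionFree x hx with h | ⟨n, h⟩
  · rw [h, Ideal.mem_bot] at h1
    rw [h1]
    exact dvd_zero _
  · cases n with
    | zero =>
      rw [pow_zero, Ideal.span_singleton_one] at h
      have h2 : (1 : D.S) ∈ Ideal.torsionOf D.S M x := by rw [h]; trivial
      rw [Ideal.mem_torsionOf_iff, one_smul] at h2
      exact absurd h2 hx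
    | succ n =>
      rw [h, Ideal.mem_span_singleton] at h1
      exact (dvd_pow_self _ (Nat.succ_ne_zero n)).trans h1

/-- The defect of equivariance `y ↦ h(g y) - g(h y)` of the `W(R)`-linear extension of `h`. -/
def equivarianceDefect {M N : PhiGModule.{w} D} (h : M.under ⟶ N.under) (g : L ≃ₐ[K] L) :
    WRTensor D M.under →+ WRTensor D N.under :=
  (BaseChange.map (D.embed.comp D.phiS) h.lin).toAddMonoidHom.comp (M.act g) -
    (N.act g : WRTensor D N.under →+ WRTensor D N.under).comp
      (BaseChange.map (D.embed.comp D.phiS) h.lin).toAddMonoidHom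

theorem equivarianceDefect_apply {M N : PhiGModule.{w} D} (h : M.under ⟶ N.under)
    (g : L ≃ₐ[K] L) (y : WRTensor D M.under) :
    equivarianceDefect h g y = BaseChange.map (D.embed.comp D.phiS) h.lin (M.act g y) -
      N.act g (BaseChange.map (D.embed.comp D.phiS) h.lin y) := rfl

theorem equivarianceDefect_smul {M N : PhiGModule.{w} D} (h : M.under ⟶ N.under) (g : L ≃ₐ[K] L)
    (a : WittVector p (TiltR p K L)) (y : WRTensor D M.under) :
    equivarianceDefect h g (a • y) = galW p g a • equivarianceDefect h g y := by
  rw [equivarianceDefect_apply, equivarianceDefect_apply, M.act_smul, map_smul, map_smul,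
    N.act_smul, smul_sub]

theorem map_phiWR {M N : PhiModule.{w} D.phiS} (h : M ⟶ N) (y : WRTensor D M) :
    BaseChange.map (D.embed.comp D.phiS) h.lin (phiWR D M y) =
      phiWR D N (BaseChange.map (D.embed.comp D.phiS) h.lin y) :=
  PhiModule.map_extendPhi _ _ _ h.lin h.comm y

theorem equivarianceDefect_phi {M N : PhiGModule.{w} D} (h : M.under ⟶ N.under) (g : L ≃ₐ[K] L)
    (y : WRTensor D M.under) :
    equivarianceDefect h g (phiWR D M.under y) =
      phiWR D N.under (equivarianceDefect h g y) := by
  rw [equivarianceDefect_apply, equivarianceDefect_apply, M.act_phi, map_phiWR, map_phiWR,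
    N.act_phi, map_sub]

theorem frobenius_embed_pow_smul_tmul {M : PhiModule.{w} D.phiS} (F : D.S) (r : ℕ) (x : M) :
    WittVector.frobenius (D.embed F) ^ r • BaseChange.tmul (D.embed.comp D.phiS) 1 x =
      BaseChange.tmul (D.embed.comp D.phiS) 1 (F ^ r • x) := by
  have h1 : WittVector.frobenius (D.embed F) = (D.embed.comp D.phiS) F :=
    RingHom.congr_fun D.frobenius_comp_embed F
  rw [h1, ← map_pow, BaseChange.smul_tmul, BaseChange.mul_tmul]

theorem frobenius_embedE_pow_smul_tmul {M : PhiModule.{w} D.phiS} (r : ℕ) (x : M) :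
    WittVector.frobenius D.embedE ^ r • BaseChange.tmul (D.embed.comp D.phiS) 1 x =
      BaseChange.tmul (D.embed.comp D.phiS) 1
        ((D.E : PowerSeries (WittVector p (ResField K))) ^ r • x) :=
  frobenius_embed_pow_smul_tmul _ r x

theorem smul_phiWR_tmul_one {M : PhiModule.{w} D.phiS} (s : D.S) (x : M) :
    (D.embed.comp D.phiS) s • phiWR D M (BaseChange.tmul (D.embed.comp D.phiS) 1 x) =
      BaseChange.tmul (D.embed.comp D.phiS) 1 (s • M.phi x) := by
  have h3 : phiWR D M (BaseChange.tmul (D.embed.comp D.phiS) 1 x) =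
      BaseChange.tmul (D.embed.comp D.phiS) (WittVector.frobenius 1) (M.phi x) := rfl
  rw [h3, map_one, BaseChange.smul_tmul, BaseChange.mul_tmul]

/-- The span of the values of the defect of equivariance on `M`. -/
def defectSpan {M N : PhiGModule.{w} D} (h : M.under ⟶ N.under) (g : L ≃ₐ[K] L) :
    Submodule (WittVector p (TiltR p K L)) (WRTensor D N.under) :=
  Submodule.span _ (Set.range fun x : M.under =>
    equivarianceDefect h g (BaseChange.tmul (D.embed.comp D.phiS) 1 x))

theorem equivarianceDefect_tmul_mem {M N : PhiGModule.{w} D} (h : M.under ⟶ N.under)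
    (g : L ≃ₐ[K] L) (x : M.under) :
    equivarianceDefect h g (BaseChange.tmul (D.embed.comp D.phiS) 1 x) ∈ defectSpan h g :=
  Submodule.subset_span ⟨x, rfl⟩

/-- On the image of the linearization of `φ`, the defect takes values in the span of the `φ`-images
of its values. -/
theorem equivarianceDefect_linearization_mem {M N : PhiGModule.{w} D} (h : M.under ⟶ N.under)
    (g : L ≃ₐ[K] L) (y : BaseChange D.phiS M.under) :
    equivarianceDefect h g
        (BaseChange.tmul (D.embed.comp D.phiS) 1 (M.under.linearization y)) ∈
      Submodule.span (WittVector p (TiltR p K L)) (phiWR D N.under '' defectSpan h g) := by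
  induction y using BaseChange.induction_on with
  | zero =>
    rw [map_zero, BaseChange.tmul_zero, map_zero]
    exact Submodule.zero_mem _
  | tmul s x =>
    have h1 : M.under.linearization (BaseChange.tmul D.phiS s x) = s • M.under.phi x := rfl
    rw [h1, ← smul_phiWR_tmul_one, equivarianceDefect_smul, equivarianceDefect_phi]
    exact Submodule.smul_mem _ _ (Submodule.subset_span
      ⟨_, equivarianceDefect_tmul_mem h g x, rfl⟩)
  | add y z hy hz =>
    rw [map_add, BaseChange.tmul_add, map_add]
    exact Submodule.add_mem _ hy hz

theorem defectSpan_le {α : WittVector p (TiltR p K L)} {r r' : ℕ}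
    {M N : PhiGModule.{w} D} (hM : IsTorsionAlpha D r α M) (hN : IsTorsionAlpha D r' α N)
    (h : M.under ⟶ N.under) (g : L ≃ₐ[K] L) :
    defectSpan h g ≤ (Ideal.span {α} * I1 p K L) • ⊤ := by
  rw [defectSpan, Submodule.span_le]
  rintro _ ⟨x, rfl⟩
  have h1 := map_mem_smul_top (BaseChange.map (D.embed.comp D.phiS) h.lin) (hM.congr g x)
  have h2 := hN.congr g (h.lin x)
  rw [map_sub, BaseChange.map_tmul] at h1
  have h3 := Submodule.sub_mem _ h1 h2
  rw [sub_sub_sub_cancel_right] at h3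
  exact h3

/-- The height condition: `E ^ r x` lies in the image of the linearization of `φ`, and the defect is
`g`-semilinear. -/
theorem smul_mem_span_phiWR_defectSpan {r : ℕ} {M N : PhiGModule.{w} D}
    (hM : IsTorsionKisin D r M.under) (h : M.under ⟶ N.under) (g : L ≃ₐ[K] L)
    {y : WRTensor D N.under} (hy : y ∈ defectSpan h g) :
    galW p g (WittVector.frobenius D.embedE) ^ r • y ∈
      Submodule.span (WittVector p (TiltR p K L)) (phiWR D N.under '' defectSpan h g) := by
  have h1 : defectSpan h g ≤ (Submodule.span (WittVector p (TiltR p K L))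
      (phiWR D N.under '' defectSpan h g)).comap
        (LinearMap.lsmul _ _ (galW p g (WittVector.frobenius D.embedE) ^ r)) := by
    rw [defectSpan, Submodule.span_le]
    rintro _ ⟨x, rfl⟩
    obtain ⟨z, hz⟩ := hM.height x
    have h2 := equivarianceDefect_linearization_mem h g z
    rw [hz, ← frobenius_embedE_pow_smul_tmul, equivarianceDefect_smul, map_pow] at h2
    exact h2
  exact h1 hy

/-- The values of the defect on `M` span a contracted submodule. -/
theorem isContracted_defectSpan {α : WittVector p (TiltR p K L)} {r r' : ℕ}
    {M N : PhiGModule.{w} D} (hM : IsTorsionAlpha D r α M) (hN : IsTorsionAlpha D r' α N)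
    (h : M.under ⟶ N.under) (g : L ≃ₐ[K] L) :
    IsContracted (D.embed.comp D.phiS) WittVector.frobenius (by
      rw [← RingHom.comp_assoc, D.frobenius_comp_embed]) (Ideal.span {α} * I1 p K L)
      (galW p g (WittVector.frobenius D.embedE) ^ r) N.under (defectSpan h g) :=
  ⟨defectSpan_le hM hN h g, fun _ hy => smul_mem_span_phiWR_defectSpan hM.torsionKisin h g hy⟩

theorem equivarianceDefect_eq_zero {α : WittVector p (TiltR p K L)}
    (hα : α ∉ Ideal.span {(p : WittVector p (TiltR p K L))}) {r r' : ℕ}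
    (hr : ((p * (r - 1) / (p - 1) : ℝ) : EReal) < vR p K L (α.coeff 0))
    {M N : PhiGModule.{w} D} (hM : IsTorsionAlpha D r α M) (hN : IsTorsionAlpha D r' α N)
    (h : M.under ⟶ N.under) (g : L ≃ₐ[K] L) : equivarianceDefect h g = 0 := by
  have hp := (Fact.out : p.Prime)
  have hα0 : α.coeff 0 ≠ 0 := fun h0 => hα (by
    rwa [WittVector.mem_span_p_iff_coeff_zero_eq_zero])
  have := isDomain_tiltR p K L
  have := D.isNoetherianRing_S
  have := D.isDomain_quotient
  have := D.isPrincipalIdealRing_quotient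
  have hlam : tiltVal p K L ((WittVector.frobenius D.embedE).coeff 0) = absVal K L (p : L) ^ p := by
    rw [WittVector.coeff_frobenius_charP, map_pow, D.tiltVal_embedE]
  obtain ⟨n, hn⟩ := hN.torsionKisin.torsion
  have hbot := IsContracted.eq_bot_of_eq_bot_of_killed (D.embed.comp D.phiS)
    WittVector.frobenius (by rw [← RingHom.comp_assoc, D.frobenius_comp_embed]) p
    (Ideal.span {α} * I1 p K L) (galW p g (WittVector.frobenius D.embedE) ^ r)
    (fun z hz => WittVector.eq_zero_of_p_mul_eq_zero z (by rwa [mul_comm]))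
    (fun z hz => mem_span_mul_I1_of_p_mul_mem hα0 hz)
    (IsContracted.eq_bot_of_killed (D.embed.comp D.phiS)
      WittVector.frobenius _ p (WittVector.constantCoeff (p := p) (R := TiltR p K L))
      (WittVector.constantCoeff_surjective p) (fun x => (p_dvd_witt_iff x).symm)
      (tiltVal p K L) (fun x => (PreTilt.map_eq_zero (absVal_integers K L)).1)
      (tiltVal_le_one (absVal_integers K L))
      (fun x y => tilt_dvd_of_val_le (absVal_integers K L))
      (fun x => WittVector.coeff_frobenius_charP p x 0)
      (ε := WittVector.frobenius D.embedE) (fun z hz => D.exists_frobenius_eq hz)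
      (by
        rw [WittVector.constantCoeff_apply, hlam]
        exact pow_ne_zero _ (absVal_p_ne_zero p K L))
      (by
        rw [WittVector.constantCoeff_apply, WittVector.constantCoeff_apply, galW,
          WittVector.map_coeff, tiltVal_galO])
      r hp.ne_zero
      (by
        rw [WittVector.constantCoeff_apply, WittVector.constantCoeff_apply, hlam]
        exact tiltVal_pow_lt hα0 hr))
    n N.under hN.torsionKisin.finite hn hN.torsionKisin.annihilatorsDivisible _
    (isContracted_defectSpan hM hN h g)
  ext y
  rw [AddMonoidHom.zero_apply]
  induction y using BaseChange.induction_on with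
  | zero => exact map_zero _
  | tmul a x =>
    have h1 : equivarianceDefect h g (BaseChange.tmul (D.embed.comp D.phiS) 1 x) = 0 := by
      rw [← Submodule.mem_bot (WittVector p (TiltR p K L)), ← hbot]
      exact equivarianceDefect_tmul_mem h g x
    rw [← mul_one a, ← BaseChange.smul_tmul, equivarianceDefect_smul, h1, smul_zero]
  | add y z hy hz => rw [map_add, hy, hz, add_zero]

theorem PhiGModule.forget_map_bijective {α : WittVector p (TiltR p K L)}
    (hα : α ∉ Ideal.span {(p : WittVector p (TiltR p K L))}) {r r' : ℕ}
    (hr : ((p * (r - 1) / (p - 1) : ℝ) : EReal) < vR p K L (α.coeff 0))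
    {M N : PhiGModule.{w} D} (hM : IsTorsionAlpha D r α M) (hN : IsTorsionAlpha D r' α N) :
    Function.Bijective (PhiGModule.forget.map :
      (M ⟶ N) → (PhiGModule.forget.obj M ⟶ PhiGModule.forget.obj N)) := by
  constructor
  · intro f g hfg
    exact PhiGModule.Hom.ext hfg
  · intro (h : M.under ⟶ N.under)
    refine ⟨⟨h, fun g x => sub_eq_zero.1 ?_⟩, rfl⟩
    exact DFunLike.congr_fun (equivarianceDefect_eq_zero hα hr hM hN h g) x

end Equivariance

end CaisLiu

end

theorem mainTheorem10 (p : ℕ) [Fact p.Prime]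
    (K : Type*) [NontriviallyNormedField K] [IsUltrametricDist K] [CompleteSpace K]
    [Fact (‖(p : K)‖ = (p : ℝ)⁻¹)]
    [IsDiscreteValuationRing (CaisLiu.IntegerRing K)] [PerfectField (CaisLiu.ResField K)]
    (L : Type*) [Field L] [Algebra K L] [Algebra.IsAlgebraic K L] [IsAlgClosed L]
    (D : CaisLiu.IterateData p K L)
    (α : WittVector p (CaisLiu.TiltR p K L))
    (hα : α ∉ Ideal.span {(p : WittVector p (CaisLiu.TiltR p K L))})
    (r : ℕ)
    (hr : ((p * (r - 1) / (p - 1) : ℝ) : EReal) < CaisLiu.vR p K L (α.coeff 0)) :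
    (∀ (r' : ℕ) (M N : CaisLiu.PhiGModule.{w} D),
      CaisLiu.IsTorsionAlpha D r α M → CaisLiu.IsTorsionAlpha D r' α N →
        Function.Bijective
          (CaisLiu.PhiGModule.forget.map : (M ⟶ N) →
            (CaisLiu.PhiGModule.forget.obj M ⟶ CaisLiu.PhiGModule.forget.obj N))) ∧
    (CaisLiu.forgetTorsion.{w} D r α).Full ∧ (CaisLiu.forgetTorsion.{w} D r α).Faithful := by
  refine ⟨fun r' M N hM hN => CaisLiu.PhiGModule.forget_map_bijective hα hr hM hN, ⟨?_⟩, ⟨?_⟩⟩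
  · intro M N h
    obtain ⟨f, hf⟩ := (CaisLiu.PhiGModule.forget_map_bijective hα hr M.property N.property).2 h.hom
    exact ⟨⟨f⟩, CategoryTheory.ObjectProperty.hom_ext _ hf⟩
  · intro M N f f' hff
    refine CategoryTheory.ObjectProperty.hom_ext _ ?_
    refine (CaisLiu.PhiGModule.forget_map_bijective hα hr M.property N.property).1 ?_
    exact congrArg (fun k => k.hom) hff
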